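/- Let $N \ge 1$ be an integer, $a \in (-1,1)$, $R > 0$ and $h > 0$, and assume that $A := N + a + 2h - 1 > 0$ (this is automatic if $N \ge 2$). Write points of $\mathbb{R}^{N+1}$ as $Y = (y_0, y)$ with $y_0 \in \mathbb{R}$, $y \in \mathbb{R}^N$. For $r > 0$ let $\mathbb{D}_r = \{Y : y_0 > 0,\ |Y| < r\}$ and $\mathbb{H}_r = \{Y : y_0 > 0,\ |Y| = r\}$, the latter with its surface measure $d\eta$. For an open $\Omega \subset \{y_0 > 0\}$, $H^1(\Omega, y_0^a)$ is the closure of $C^\infty(\Omega)$ under the norm $\left(\int_\Omega (|\varphi|^2 + |\nabla \varphi|^2)\, y_0^a \, dY\right)^{1/2}$, and $H^1_{loc}(\mathbb{D}_R, y_0^a)$ is the space of functions that belong to $H^1(\mathbb{D}_\rho, y_0^a)$ for every $\rho \in (0,R)$. Let $V \in H^1_{loc}(\mathbb{D}_R, y_0^a)$. Then for every $r \in (0,R)$, $V$ has a trace on $\mathbb{H}_r$ in $L^2(\mathbb{H}_r, y_0^a\, d\eta)$ (the limit of the restrictions to $\mathbb{H}_r$ of smooth functions converging to $V$ in $H^1(\mathbb{D}_\rho,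 y_0^a)$, for some $\rho \in (r,R)$); values of $V$ on $\mathbb{H}_r$ are understood in this sense. Define $$W_h(r;V) = \frac{1}{r^{A}} \int_{\mathbb{D}_r} |\nabla V|^2 y_0^a \, dY - \frac{h}{r^{A+1}} \int_{\mathbb{H}_r} |V|^2 y_0^a \, d\eta ,$$ and, for a given $r$, let $\bar V(Y) = \left(\frac{|Y|}{r}\right)^h V\!\left(\frac{rY}{|Y|}\right)$ be the $h$-homogeneous extension of $V$ from $\mathbb{H}_r$. (1) For a.e. $r \in (0,R)$, $\bar V \in H^1(\mathbb{D}_r, y_0^a)$, the last integral below is finite, $W_h(\cdot\,; V)$ is differentiable at $r$, and $$\frac{d}{dr} W_h(r;V) = \frac{A}{r}\left[ W_h(r;\bar V) - W_h(r;V) \right] + \frac{1}{r^{A+2}} \int_{\mathbb{H}_r} \left[ Y \cdot \nabla V - hV \right]^2 y_0^a \, d\eta. \qquad (*)$$ (2) Suppose in addition that $V \in C^2(\mathbb{D}_R)$, that $y_0^{-a}\,\mathrm{div}(y_0^a \nabla V) = \Delta_y V + \frac{a}{y_0}\partial_{y_0} V + \partial_{y_0}^2 V$ belongs to $L^2(\mathbb{D}_\rho,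 y_0^a)$ for every $\rho \in (0,R)$, and that $V$ satisfies the elliptic boundary conditions: there is $\varepsilon_0 > 0$ such that $y_0^a \partial_{y_0} V$ is bounded on $\mathbb{D}_R \cap \{y_0 < \varepsilon_0\}$, and for every $y \in \mathbb{R}^N$ with $|y| < R$, either (I) $\lim_{y_0 \to 0^+} y_0^a \partial_{y_0} V(y_0,y) = 0$, or (II) $\lim_{y_0 \to 0^+} V(y_0,y) = 0$ and $\lim_{y_0 \to 0^+} \nabla_y V(y_0,y) = 0$. Then all assertions of (1), including $(*)$, hold for every $r \in (0,R)$. -/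

import Mathlib

open MeasureTheory Set Filter Topology
open scoped ENNReal ContDiff

noncomputable section

namespace EllipticWeiss

/-- The ambient space `ℝ^{N+1}`; the coordinate `Y 0` is the distinguished variable `y₀`, the
coordinates `Y 1, …, Y N` form the vector `y`. -/
abbrev Space (N : ℕ) : Type := EuclideanSpace ℝ (Fin (N + 1))

/-- The point `(t, y)` of `ℝ^{N+1}`, with `t ∈ ℝ` and `y ∈ ℝ^N`. -/
def mkPoint {N : ℕ} (t : ℝ) (y : EuclideanSpace ℝ (Fin N)) : Space N :=
  WithLp.toLp 2 (Fin.cons t y.ofLp)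

/-- The open half-ball `D_r = {Y : y₀ > 0, |Y| < r}`. -/
def halfBall (N : ℕ) (r : ℝ) : Set (Space N) := {Y | 0 < Y 0 ∧ ‖Y‖ < r}

/-- The canonical surface measure `η` of the half-sphere `H_r = {Y : y₀ > 0, |Y| = r}`, as a measure
on `ℝ^{N+1}`: the image of the surface measure of the unit sphere under `z ↦ r z`, multiplied by
`r ^ N` and restricted to the open upper half-space. -/
def halfSphereMeasure (N : ℕ) (r : ℝ) : Measure (Space N) :=
  (ENNReal.ofReal (r ^ N) •
    Measure.map (fun z : Metric.sphere (0 : Space N) 1 => r • z.1)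
      (Measure.toSphere (volume : Measure (Space N)))).restrict {Y | 0 < Y 0}

/-- The measure `y₀ ^ a dY` on `Ω` (used for subsets `Ω` of the upper half-space). -/
def weightedVolume {N : ℕ} (a : ℝ) (Ω : Set (Space N)) : Measure (Space N) :=
  (volume.restrict Ω).withDensity fun Y => ENNReal.ofReal ((Y 0) ^ a)

/-- The measure `y₀ ^ a dη` on the half-sphere `H_r`. -/
def weightedSphere (N : ℕ) (a r : ℝ) : Measure (Space N) :=
  (halfSphereMeasure N r).withDensity fun Y => ENNReal.ofReal ((Y 0) ^ a)

/-- `φ n` is a sequence of functions in `C^∞(Ω)` with finite `H¹(Ω, y₀ ^ a)` norm, such that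
`φ n → V` and `∇ (φ n) → G` in `L²(Ω, y₀ ^ a)`. -/
def SmoothApprox {N : ℕ} (a : ℝ) (Ω : Set (Space N)) (φ : ℕ → Space N → ℝ)
    (V : Space N → ℝ) (G : Space N → Space N) : Prop :=
  (∀ n, ContDiffOn ℝ ∞ (φ n) Ω ∧ MemLp (φ n) 2 (weightedVolume a Ω) ∧
      MemLp (gradient (φ n)) 2 (weightedVolume a Ω)) ∧
    Tendsto (fun n => eLpNorm (fun Y => φ n Y - V Y) 2 (weightedVolume a Ω)) atTop (𝓝 0) ∧
    Tendsto (fun n => eLpNorm (fun Y => gradient (φ n) Y - G Y) 2 (weightedVolume a Ω))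
      atTop (𝓝 0)

/-- `V` belongs to the weighted Sobolev space `H¹(Ω, y₀ ^ a)`, the closure of `C^∞(Ω)` under the
`H¹(Ω, y₀ ^ a)` norm, and `G` is its gradient. -/
def HasH1Gradient {N : ℕ} (a : ℝ) (Ω : Set (Space N))
    (V : Space N → ℝ) (G : Space N → Space N) : Prop :=
  MemLp V 2 (weightedVolume a Ω) ∧ MemLp G 2 (weightedVolume a Ω) ∧
    ∃ φ : ℕ → Space N → ℝ, SmoothApprox a Ω φ V G

/-- `V ∈ H¹_loc(D_R, y₀ ^ a)` with gradient `G`: `V ∈ H¹(D_ρ, y₀ ^ a)` for every `ρ ∈ (0, R)`. -/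
def HasH1LocGradient {N : ℕ} (a R : ℝ) (V : Space N → ℝ) (G : Space N → Space N) : Prop :=
  ∀ ρ ∈ Ioo 0 R, HasH1Gradient a (halfBall N ρ) V G

/-- `u ∈ L²(H_r, y₀ ^ a dη)` is the trace on the half-sphere `H_r` of `V ∈ H¹_loc(D_R, y₀ ^ a)`:
the `L²` limit of the restrictions to `H_r` of smooth functions that converge to `V` in
`H¹(D_ρ, y₀ ^ a)` for some `ρ ∈ (r, R)`. -/
def IsTrace {N : ℕ} (a R : ℝ) (V : Space N → ℝ) (G : Space N → Space N) (r : ℝ)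
    (u : Space N → ℝ) : Prop :=
  MemLp u 2 (weightedSphere N a r) ∧
    ∃ ρ ∈ Ioo r R, ∃ φ : ℕ → Space N → ℝ, SmoothApprox a (halfBall N ρ) φ V G ∧
      Tendsto (fun n => eLpNorm (fun Y => φ n Y - u Y) 2 (weightedSphere N a r)) atTop (𝓝 0)

/-- `D(r) = ∫_{D_r} |∇V|² y₀ ^ a dY`, for the gradient field `G = ∇V`. -/
def energyD {N : ℕ} (a r : ℝ) (G : Space N → Space N) : ℝ :=
  ∫ Y, ‖G Y‖ ^ 2 ∂(weightedVolume a (halfBall N r))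

/-- `H(r) = ∫_{H_r} |V|² y₀ ^ a dη`, where `u` gives the values of `V` on `H_r`. -/
def heightH {N : ℕ} (a r : ℝ) (u : Space N → ℝ) : ℝ :=
  ∫ Y, (u Y) ^ 2 ∂(weightedSphere N a r)

/-- The exponent `A = N + a + 2 h - 1`. -/
def expA (N : ℕ) (a h : ℝ) : ℝ := N + a + 2 * h - 1

/-- The Weiss functional `W_h(r; V) = r ^ (-A) D(r; V) - h r ^ (-A - 1) H(r; V)` of a function with
values `u` on `H_r` and gradient `G` in `D_r`. -/
def weissW {N : ℕ} (a h r : ℝ) (u : Space N → ℝ) (G : Space N → Space N) : ℝ :=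
  1 / r ^ expA N a h * energyD a r G - h / r ^ (expA N a h + 1) * heightH a r u

/-- The `h`-homogeneous extension `Y ↦ (|Y| / r) ^ h u (r Y / |Y|)` of a function `u` on `H_r`. -/
def homExt {N : ℕ} (h r : ℝ) (u : Space N → ℝ) (Y : Space N) : ℝ :=
  (‖Y‖ / r) ^ h * u ((r / ‖Y‖) • Y)

/-- The Weiss identity at the radius `r`, for a function `V` with values (traces) `T s` on the
half-spheres `H_s` and with gradient `G`. It includes that the objects on the right-hand side are
well defined: the `h`-homogeneous extension of `V` from `H_r` belongs to `H¹(D_r, y₀ ^ a)`, and the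
last integral converges. -/
def WeissIdentityAt {N : ℕ} (a h : ℝ) (T : ℝ → Space N → ℝ) (G : Space N → Space N)
    (r : ℝ) : Prop :=
  Integrable (fun Y => (inner ℝ Y (G Y) - h * T r Y) ^ 2) (weightedSphere N a r) ∧
    ∃ Gbar : Space N → Space N,
      HasH1Gradient a (halfBall N r) (homExt h r (T r)) Gbar ∧
      HasDerivAt (fun s => weissW a h s (T s) G)
        (expA N a h / r * (weissW a h r (homExt h r (T r)) Gbar - weissW a h r (T r) G) +
          1 / r ^ (expA N a h + 2) *
            ∫ Y, (inner ℝ Y (G Y) - h * T r Y) ^ 2 ∂(weightedSphere N a r)) r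

/-- The elliptic boundary conditions for a function `V` that is differentiable in `D_R`:
`y₀ ^ a ∂_{y₀} V` is bounded in `D_R ∩ {y₀ < ε₀}` for some `ε₀ > 0`, and for every `y ∈ ℝ^N` with
`|y| < R`, as `y₀ → 0⁺`, either (I) `y₀ ^ a ∂_{y₀} V(y₀, y) → 0`, or (II) `V(y₀, y) → 0` and
`∇_y V(y₀, y) → 0`. -/
def EllipticBC {N : ℕ} (a R : ℝ) (V : Space N → ℝ) : Prop :=
  (∃ ε₀ > 0, ∃ M : ℝ, ∀ Y ∈ halfBall N R, Y 0 < ε₀ → |(Y 0) ^ a * gradient V Y 0| ≤ M) ∧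
    ∀ y : EuclideanSpace ℝ (Fin N), ‖y‖ < R →
      (Tendsto (fun t : ℝ => t ^ a * gradient V (mkPoint t y) 0) (𝓝[>] 0) (𝓝 0)) ∨
      (Tendsto (fun t : ℝ => V (mkPoint t y)) (𝓝[>] 0) (𝓝 0) ∧
        ∀ i : Fin N,
          Tendsto (fun t : ℝ => gradient V (mkPoint t y) i.succ) (𝓝[>] 0) (𝓝 0))

/-- `y₀ ^ (-a) div (y₀ ^ a ∇V) = Δ_y V + (a / y₀) ∂_{y₀} V + ∂²_{y₀} V`, for `V` of class `C²`. -/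
def weightedLaplacian {N : ℕ} (a : ℝ) (V : Space N → ℝ) (Y : Space N) : ℝ :=
  Laplacian.laplacian V Y + a / Y 0 * gradient V Y 0

end EllipticWeiss

end

/-! Dilation carries every half-sphere `H_r` onto the unit one, with the fixed measure `dσ = θ₀^a
dη`. There `D(r) = ∫₀^r s^(N+a) ∫ |G(sθ)|² dσ ds` and `H(r) = r^(N+a) X(r)` with `X(r) = ∫ V(rθ)²
dσ`, so formally `D' = r^(N+a) P` and `X' = S`, where `P = ∫ |G(rθ)|² dσ` and `S = 2 ∫ V (θ·G) dσ`.
The homogeneous extension has the same height as `V`; its gradient keeps the tangential part of `G`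
and has radial part `hV/r`, so its energy is `r^(N+a+1)/A · (h² X/r² + P - Q)` with `Q = ∫ (θ·G)²
dσ`. The radial integral of `s^(A-1)` converges because `A > 0`. Since `N + a = A - 2h + 1`, the
identity `(*)` is then pure algebra: `weissIdentityAt_of_hasDerivAt`. What must be justified at a
given radius is that `D` and `X` have the expected derivatives, that `G(r·)` is in `L²(dσ)`, and
that the extension is in `H¹`. The last point follows from `SphereApprox`: smooth functions
approximating `V` and `G` in `L²` on `H_r` extend homogeneously to approximants on the half-ball.

For almost every radius, Lebesgue differentiation gives the derivative of `D`. The formula for the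
increments of `X` (`height_sub`) passes to the limit from smooth functions, whose traces are
controlled by a Sobolev inequality on rays. `SphereApprox` comes from Fatou's lemma applied to the
approximation errors on spheres.

For every radius, it is enough that `r ↦ ∇V(r·)` is continuous into `L²(dσ)`; as `∇V` is continuous
inside, only concentration at the equator has to be excluded (`exists_gradient_tail_le`). The
gradient at a point `X` close to the flat boundary is expressed by averages over balls that rise
away from the boundary and whose radius grows in proportion to the time. Along these balls,
integration by parts against a radial bump trades all second derivatives of `V` for `∂₀V`, which is
`O(y₀^(-a))`, and `ΔV`, that is, the weighted Laplacian up to `a/y₀ · ∂₀V`. The term from `∂₀V` is a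
power of the height that is square integrable for `dσ`. The term from the weighted Laplacian is
squared by Cauchy–Schwarz and integrated over the sphere by Tonelli and a bound for the weight on
spherical caps (`lintegral_lift_le`); there is room to do this with a weight `θ₀^p`, `p < a`, whence
a gain `δ^(a-p)` on `{θ₀ < δ}`. Continuity then gives both derivatives at every radius, and
`SphereApprox` is carried from good radii to nearby ones by dilation. -/

noncomputable section

namespace EllipticWeiss

variable {N : ℕ}

/-! ### Half-balls, half-spheres and polar coordinates -/

lemma measurable_coord (i : Fin (N + 1)) : Measurable fun Y : Space N => Y i := by
  fun_prop

lemma measurable_weight (a : ℝ) : Measurable fun Y : Space N => ENNReal.ofReal ((Y 0) ^ a) := by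
  have := measurable_coord (N := N) 0
  fun_prop

lemma isOpen_halfBall (r : ℝ) : IsOpen (halfBall N r) := by
  have h1 : IsOpen {Y : Space N | 0 < Y 0} := isOpen_lt continuous_const (by fun_prop)
  have h2 : IsOpen {Y : Space N | ‖Y‖ < r} := isOpen_lt continuous_norm continuous_const
  exact h1.inter h2

lemma measurableSet_halfBall (r : ℝ) : MeasurableSet (halfBall N r) :=
  (isOpen_halfBall r).measurableSet

lemma halfBall_mono {r s : ℝ} (h : r ≤ s) : halfBall N r ⊆ halfBall N s :=
  fun _ hY => ⟨hY.1, hY.2.trans_le h⟩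

lemma measurableSet_upper : MeasurableSet {Y : Space N | 0 < Y 0} :=
  measurableSet_lt measurable_const (measurable_coord 0)

instance sFinite_weightedSphere (N : ℕ) (a r : ℝ) : SFinite (weightedSphere N a r) := by
  unfold weightedSphere halfSphereMeasure; infer_instance

/-- Integration over the half-sphere in terms of the surface measure of the unit sphere. -/
lemma lintegral_weightedSphere_eq (a : ℝ) {r : ℝ} {F : Space N → ℝ≥0∞} (hF : Measurable F) :
    ∫⁻ Y, F Y ∂(weightedSphere N a r) = ENNReal.ofReal (r ^ N) *
      ∫⁻ z : Metric.sphere (0 : Space N) 1, {Y : Space N | 0 < Y 0}.indicator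
        (fun Y => ENNReal.ofReal ((Y 0) ^ a) * F Y) (r • z.1)
        ∂(Measure.toSphere (volume : Measure (Space N))) := by
  have hm : Measurable fun z : Metric.sphere (0 : Space N) 1 => r • z.1 :=
    measurable_subtype_coe.const_smul r
  unfold weightedSphere halfSphereMeasure
  rw [lintegral_withDensity_eq_lintegral_mul _ (measurable_weight a) hF,
    ← lintegral_indicator measurableSet_upper, lintegral_smul_measure, lintegral_map _ hm]
  · rfl
  · exact ((measurable_weight a).mul hF).indicator measurableSet_upper

/-- The surface measure contributes `r^N` and the weight `r^a`. Functions on half-spheres of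
different radii thereby become functions in one `L²` space on the unit half-sphere. -/
lemma lintegral_weightedSphere (a : ℝ) {r : ℝ} (hr : 0 < r) {F : Space N → ℝ≥0∞}
    (hF : Measurable F) :
    ∫⁻ Y, F Y ∂(weightedSphere N a r) = ENNReal.ofReal (r ^ (N + a)) *
      ∫⁻ θ, F (r • θ) ∂(weightedSphere N a 1) := by
  have hF' : Measurable fun θ => F (r • θ) := hF.comp (measurable_const_smul r)
  rw [lintegral_weightedSphere_eq a hF, lintegral_weightedSphere_eq a hF',
    Real.rpow_add hr, Real.rpow_natCast, ENNReal.ofReal_mul (by positivity), mul_assoc]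
  congr 1
  simp only [one_pow, ENNReal.ofReal_one, one_mul, one_smul]
  have hm : Measurable fun z : Metric.sphere (0 : Space N) 1 => z.1 := measurable_subtype_coe
  rw [← lintegral_const_mul]
  · refine lintegral_congr fun z => ?_
    by_cases hz : 0 < z.1 0
    · have h2 : (0 : ℝ) < (r • z.1) 0 := by simpa using mul_pos hr hz
      rw [indicator_of_mem (show r • z.1 ∈ {Y : Space N | 0 < Y 0} from h2),
        indicator_of_mem (show z.1 ∈ {Y : Space N | 0 < Y 0} from hz), ← mul_assoc,
        ← ENNReal.ofReal_mul (by positivity), ← Real.mul_rpow hr.le hz.le]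
      rfl
    · have h2 : ¬ (0 : ℝ) < (r • z.1) 0 := by
        have : (r • z.1) 0 = r * z.1 0 := rfl
        rw [this]; push Not at hz ⊢; exact mul_nonpos_of_nonneg_of_nonpos hr.le hz
      rw [indicator_of_notMem (show r • z.1 ∉ {Y : Space N | 0 < Y 0} from h2),
        indicator_of_notMem (show z.1 ∉ {Y : Space N | 0 < Y 0} from hz), mul_zero]
  · exact ((((measurable_weight a).mul hF').indicator measurableSet_upper)).comp hm

lemma weightedSphere_eq_map (a : ℝ) {r : ℝ} (hr : 0 < r) :
    weightedSphere N a r = ENNReal.ofReal (r ^ (N + a)) •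
      Measure.map (fun θ => r • θ) (weightedSphere N a 1) := by
  ext s hs
  have hm : Measurable fun θ : Space N => r • θ := measurable_const_smul r
  rw [← lintegral_indicator_one hs, lintegral_weightedSphere a hr (measurable_one.indicator hs),
    Measure.smul_apply, Measure.map_apply hm hs, smul_eq_mul, ← lintegral_indicator_one (hm hs)]
  rfl

lemma ae_weightedSphere_one (N : ℕ) (a : ℝ) :
    ∀ᵐ θ ∂(weightedSphere N a 1), ‖θ‖ = 1 ∧ 0 < θ 0 := by
  have hS : MeasurableSet {θ : Space N | ‖θ‖ = 1 ∧ 0 < θ 0}ᶜ := by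
    have h1 : MeasurableSet {θ : Space N | ‖θ‖ = 1} := measurable_norm (measurableSet_singleton 1)
    exact (h1.inter measurableSet_upper).compl
  rw [ae_iff]
  change weightedSphere N a 1 {θ : Space N | ‖θ‖ = 1 ∧ 0 < θ 0}ᶜ = 0
  rw [← lintegral_indicator_one hS, lintegral_weightedSphere_eq a (measurable_one.indicator hS)]
  rw [mul_eq_zero]; right
  convert lintegral_zero with z
  have hz : ‖z.1‖ = 1 := by simp
  by_cases h0 : 0 < z.1 0
  · rw [indicator_of_mem (show (1 : ℝ) • z.1 ∈ {Y : Space N | 0 < Y 0} by simpa using h0),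
      indicator_of_notMem, mul_zero]
    simpa [hz] using h0
  · rw [indicator_of_notMem]; simpa using h0

/-- Polar coordinates for the Lebesgue measure. -/
lemma lintegral_polar {F : Space N → ℝ≥0∞} (hF : Measurable F) :
    ∫⁻ Y, F Y = ∫⁻ s in Ioi (0 : ℝ), ENNReal.ofReal (s ^ N) *
      ∫⁻ z : Metric.sphere (0 : Space N) 1, F (s • z.1)
        ∂(Measure.toSphere (volume : Measure (Space N))) := by
  have h0 : MeasurableSet ({0}ᶜ : Set (Space N)) := (measurableSet_singleton 0).compl
  have hmp := (Measure.measurePreserving_homeomorphUnitSphereProd (volume : Measure (Space N)))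
  have hd : Module.finrank ℝ (Space N) - 1 = N := by simp [Space]
  rw [hd] at hmp
  set S := Measure.toSphere (volume : Measure (Space N)) with hSdef
  set G : Metric.sphere (0 : Space N) 1 × Ioi (0 : ℝ) → ℝ≥0∞ := fun p => F (p.2.1 • p.1.1) with hG
  have hGm : Measurable G := by
    apply hF.comp
    exact (measurable_subtype_coe.comp measurable_snd).smul
      (measurable_subtype_coe.comp measurable_fst)
  have e1 : ∫⁻ Y, F Y = ∫⁻ x : ({0}ᶜ : Set (Space N)), F x ∂((volume : Measure (Space N)).comap (↑)) := by
    rw [lintegral_subtype_comap h0, restrict_compl_singleton]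
  have e2 : ∫⁻ x : ({0}ᶜ : Set (Space N)), F x ∂((volume : Measure (Space N)).comap (↑))
      = ∫⁻ p, G p ∂(S.prod (Measure.volumeIoiPow N)) := by
    rw [← hmp.lintegral_comp hGm]
    refine lintegral_congr fun x => ?_
    have := homeomorphUnitSphereProd_symm_apply_coe (Space N) (homeomorphUnitSphereProd (Space N) x)
    rw [Homeomorph.symm_apply_apply] at this
    rw [hG, this]
  rw [e1, e2, lintegral_prod_symm _ hGm.aemeasurable, Measure.volumeIoiPow]
  have hm1 : Measurable fun r : Ioi (0 : ℝ) => ENNReal.ofReal (r.1 ^ N) :=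
    (measurable_subtype_coe.pow_const N).ennreal_ofReal
  rw [lintegral_withDensity_eq_lintegral_mul _ hm1 hGm.lintegral_prod_left']
  exact lintegral_subtype_comap (μ := volume) measurableSet_Ioi
    (fun s : ℝ => ENNReal.ofReal (s ^ N) * ∫⁻ z : Metric.sphere (0 : Space N) 1, F (s • z.1) ∂S)

/-- The measure `s ^ (N + a) ds` on `(0, ρ)`. -/
def radialMeasure (N : ℕ) (a ρ : ℝ) : Measure ℝ :=
  (volume.restrict (Ioo 0 ρ)).withDensity fun s => ENNReal.ofReal (s ^ (N + a))

instance (N : ℕ) (a ρ : ℝ) : SFinite (radialMeasure N a ρ) := by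
  unfold radialMeasure; infer_instance

lemma measurable_rpow_ofReal (q : ℝ) : Measurable fun s : ℝ => ENNReal.ofReal (s ^ q) := by
  fun_prop

lemma measurable_dilate : Measurable fun p : ℝ × Space N => p.1 • p.2 :=
  measurable_fst.smul measurable_snd

lemma lintegral_weightedVolume_halfBall (a ρ : ℝ) {F : Space N → ℝ≥0∞} (hF : Measurable F) :
    ∫⁻ Y, F Y ∂(weightedVolume a (halfBall N ρ)) =
      ∫⁻ s in Ioo 0 ρ, ENNReal.ofReal (s ^ (N + a)) *
        ∫⁻ θ, F (s • θ) ∂(weightedSphere N a 1) := by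
  have hm := (measurable_weight (N := N) a)
  unfold weightedVolume
  rw [lintegral_withDensity_eq_lintegral_mul _ hm hF,
    ← lintegral_indicator (measurableSet_halfBall ρ),
    lintegral_polar ((hm.mul hF).indicator (measurableSet_halfBall ρ)),
    ← lintegral_indicator measurableSet_Ioi, ← lintegral_indicator measurableSet_Ioo]
  refine lintegral_congr fun s => ?_
  by_cases hs : 0 < s
  · rw [indicator_of_mem (mem_Ioi.2 hs)]
    have hnorm (z : Metric.sphere (0 : Space N) 1) : ‖s • z.1‖ = s := by
      have : ‖z.1‖ = 1 := by simp
      rw [norm_smul, this, mul_one, Real.norm_of_nonneg hs.le]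
    by_cases hsr : s < ρ
    · rw [indicator_of_mem (show s ∈ Ioo 0 ρ from ⟨hs, hsr⟩), ← lintegral_weightedSphere a hs hF,
        lintegral_weightedSphere_eq a hF]
      congr 1
      refine lintegral_congr fun z => ?_
      have : s • z.1 ∈ halfBall N ρ ↔ s • z.1 ∈ {Y : Space N | 0 < Y 0} := by
        constructor
        · exact fun h => h.1
        · exact fun h => ⟨h, by rw [hnorm]; exact hsr⟩
      by_cases h : s • z.1 ∈ {Y : Space N | 0 < Y 0}
      · rw [indicator_of_mem h, indicator_of_mem (this.2 h)]; rfl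
      · rw [indicator_of_notMem h, indicator_of_notMem (fun h' => h (this.1 h'))]
    · rw [indicator_of_notMem (show s ∉ Ioo 0 ρ from fun h => hsr h.2)]
      rw [mul_eq_zero]; right
      convert lintegral_zero with z
      rw [indicator_of_notMem]
      intro h
      have := h.2
      rw [hnorm] at this
      exact hsr this
  · rw [indicator_of_notMem (show s ∉ Ioi (0 : ℝ) from hs),
      indicator_of_notMem (show s ∉ Ioo 0 ρ from fun h => hs h.1)]

/-- The weighted volume of a half-ball is a product measure in polar coordinates. -/
lemma weightedVolume_halfBall_eq_map (a ρ : ℝ) :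
    weightedVolume a (halfBall N ρ) = Measure.map (fun p : ℝ × Space N => p.1 • p.2)
      ((radialMeasure N a ρ).prod (weightedSphere N a 1)) := by
  ext s hs
  have hm := measurable_dilate (N := N)
  have hsm : Measurable fun p : ℝ × Space N => s.indicator (1 : Space N → ℝ≥0∞) (p.1 • p.2) :=
    (measurable_one.indicator hs).comp hm
  rw [← lintegral_indicator_one hs, lintegral_weightedVolume_halfBall a ρ (measurable_one.indicator hs),
    ← lintegral_indicator_one hs, lintegral_map (measurable_one.indicator hs) hm,
    lintegral_prod _ hsm.aemeasurable, radialMeasure,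
    lintegral_withDensity_eq_lintegral_mul _ (measurable_rpow_ofReal _)]
  · rfl
  · exact hsm.lintegral_prod_right'

lemma measurePreserving_polar (a ρ : ℝ) :
    MeasurePreserving (fun p : ℝ × Space N => p.1 • p.2)
      ((radialMeasure N a ρ).prod (weightedSphere N a 1)) (weightedVolume a (halfBall N ρ)) :=
  ⟨measurable_dilate, (weightedVolume_halfBall_eq_map a ρ).symm⟩

lemma lintegral_weightedVolume_halfBall' (a ρ : ℝ) {F : Space N → ℝ≥0∞}
    (hF : AEMeasurable F (weightedVolume a (halfBall N ρ))) :
    ∫⁻ Y, F Y ∂(weightedVolume a (halfBall N ρ)) =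
      ∫⁻ s in Ioo 0 ρ, ENNReal.ofReal (s ^ (N + a)) *
        ∫⁻ θ, F (s • θ) ∂(weightedSphere N a 1) := by
  have hm := measurable_dilate (N := N)
  have hF2 : AEMeasurable (fun p : ℝ × Space N => F (p.1 • p.2))
      ((radialMeasure N a ρ).prod (weightedSphere N a 1)) := by
    exact hF.comp_quasiMeasurePreserving (measurePreserving_polar a ρ).quasiMeasurePreserving
  rw [weightedVolume_halfBall_eq_map] at hF ⊢
  rw [lintegral_map' hF hm.aemeasurable, lintegral_prod _ hF2, radialMeasure,
    lintegral_withDensity_eq_lintegral_mul₀' (measurable_rpow_ofReal _).aemeasurable]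
  · rfl
  · exact hF2.lintegral_prod_right'

/-! ### Convergence in `L²` -/

section LTwo

variable {α ι E : Type*} [MeasurableSpace α] {μ : Measure α} [NormedAddCommGroup E]

lemma eLpNorm_two_sq (f : α → E) : eLpNorm f 2 μ ^ 2 = ∫⁻ x, ‖f x‖ₑ ^ 2 ∂μ := by
  have := eLpNorm_nnreal_pow_eq_lintegral (μ := μ) (f := f) (p := 2) two_ne_zero
  simpa using this

/-- Integrals of squares, unlike norms, can be disintegrated by Tonelli; almost all convergence
statements below are put in this form. -/
lemma tendsto_eLpNorm_two_iff {f : ι → α → E} {l : Filter ι} :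
    Tendsto (fun i => eLpNorm (f i) 2 μ) l (𝓝 0) ↔
      Tendsto (fun i => ∫⁻ x, ‖f i x‖ₑ ^ 2 ∂μ) l (𝓝 0) := by
  simp_rw [← eLpNorm_two_sq]
  constructor
  · intro h
    simpa [Function.comp_def] using (ENNReal.continuous_pow 2).tendsto 0 |>.comp h
  · intro h
    have h2 := (ENNReal.continuous_rpow_const (y := (2⁻¹ : ℝ))).tendsto 0 |>.comp h
    have h3 : ∀ x : ℝ≥0∞, (x ^ 2) ^ (2⁻¹ : ℝ) = x := fun x => by
      rw [← ENNReal.rpow_natCast, ← ENNReal.rpow_mul]; norm_num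
    simpa [Function.comp_def, h3] using h2

lemma memLp_two_iff {f : α → E} (hf : AEStronglyMeasurable f μ) :
    MemLp f 2 μ ↔ ∫⁻ x, ‖f x‖ₑ ^ 2 ∂μ < ⊤ := by
  rw [← eLpNorm_two_sq]
  constructor
  · intro h; exact ENNReal.pow_lt_top h.2
  · intro h
    refine ⟨hf, ?_⟩
    by_contra h'
    rw [not_lt, top_le_iff] at h'
    simp [h'] at h

lemma MemLp.lintegral_sq_lt_top {f : α → E} (hf : MemLp f 2 μ) : ∫⁻ x, ‖f x‖ₑ ^ 2 ∂μ < ⊤ :=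
  (memLp_two_iff hf.1).1 hf

lemma enorm_add_sq_le (x y : E) : ‖x + y‖ₑ ^ 2 ≤ 2 * (‖x‖ₑ ^ 2 + ‖y‖ₑ ^ 2) := by
  calc ‖x + y‖ₑ ^ 2 ≤ (‖x‖ₑ + ‖y‖ₑ) ^ 2 := by gcongr; exact enorm_add_le x y
    _ ≤ 2 * (‖x‖ₑ ^ 2 + ‖y‖ₑ ^ 2) := by
      have := ENNReal.rpow_add_le_mul_rpow_add_rpow ‖x‖ₑ ‖y‖ₑ (p := 2) (by norm_num)
      norm_num at this
      exact_mod_cast this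

lemma lintegral_enorm_add_sq_le {f g : α → E} (hf : AEStronglyMeasurable f μ) :
    ∫⁻ x, ‖f x + g x‖ₑ ^ 2 ∂μ ≤ 2 * (∫⁻ x, ‖f x‖ₑ ^ 2 ∂μ + ∫⁻ x, ‖g x‖ₑ ^ 2 ∂μ) := by
  rw [← lintegral_add_left' (hf.enorm.pow_const 2), ← lintegral_const_mul' _ _ (by simp)]
  exact lintegral_mono fun x => enorm_add_sq_le _ _

/-- Inner products of `L²`-convergent functions converge. -/
lemma tendsto_integral_inner {F : Type*} [NormedAddCommGroup F] [InnerProductSpace ℝ F]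
    {l : Filter ι} {f g : ι → α → F} {f₀ g₀ : α → F}
    (hf : ∀ᶠ i in l, MemLp (f i) 2 μ) (hg : ∀ᶠ i in l, MemLp (g i) 2 μ)
    (hf₀ : MemLp f₀ 2 μ) (hg₀ : MemLp g₀ 2 μ)
    (hfl : Tendsto (fun i => ∫⁻ x, ‖f i x - f₀ x‖ₑ ^ 2 ∂μ) l (𝓝 0))
    (hgl : Tendsto (fun i => ∫⁻ x, ‖g i x - g₀ x‖ₑ ^ 2 ∂μ) l (𝓝 0)) :
    Tendsto (fun i => ∫ x, inner ℝ (f i x) (g i x) ∂μ) l (𝓝 (∫ x, inner ℝ (f₀ x) (g₀ x) ∂μ)) := by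
  classical
  have key (u v : α → F) (hu : MemLp u 2 μ) (hv : MemLp v 2 μ) :
      ∫ x, inner ℝ (u x) (v x) ∂μ = inner ℝ (hu.toLp u) (hv.toLp v) := by
    rw [L2.inner_def]
    refine integral_congr_ae ?_
    filter_upwards [hu.coeFn_toLp, hv.coeFn_toLp] with x h1 h2
    rw [h1, h2]
  -- Membership in `L²` is known only eventually along `l`; the default value 0 elsewhere does not
  -- affect the limit.
  have conv (u : ι → α → F) (u₀ : α → F) (hu : ∀ᶠ i in l, MemLp (u i) 2 μ) (hu₀ : MemLp u₀ 2 μ)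
      (h : Tendsto (fun i => ∫⁻ x, ‖u i x - u₀ x‖ₑ ^ 2 ∂μ) l (𝓝 0)) :
      Tendsto (fun i => if h : MemLp (u i) 2 μ then h.toLp (u i) else 0) l (𝓝 (hu₀.toLp u₀)) := by
    rw [Lp.tendsto_Lp_iff_tendsto_eLpNorm']
    have h' := (tendsto_eLpNorm_two_iff (f := fun i x => u i x - u₀ x)).2 h
    refine h'.congr' ?_
    filter_upwards [hu] with i hi
    rw [dif_pos hi]
    refine eLpNorm_congr_ae ?_
    filter_upwards [hi.coeFn_toLp, hu₀.coeFn_toLp] with x h1 h2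
    simp [h1, h2]
  have := (conv f f₀ hf hf₀ hfl).inner (𝕜 := ℝ) (conv g g₀ hg hg₀ hgl)
  rw [key f₀ g₀ hf₀ hg₀]
  refine this.congr' ?_
  filter_upwards [hf, hg] with i hi1 hi2
  rw [dif_pos hi1, dif_pos hi2, key _ _ hi1 hi2]

end LTwo

/-! ### Shells away from the origin, and restriction to rays and spheres -/

/-- The product measure on the polar coordinates of the shell `r₁ < |Y| ≤ r₂`. -/
def shellMeasure (N : ℕ) (a r₁ r₂ : ℝ) : Measure (ℝ × Space N) :=
  (volume.restrict (Ioc r₁ r₂)).prod (weightedSphere N a 1)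

lemma rpow_lower_bound (q : ℝ) {r₁ r₂ : ℝ} (h₁ : 0 < r₁) {t : ℝ}
    (ht : t ∈ Icc r₁ r₂) : min (r₁ ^ q) (r₂ ^ q) ≤ t ^ q := by
  have ht0 : 0 < t := h₁.trans_le ht.1
  rcases le_total 0 q with hq | hq
  · exact (min_le_left _ _).trans (Real.rpow_le_rpow h₁.le ht.1 hq)
  · exact (min_le_right _ _).trans (Real.rpow_le_rpow_of_nonpos ht0 ht.2 hq)

/-- The density `s^(N+a)` is monotone, so on the compact interval it is bounded below by the smaller
of its two end values. -/
lemma restrict_le_radialMeasure (a : ℝ) {r₁ r₂ ρ : ℝ} (h₁ : 0 < r₁) (h₁₂ : r₁ ≤ r₂) (h₂ : r₂ < ρ) :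
    ∃ C : ℝ≥0∞, C ≠ ⊤ ∧ volume.restrict (Ioc r₁ r₂) ≤ C • radialMeasure N a ρ := by
  set c := min (r₁ ^ (N + a)) (r₂ ^ (N + a)) with hc
  have hcpos : 0 < c := lt_min (Real.rpow_pos_of_pos h₁ _) (Real.rpow_pos_of_pos (h₁.trans_le h₁₂) _)
  refine ⟨ENNReal.ofReal c⁻¹, ENNReal.ofReal_ne_top, ?_⟩
  refine Measure.le_iff.2 fun s hs => ?_
  have hsub : Ioc r₁ r₂ ⊆ Ioo 0 ρ := fun t ht => ⟨h₁.trans ht.1, ht.2.trans_lt h₂⟩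
  rw [Measure.smul_apply, radialMeasure, withDensity_apply _ hs, smul_eq_mul,
    ← lintegral_const_mul _ (measurable_rpow_ofReal _), Measure.restrict_restrict hs,
    Measure.restrict_apply hs, ← setLIntegral_one]
  calc ∫⁻ _ in s ∩ Ioc r₁ r₂, 1 ≤ ∫⁻ t in s ∩ Ioc r₁ r₂, ENNReal.ofReal c⁻¹ *
        ENNReal.ofReal (t ^ (N + a)) := by
        refine setLIntegral_mono' (hs.inter measurableSet_Ioc) fun t ht => ?_
        rw [← ENNReal.ofReal_mul (by positivity), ← ENNReal.ofReal_one]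
        refine ENNReal.ofReal_le_ofReal ?_
        rw [inv_mul_eq_div, le_div_iff₀ hcpos, one_mul]
        exact rpow_lower_bound _ h₁ ⟨ht.2.1.le, ht.2.2⟩
    _ ≤ _ := lintegral_mono_set (inter_subset_inter_right _ hsub)

lemma shellMeasure_le (a : ℝ) {r₁ r₂ ρ : ℝ} (h₁ : 0 < r₁) (h₁₂ : r₁ ≤ r₂) (h₂ : r₂ < ρ) :
    ∃ C : ℝ≥0∞, C ≠ ⊤ ∧ shellMeasure N a r₁ r₂ ≤
      C • (radialMeasure N a ρ).prod (weightedSphere N a 1) := by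
  obtain ⟨C, hC, hle⟩ := restrict_le_radialMeasure (N := N) a h₁ h₁₂ h₂
  refine ⟨C, hC, ?_⟩
  refine Measure.le_iff.2 fun s hs => ?_
  rw [shellMeasure, Measure.smul_apply, Measure.prod_apply hs, Measure.prod_apply hs, smul_eq_mul,
    ← smul_eq_mul, ← lintegral_smul_measure]
  exact lintegral_mono' hle le_rfl

lemma map_shellMeasure_le (a : ℝ) {r₁ r₂ ρ : ℝ} (h₁ : 0 < r₁) (h₁₂ : r₁ ≤ r₂) (h₂ : r₂ < ρ) :
    ∃ C : ℝ≥0∞, C ≠ ⊤ ∧ Measure.map (fun p : ℝ × Space N => p.1 • p.2) (shellMeasure N a r₁ r₂) ≤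
      C • weightedVolume a (halfBall N ρ) := by
  obtain ⟨C, hC, hle⟩ := shellMeasure_le (N := N) a h₁ h₁₂ h₂
  refine ⟨C, hC, ?_⟩
  rw [weightedVolume_halfBall_eq_map, ← Measure.map_smul]
  exact Measure.map_mono hle measurable_dilate

lemma quasiMeasurePreserving_shell (a : ℝ) {r₁ r₂ ρ : ℝ} (h₁ : 0 < r₁) (h₁₂ : r₁ ≤ r₂)
    (h₂ : r₂ < ρ) :
    Measure.QuasiMeasurePreserving (fun p : ℝ × Space N => p.1 • p.2) (shellMeasure N a r₁ r₂)
      (weightedVolume a (halfBall N ρ)) := by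
  obtain ⟨C, hC, hle⟩ := map_shellMeasure_le (N := N) a h₁ h₁₂ h₂
  exact ⟨measurable_dilate, (Measure.absolutelyContinuous_of_le hle).trans
    (Measure.smul_absolutelyContinuous)⟩

/-- Integrals over a shell are controlled by integrals over a half-ball. -/
lemma lintegral_shell_le (N : ℕ) (a : ℝ) {r₁ r₂ ρ : ℝ} (h₁ : 0 < r₁) (h₁₂ : r₁ ≤ r₂) (h₂ : r₂ < ρ) :
    ∃ C : ℝ≥0∞, C ≠ ⊤ ∧ ∀ F : Space N → ℝ≥0∞, AEMeasurable F (weightedVolume a (halfBall N ρ)) →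
      ∫⁻ p, F (p.1 • p.2) ∂(shellMeasure N a r₁ r₂) ≤
        C * ∫⁻ Y, F Y ∂(weightedVolume a (halfBall N ρ)) := by
  obtain ⟨C, hC, hle⟩ := map_shellMeasure_le (N := N) a h₁ h₁₂ h₂
  refine ⟨C, hC, fun F hF => ?_⟩
  have hF' : AEMeasurable F (Measure.map (fun p : ℝ × Space N => p.1 • p.2)
      (shellMeasure N a r₁ r₂)) :=
    hF.mono_ac (quasiMeasurePreserving_shell a h₁ h₁₂ h₂).absolutelyContinuous
  rw [← lintegral_map' hF' measurable_dilate.aemeasurable, ← smul_eq_mul, ← lintegral_smul_measure]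
  exact lintegral_mono' hle le_rfl

lemma memLp_shell {E : Type*} [NormedAddCommGroup E] (a : ℝ) {r₁ r₂ ρ : ℝ} (h₁ : 0 < r₁)
    (h₁₂ : r₁ ≤ r₂) (h₂ : r₂ < ρ) {f : Space N → E}
    (hf : MemLp f 2 (weightedVolume a (halfBall N ρ))) :
    MemLp (fun p : ℝ × Space N => f (p.1 • p.2)) 2 (shellMeasure N a r₁ r₂) := by
  obtain ⟨C, hC, hle⟩ := lintegral_shell_le N a h₁ h₁₂ h₂
  have hm : AEStronglyMeasurable (fun p : ℝ × Space N => f (p.1 • p.2)) (shellMeasure N a r₁ r₂) :=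
    hf.1.comp_quasiMeasurePreserving (quasiMeasurePreserving_shell a h₁ h₁₂ h₂)
  rw [memLp_two_iff hm]
  exact (hle _ (hf.1.enorm.pow_const 2)).trans_lt
    (ENNReal.mul_lt_top hC.lt_top (MemLp.lintegral_sq_lt_top hf))

lemma ae_shell {a r₁ r₂ : ℝ} :
    ∀ᵐ p ∂(shellMeasure N a r₁ r₂), p.1 ∈ Ioc r₁ r₂ ∧ ‖p.2‖ = 1 ∧ 0 < p.2 0 := by
  have h1 : ∀ᵐ p ∂(shellMeasure N a r₁ r₂), p.1 ∈ Ioc r₁ r₂ :=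
    Measure.quasiMeasurePreserving_fst.ae (ae_restrict_mem measurableSet_Ioc)
  have h2 : ∀ᵐ p ∂(shellMeasure N a r₁ r₂), ‖p.2‖ = 1 ∧ 0 < p.2 0 :=
    Measure.quasiMeasurePreserving_snd.ae (ae_weightedSphere_one N a)
  filter_upwards [h1, h2] with p h1 h2 using ⟨h1, h2⟩

lemma smul_mem_halfBall {ρ s : ℝ} {θ : Space N} (hθ : ‖θ‖ = 1 ∧ 0 < θ 0) (hs : s ∈ Ioo 0 ρ) :
    s • θ ∈ halfBall N ρ := by
  refine ⟨by simpa using mul_pos hs.1 hθ.2, ?_⟩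
  rw [norm_smul, hθ.1, mul_one, Real.norm_of_nonneg hs.1.le]; exact hs.2

section Smooth

variable {φ : Space N → ℝ} {ρ : ℝ}

lemma hasGradientAt_of_contDiffOn {Ω : Set (Space N)} (hΩ : IsOpen Ω)
    (hφ : ContDiffOn ℝ 1 φ Ω) {Y : Space N} (hY : Y ∈ Ω) :
    HasGradientAt φ (gradient φ Y) Y :=
  ((hφ.differentiableOn (by norm_num)).differentiableAt (hΩ.mem_nhds hY)).hasGradientAt

lemma continuousOn_gradient {Ω : Set (Space N)} (hΩ : IsOpen Ω) (hφ : ContDiffOn ℝ 1 φ Ω) :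
    ContinuousOn (gradient φ) Ω := by
  have := hφ.continuousOn_fderiv_of_isOpen hΩ (by norm_num)
  exact (InnerProductSpace.toDual ℝ (Space N)).symm.continuous.comp_continuousOn this

lemma hasDerivAt_ray (hφ : ContDiffOn ℝ 1 φ (halfBall N ρ)) {θ : Space N}
    (hθ : ‖θ‖ = 1 ∧ 0 < θ 0) {s : ℝ} (hs : s ∈ Ioo 0 ρ) :
    HasDerivAt (fun s => φ (s • θ)) (inner ℝ θ (gradient φ (s • θ))) s := by
  have h1 := (hasGradientAt_of_contDiffOn (isOpen_halfBall ρ) hφ (smul_mem_halfBall hθ hs)).hasFDerivAt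
  have h2 : HasDerivAt (fun s : ℝ => s • θ) θ s := by
    simpa using (hasDerivAt_id s).smul_const θ
  have := h1.comp_hasDerivAt s h2
  rw [real_inner_comm]
  simpa [Function.comp_def] using this

lemma continuousOn_ray {E : Type*} [TopologicalSpace E] {g : Space N → E}
    (hg : ContinuousOn g (halfBall N ρ)) {θ : Space N} (hθ : ‖θ‖ = 1 ∧ 0 < θ 0) :
    ContinuousOn (fun s : ℝ => g (s • θ)) (Ioo 0 ρ) :=
  hg.comp (by fun_prop) fun _ hs => smul_mem_halfBall hθ hs

lemma weightedVolume_absolutelyContinuous (a : ℝ) (Ω : Set (Space N)) :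
    weightedVolume a Ω ≪ volume.restrict Ω := withDensity_absolutelyContinuous _ _

lemma aestronglyMeasurable_of_continuousOn {E : Type*} [TopologicalSpace E]
    [TopologicalSpace.PseudoMetrizableSpace E] [SecondCountableTopology E] {g : Space N → E}
    (a : ℝ) (hg : ContinuousOn g (halfBall N ρ)) :
    AEStronglyMeasurable g (weightedVolume a (halfBall N ρ)) := by
  have : AEStronglyMeasurable g (volume.restrict (halfBall N ρ)) :=
    hg.aestronglyMeasurable (measurableSet_halfBall ρ)
  exact this.mono_ac (weightedVolume_absolutelyContinuous a _)

lemma aestronglyMeasurable_sphere_of_continuousOn {E : Type*} [TopologicalSpace E]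
    [TopologicalSpace.PseudoMetrizableSpace E] [SecondCountableTopology E] {g : Space N → E}
    (a : ℝ) (hg : ContinuousOn g (halfBall N ρ)) {s : ℝ} (hs : s ∈ Ioo 0 ρ) :
    AEStronglyMeasurable (fun θ => g (s • θ)) (weightedSphere N a 1) := by
  have hU : MeasurableSet {θ : Space N | s • θ ∈ halfBall N ρ} :=
    (measurable_const_smul s) (measurableSet_halfBall ρ)
  have h1 : ContinuousOn (fun θ : Space N => g (s • θ)) {θ : Space N | s • θ ∈ halfBall N ρ} :=
    hg.comp (by fun_prop) fun θ hθ => hθ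
  have h2 := h1.aestronglyMeasurable (μ := weightedSphere N a 1) hU
  rwa [Measure.restrict_eq_self_of_ae_mem] at h2
  filter_upwards [ae_weightedSphere_one N a] with θ hθ using smul_mem_halfBall hθ hs

end Smooth

/-! ### The trace inequality on half-spheres -/

/-- The one-dimensional Sobolev inequality. -/
lemma sq_le_integral_sq_add_deriv_sq {w w' : ℝ → ℝ} {r₁ r₂ : ℝ} (h₁₂ : r₁ < r₂)
    (hw : ∀ s ∈ Icc r₁ r₂, HasDerivAt w (w' s) s) (hw' : ContinuousOn w' (Icc r₁ r₂))
    {r : ℝ} (hr : r ∈ Icc r₁ r₂) :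
    w r ^ 2 ≤ ((r₂ - r₁)⁻¹ + 1) * ∫ s in r₁..r₂, (w s ^ 2 + w' s ^ 2) := by
  have hc : ContinuousOn w (Icc r₁ r₂) := fun s hs => (hw s hs).continuousAt.continuousWithinAt
  have hI : IntervalIntegrable (fun s => w s ^ 2 + w' s ^ 2) volume r₁ r₂ := by
    apply ContinuousOn.intervalIntegrable
    rw [uIcc_of_le h₁₂.le]; fun_prop
  set J := ∫ s in r₁..r₂, (w s ^ 2 + w' s ^ 2) with hJ
  -- `|(w²)'| = |2ww'| ≤ w² + w'²`, so `w²` oscillates by at most `J`.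
  have key : ∀ t ∈ Icc r₁ r₂, w r ^ 2 ≤ w t ^ 2 + J := by
    intro t ht
    have hsub : uIcc t r ⊆ Icc r₁ r₂ := by
      rw [← uIcc_of_le h₁₂.le] at ht hr ⊢
      exact uIcc_subset_uIcc ht hr
    have hsub' : uIoc t r ⊆ Ioc r₁ r₂ := by
      intro x hx
      rw [uIoc, mem_Ioc] at hx
      exact ⟨(le_min ht.1 hr.1).trans_lt hx.1, hx.2.trans (max_le ht.2 hr.2)⟩
    have hd : ∀ x ∈ uIcc t r, HasDerivAt (fun s => w s ^ 2) (2 * w x * w' x) x := by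
      intro x hx
      have := (hw x (hsub hx)).fun_pow 2
      simpa using this
    have hftc := intervalIntegral.integral_eq_sub_of_hasDerivAt hd (by
      apply ContinuousOn.intervalIntegrable
      exact ((continuousOn_const.mul hc).mul hw').mono hsub)
    have : |∫ x in t..r, 2 * w x * w' x| ≤ J := by
      rw [hJ, intervalIntegral.integral_of_le h₁₂.le]
      refine (intervalIntegral.norm_integral_le_integral_norm_uIoc
        (f := fun x => 2 * w x * w' x)).trans ?_
      refine (setIntegral_mono_on (g := fun s => w s ^ 2 + w' s ^ 2) ?_ ?_ measurableSet_uIoc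
        fun x _ => ?_).trans ?_
      · refine ((ContinuousOn.integrableOn_Icc (a := r₁) (b := r₂) ?_).mono_set
          (hsub'.trans Ioc_subset_Icc_self))
        exact ((continuousOn_const.mul hc).mul hw').abs
      · exact hI.1.mono_set hsub'
      · rw [Real.norm_eq_abs, abs_le]; constructor <;> nlinarith [sq_nonneg (w x - w' x), sq_nonneg (w x + w' x)]
      · exact setIntegral_mono_set hI.1 (ae_of_all _ fun x => by positivity) hsub'.eventuallyLE
    have := abs_le.1 this
    linarith
  have hJ0 : 0 ≤ J := intervalIntegral.integral_nonneg h₁₂.le fun x _ => by positivity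
  have hpos : 0 < r₂ - r₁ := sub_pos.2 h₁₂
  -- The comparison with an arbitrary `t` is averaged over `t`.
  have : (r₂ - r₁) * w r ^ 2 ≤ J + (r₂ - r₁) * J := by
    have hm : ∫ _ in r₁..r₂, w r ^ 2 ≤ ∫ t in r₁..r₂, ((w t ^ 2 + w' t ^ 2) + J) := by
      apply intervalIntegral.integral_mono_on h₁₂.le (by simp) (hI.add (by simp))
      intro t ht
      have := key t ht
      nlinarith [sq_nonneg (w' t)]
    rw [intervalIntegral.integral_add hI (by simp)] at hm
    simpa using hm
  rw [add_mul, inv_mul_eq_div, one_mul, ← sub_le_iff_le_add, le_div_iff₀ hpos]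
  nlinarith

lemma enorm_sq_real (x : ℝ) : ‖x‖ₑ ^ 2 = ENNReal.ofReal (x ^ 2) := by
  rw [Real.enorm_eq_ofReal_abs, ← ENNReal.ofReal_pow (abs_nonneg x), sq_abs]

lemma enorm_sq_eq_ofReal {E : Type*} [NormedAddCommGroup E] (x : E) :
    ‖x‖ₑ ^ 2 = ENNReal.ofReal (‖x‖ ^ 2) := by
  rw [← ofReal_norm, ← ENNReal.ofReal_pow (norm_nonneg x)]

/-- The values on half-spheres of a `C¹` function are controlled by its `H¹` norm. -/
lemma lintegral_sphere_le (N : ℕ) (a : ℝ) {r₁ r₂ ρ : ℝ} (h₁ : 0 < r₁) (h₁₂ : r₁ < r₂) (h₂ : r₂ < ρ) :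
    ∃ C : ℝ≥0∞, C ≠ ⊤ ∧ ∀ φ : Space N → ℝ, ContDiffOn ℝ 1 φ (halfBall N ρ) → ∀ r ∈ Icc r₁ r₂,
      ∫⁻ θ, ‖φ (r • θ)‖ₑ ^ 2 ∂(weightedSphere N a 1) ≤
        C * (∫⁻ Y, ‖φ Y‖ₑ ^ 2 ∂(weightedVolume a (halfBall N ρ)) +
          ∫⁻ Y, ‖gradient φ Y‖ₑ ^ 2 ∂(weightedVolume a (halfBall N ρ))) := by
  obtain ⟨C, hC, hle⟩ := lintegral_shell_le N a h₁ h₁₂.le h₂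
  refine ⟨ENNReal.ofReal ((r₂ - r₁)⁻¹ + 1) * C, ENNReal.mul_ne_top ENNReal.ofReal_ne_top hC,
    fun φ hφ r hr => ?_⟩
  have hpos : 0 < r₂ - r₁ := sub_pos.2 h₁₂
  have hm1 : AEMeasurable (fun Y => ‖φ Y‖ₑ ^ 2) (weightedVolume a (halfBall N ρ)) :=
    (aestronglyMeasurable_of_continuousOn a hφ.continuousOn).enorm.pow_const 2
  have hm2 : AEMeasurable (fun Y => ‖gradient φ Y‖ₑ ^ 2) (weightedVolume a (halfBall N ρ)) :=
    (aestronglyMeasurable_of_continuousOn a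
      (continuousOn_gradient (isOpen_halfBall ρ) hφ)).enorm.pow_const 2
  have hsub : Icc r₁ r₂ ⊆ Ioo 0 ρ := fun s hs => ⟨h₁.trans_le hs.1, hs.2.trans_lt h₂⟩
  rw [← lintegral_add_left' hm1, mul_assoc]
  refine le_trans ?_ (mul_le_mul_right (hle _ (hm1.add hm2)) _)
  have hm3 : AEMeasurable (fun p : ℝ × Space N => ‖φ (p.1 • p.2)‖ₑ ^ 2 + ‖gradient φ (p.1 • p.2)‖ₑ ^ 2)
      (shellMeasure N a r₁ r₂) :=
    (hm1.add hm2).comp_quasiMeasurePreserving (quasiMeasurePreserving_shell a h₁ h₁₂.le h₂)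
  simp only [Pi.add_apply]
  rw [shellMeasure] at hm3 ⊢
  rw [lintegral_prod_symm _ hm3, ← lintegral_const_mul' _ _ ENNReal.ofReal_ne_top]
  refine lintegral_mono_ae ?_
  filter_upwards [ae_weightedSphere_one N a] with θ hθ
  have hcg := continuousOn_gradient (isOpen_halfBall ρ) hφ
  have hcw : ContinuousOn (fun s : ℝ => φ (s • θ)) (Icc r₁ r₂) :=
    (continuousOn_ray hφ.continuousOn hθ).mono hsub
  have hcw' : ContinuousOn (fun s : ℝ => inner ℝ θ (gradient φ (s • θ))) (Icc r₁ r₂) :=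
    continuousOn_const.inner ((continuousOn_ray hcg hθ).mono hsub)
  -- The one-dimensional inequality is used on each ray; the radial derivative is at most the
  -- gradient since `‖θ‖ = 1`.
  have := sq_le_integral_sq_add_deriv_sq h₁₂ (w := fun s => φ (s • θ))
    (w' := fun s => inner ℝ θ (gradient φ (s • θ)))
    (fun s hs => hasDerivAt_ray hφ hθ (hsub hs)) hcw' hr
  rw [enorm_sq_real]
  refine (ENNReal.ofReal_le_ofReal this).trans ?_
  rw [ENNReal.ofReal_mul (by positivity), intervalIntegral.integral_of_le h₁₂.le,
    ofReal_integral_eq_lintegral_ofReal]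
  · gcongr with s
    rw [ENNReal.ofReal_add (by positivity) (by positivity), enorm_sq_real]
    gcongr
    rw [← enorm_sq_real]
    gcongr
    rw [← ofReal_norm, ← ofReal_norm]
    refine ENNReal.ofReal_le_ofReal ((norm_inner_le_norm _ _).trans ?_)
    rw [hθ.1, one_mul]
  · exact ((hcw.pow 2).add (hcw'.pow 2)).integrableOn_Icc.mono_set Ioc_subset_Icc_self
  · exact ae_of_all _ fun s => by positivity

/-! ### Rescaling half-spheres to the unit half-sphere -/

lemma measurableEmbedding_smul {r : ℝ} (hr : 0 < r) :
    MeasurableEmbedding fun θ : Space N => r • θ :=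
  (Homeomorph.smulOfNeZero r hr.ne').measurableEmbedding

lemma ofReal_rpow_ne_zero {r : ℝ} (hr : 0 < r) (q : ℝ) : ENNReal.ofReal (r ^ q) ≠ 0 := by
  simpa using Real.rpow_pos_of_pos hr q

lemma lintegral_weightedSphere' (a : ℝ) {r : ℝ} (hr : 0 < r) (F : Space N → ℝ≥0∞) :
    ∫⁻ Y, F Y ∂(weightedSphere N a r) = ENNReal.ofReal (r ^ (N + a)) *
      ∫⁻ θ, F (r • θ) ∂(weightedSphere N a 1) := by
  rw [weightedSphere_eq_map a hr, lintegral_smul_measure, (measurableEmbedding_smul hr).lintegral_map,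
    smul_eq_mul]

lemma integral_weightedSphere (a : ℝ) {r : ℝ} (hr : 0 < r) (F : Space N → ℝ) :
    ∫ Y, F Y ∂(weightedSphere N a r) = r ^ (N + a) *
      ∫ θ, F (r • θ) ∂(weightedSphere N a 1) := by
  rw [weightedSphere_eq_map a hr, integral_smul_measure, (measurableEmbedding_smul hr).integral_map,
    smul_eq_mul, ENNReal.toReal_ofReal (Real.rpow_nonneg hr.le _)]

lemma aestronglyMeasurable_weightedSphere_iff {E : Type*} [NormedAddCommGroup E] (a : ℝ) {r : ℝ}
    (hr : 0 < r) {f : Space N → E} :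
    AEStronglyMeasurable f (weightedSphere N a r) ↔
      AEStronglyMeasurable (fun θ => f (r • θ)) (weightedSphere N a 1) := by
  have h1 : AEStronglyMeasurable f (weightedSphere N a r) ↔
      AEStronglyMeasurable f (Measure.map (fun θ => r • θ) (weightedSphere N a 1)) := by
    rw [weightedSphere_eq_map a hr]
    exact ⟨fun h => h.mono_ac (Measure.absolutelyContinuous_smul (ofReal_rpow_ne_zero hr _)),
      fun h => h.mono_ac Measure.smul_absolutelyContinuous⟩
  rw [h1, (measurableEmbedding_smul hr).aestronglyMeasurable_map_iff]
  rfl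

lemma memLp_weightedSphere_iff {E : Type*} [NormedAddCommGroup E] (a : ℝ) {r : ℝ}
    (hr : 0 < r) {f : Space N → E} :
    MemLp f 2 (weightedSphere N a r) ↔ MemLp (fun θ => f (r • θ)) 2 (weightedSphere N a 1) := by
  constructor
  · intro h
    have h1 := (aestronglyMeasurable_weightedSphere_iff a hr).1 h.1
    rw [memLp_two_iff h1]
    have := MemLp.lintegral_sq_lt_top h
    rw [lintegral_weightedSphere' a hr] at this
    exact ENNReal.lt_top_of_mul_ne_top_right this.ne (ofReal_rpow_ne_zero hr _)
  · intro h
    have h1 := (aestronglyMeasurable_weightedSphere_iff a hr).2 h.1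
    rw [memLp_two_iff h1, lintegral_weightedSphere' a hr]
    exact ENNReal.mul_lt_top ENNReal.ofReal_lt_top (MemLp.lintegral_sq_lt_top h)

lemma integrable_weightedSphere_iff (a : ℝ) {r : ℝ} (hr : 0 < r) {f : Space N → ℝ} :
    Integrable f (weightedSphere N a r) ↔
      Integrable (fun θ => f (r • θ)) (weightedSphere N a 1) := by
  rw [weightedSphere_eq_map a hr, integrable_smul_measure (ofReal_rpow_ne_zero hr _)
    ENNReal.ofReal_ne_top, (measurableEmbedding_smul hr).integrable_map_iff]
  rfl

lemma tendsto_weightedSphere_iff {ι E : Type*} [NormedAddCommGroup E] (a : ℝ) {r : ℝ}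
    (hr : 0 < r) {f : ι → Space N → E} {l : Filter ι} :
    Tendsto (fun i => eLpNorm (f i) 2 (weightedSphere N a r)) l (𝓝 0) ↔
      Tendsto (fun i => ∫⁻ θ, ‖f i (r • θ)‖ₑ ^ 2 ∂(weightedSphere N a 1)) l (𝓝 0) := by
  rw [tendsto_eLpNorm_two_iff]
  simp_rw [lintegral_weightedSphere' a hr]
  constructor
  · intro h
    have := ENNReal.Tendsto.const_mul (a := (ENNReal.ofReal (r ^ (N + a)))⁻¹) h
      (Or.inr (ENNReal.inv_ne_top.2 (ofReal_rpow_ne_zero hr _)))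
    simp_rw [← mul_assoc, ENNReal.inv_mul_cancel (ofReal_rpow_ne_zero hr _) ENNReal.ofReal_ne_top]
      at this
    simpa using this
  · intro h
    simpa using ENNReal.Tendsto.const_mul (a := ENNReal.ofReal (r ^ (N + a))) h
      (Or.inr ENNReal.ofReal_ne_top)

/-! ### Approximating sequences and traces -/

lemma weightedVolume_mono (a : ℝ) {r s : ℝ} (h : r ≤ s) :
    weightedVolume a (halfBall N r) ≤ weightedVolume a (halfBall N s) := by
  unfold weightedVolume
  rw [← restrict_withDensity (measurableSet_halfBall r),
    ← restrict_withDensity (measurableSet_halfBall s)]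
  exact Measure.restrict_mono (halfBall_mono h) le_rfl

lemma SmoothApprox.mono {a r s : ℝ} (h : r ≤ s) {φ : ℕ → Space N → ℝ} {V : Space N → ℝ}
    {G : Space N → Space N} (hφ : SmoothApprox a (halfBall N s) φ V G) :
    SmoothApprox a (halfBall N r) φ V G := by
  have hm := weightedVolume_mono (N := N) a h
  refine ⟨fun n => ⟨(hφ.1 n).1.mono (halfBall_mono h), (hφ.1 n).2.1.mono_measure hm,
    (hφ.1 n).2.2.mono_measure hm⟩, ?_, ?_⟩
  · exact tendsto_of_tendsto_of_tendsto_of_le_of_le tendsto_const_nhds hφ.2.1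
      (fun _ => zero_le) fun n => eLpNorm_mono_measure _ hm
  · exact tendsto_of_tendsto_of_tendsto_of_le_of_le tendsto_const_nhds hφ.2.2
      (fun _ => zero_le) fun n => eLpNorm_mono_measure _ hm

lemma SmoothApprox.contDiffOn {a : ℝ} {Ω : Set (Space N)} {φ : ℕ → Space N → ℝ} {V : Space N → ℝ}
    {G : Space N → Space N} (hφ : SmoothApprox a Ω φ V G) (n : ℕ) : ContDiffOn ℝ 1 (φ n) Ω :=
  (hφ.1 n).1.of_le (by exact_mod_cast le_top)

lemma SmoothApprox.tendsto_sq {a : ℝ} {Ω : Set (Space N)} {φ : ℕ → Space N → ℝ} {V : Space N → ℝ}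
    {G : Space N → Space N} (hφ : SmoothApprox a Ω φ V G) :
    Tendsto (fun n => ∫⁻ Y, ‖φ n Y - V Y‖ₑ ^ 2 ∂(weightedVolume a Ω) +
      ∫⁻ Y, ‖gradient (φ n) Y - G Y‖ₑ ^ 2 ∂(weightedVolume a Ω)) atTop (𝓝 0) := by
  simpa using (tendsto_eLpNorm_two_iff.1 hφ.2.1).add (tendsto_eLpNorm_two_iff.1 hφ.2.2)

lemma ae_mem_halfBall (a ρ : ℝ) : ∀ᵐ Y ∂(weightedVolume a (halfBall N ρ)), Y ∈ halfBall N ρ :=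
  (weightedVolume_absolutelyContinuous a _).ae_le (ae_restrict_mem (measurableSet_halfBall ρ))

lemma gradient_sub_of_contDiffOn {Ω : Set (Space N)} (hΩ : IsOpen Ω) {φ ψ : Space N → ℝ}
    (hφ : ContDiffOn ℝ 1 φ Ω) (hψ : ContDiffOn ℝ 1 ψ Ω) {Y : Space N} (hY : Y ∈ Ω) :
    gradient (fun Y => φ Y - ψ Y) Y = gradient φ Y - gradient ψ Y := by
  have h1 := (hasGradientAt_of_contDiffOn hΩ hφ hY).hasFDerivAt
  have h2 := (hasGradientAt_of_contDiffOn hΩ hψ hY).hasFDerivAt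
  have h3 := h1.sub h2
  rw [← map_sub] at h3
  exact (hasGradientAt_iff_hasFDerivAt.2 h3).gradient

/-- The distance on half-spheres of two `C¹` functions in terms of their `H¹`-distances to a
third function. -/
lemma lintegral_sphere_sub_le (N : ℕ) (a : ℝ) {r₁ r₂ ρ : ℝ} (h₁ : 0 < r₁) (h₁₂ : r₁ < r₂)
    (h₂ : r₂ < ρ) :
    ∃ C : ℝ≥0∞, C ≠ ⊤ ∧ ∀ (V : Space N → ℝ) (G : Space N → Space N),
      AEStronglyMeasurable V (weightedVolume a (halfBall N ρ)) →
      AEStronglyMeasurable G (weightedVolume a (halfBall N ρ)) →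
      ∀ φ ψ : Space N → ℝ, ContDiffOn ℝ 1 φ (halfBall N ρ) → ContDiffOn ℝ 1 ψ (halfBall N ρ) →
      ∀ r ∈ Icc r₁ r₂, ∫⁻ θ, ‖φ (r • θ) - ψ (r • θ)‖ₑ ^ 2 ∂(weightedSphere N a 1) ≤
        C * ((∫⁻ Y, ‖φ Y - V Y‖ₑ ^ 2 ∂(weightedVolume a (halfBall N ρ)) +
          ∫⁻ Y, ‖gradient φ Y - G Y‖ₑ ^ 2 ∂(weightedVolume a (halfBall N ρ))) +
          (∫⁻ Y, ‖ψ Y - V Y‖ₑ ^ 2 ∂(weightedVolume a (halfBall N ρ)) +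
          ∫⁻ Y, ‖gradient ψ Y - G Y‖ₑ ^ 2 ∂(weightedVolume a (halfBall N ρ)))) := by
  obtain ⟨C, hC, hle⟩ := lintegral_sphere_le N a h₁ h₁₂ h₂
  refine ⟨C * 2, ENNReal.mul_ne_top hC (by simp), fun V G hV hG φ ψ hφ hψ r hr => ?_⟩
  refine (hle (fun Y => φ Y - ψ Y) (hφ.sub hψ) r hr).trans ?_
  rw [mul_assoc]
  gcongr
  have e1 := lintegral_enorm_add_sq_le (g := fun Y => V Y - ψ Y)
    ((aestronglyMeasurable_of_continuousOn a hφ.continuousOn).sub hV)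
  have e2 := lintegral_enorm_add_sq_le (g := fun Y => G Y - gradient ψ Y)
    ((aestronglyMeasurable_of_continuousOn a
      (continuousOn_gradient (isOpen_halfBall ρ) hφ)).sub hG)
  simp only [Pi.sub_apply, sub_add_sub_cancel] at e1 e2
  have e3 : ∫⁻ Y, ‖gradient (fun Y => φ Y - ψ Y) Y‖ₑ ^ 2 ∂(weightedVolume a (halfBall N ρ)) =
      ∫⁻ Y, ‖gradient φ Y - gradient ψ Y‖ₑ ^ 2 ∂(weightedVolume a (halfBall N ρ)) := by
    refine lintegral_congr_ae ?_
    filter_upwards [ae_mem_halfBall a ρ] with Y hY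
    simp only [gradient_sub_of_contDiffOn (isOpen_halfBall ρ) hφ hψ hY]
  rw [e3]
  refine (add_le_add e1 e2).trans (le_of_eq ?_)
  have s1 : ∫⁻ Y, ‖V Y - ψ Y‖ₑ ^ 2 ∂(weightedVolume a (halfBall N ρ)) =
      ∫⁻ Y, ‖ψ Y - V Y‖ₑ ^ 2 ∂(weightedVolume a (halfBall N ρ)) := by
    simp_rw [← edist_eq_enorm_sub, edist_comm]
  have s2 : ∫⁻ Y, ‖G Y - gradient ψ Y‖ₑ ^ 2 ∂(weightedVolume a (halfBall N ρ)) =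
      ∫⁻ Y, ‖gradient ψ Y - G Y‖ₑ ^ 2 ∂(weightedVolume a (halfBall N ρ)) := by
    simp_rw [← edist_eq_enorm_sub, edist_comm]
  rw [s1, s2]; ring

lemma memLp_sphere_of_contDiffOn {a ρ : ℝ} {φ : Space N → ℝ} (hφ : ContDiffOn ℝ 1 φ (halfBall N ρ))
    (h1 : MemLp φ 2 (weightedVolume a (halfBall N ρ)))
    (h2 : MemLp (gradient φ) 2 (weightedVolume a (halfBall N ρ))) {r : ℝ} (hr : r ∈ Ioo 0 ρ) :
    MemLp (fun θ => φ (r • θ)) 2 (weightedSphere N a 1) := by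
  obtain ⟨C, hC, hle⟩ := lintegral_sphere_le N a (r₁ := r / 2) (r₂ := r) (half_pos hr.1)
    (half_lt_self hr.1) hr.2
  rw [memLp_two_iff (aestronglyMeasurable_sphere_of_continuousOn a hφ.continuousOn hr)]
  refine (hle φ hφ r ⟨(half_lt_self hr.1).le, le_rfl⟩).trans_lt
    (ENNReal.mul_lt_top hC.lt_top (ENNReal.add_lt_top.2 ⟨?_, ?_⟩))
  · exact MemLp.lintegral_sq_lt_top h1
  · exact MemLp.lintegral_sq_lt_top h2

/-- Restrictions to `H_r` of an `H¹`-convergent sequence form a Cauchy sequence by the trace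
inequality, and `L²` is complete. -/
lemma exists_isTrace {a R : ℝ} {V : Space N → ℝ} {G : Space N → Space N}
    (hV : HasH1LocGradient a R V G) {r : ℝ} (hr : r ∈ Ioo 0 R) : ∃ u, IsTrace a R V G r u := by
  obtain ⟨ρ, hrρ, hρR⟩ := exists_between hr.2
  obtain ⟨hV1, hG1, φ, hφ⟩ := hV ρ ⟨hr.1.trans hrρ, hρR⟩
  obtain ⟨C, hC, hle⟩ := lintegral_sphere_sub_le N a (r₁ := r / 2) (r₂ := r) (half_pos hr.1)
    (half_lt_self hr.1) hrρ
  have hmem : ∀ n, MemLp (fun θ => φ n (r • θ)) 2 (weightedSphere N a 1) := fun n =>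
    memLp_sphere_of_contDiffOn (hφ.contDiffOn n) (hφ.1 n).2.1 (hφ.1 n).2.2 ⟨hr.1, hrρ⟩
  set f : ℕ → Lp ℝ 2 (weightedSphere N a 1) := fun n => (hmem n).toLp _ with hf
  have hcau : CauchySeq f := by
    rw [Lp.cauchySeq_Lp_iff_cauchySeq_eLpNorm]
    rw [tendsto_eLpNorm_two_iff (f := fun n : ℕ × ℕ => (⇑(f n.1) - ⇑(f n.2) : Space N → ℝ))]
    have hlim : Tendsto (fun n : ℕ × ℕ => C * ((∫⁻ Y, ‖φ n.1 Y - V Y‖ₑ ^ 2 ∂(weightedVolume a (halfBall N ρ)) +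
          ∫⁻ Y, ‖gradient (φ n.1) Y - G Y‖ₑ ^ 2 ∂(weightedVolume a (halfBall N ρ))) +
          (∫⁻ Y, ‖φ n.2 Y - V Y‖ₑ ^ 2 ∂(weightedVolume a (halfBall N ρ)) +
          ∫⁻ Y, ‖gradient (φ n.2) Y - G Y‖ₑ ^ 2 ∂(weightedVolume a (halfBall N ρ))))) atTop (𝓝 0) := by
      have h0 := hφ.tendsto_sq
      have h1 := ((h0.comp (tendsto_fst.mono_left prod_atTop_atTop_eq.ge)).add (h0.comp (tendsto_snd.mono_left prod_atTop_atTop_eq.ge)))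
      simpa using ENNReal.Tendsto.const_mul h1 (Or.inr hC)
    refine tendsto_of_tendsto_of_tendsto_of_le_of_le tendsto_const_nhds hlim
      (fun _ => zero_le) fun n => ?_
    refine le_trans (le_of_eq ?_) (hle V G hV1.1 hG1.1 (φ n.1) (φ n.2) (hφ.contDiffOn _)
      (hφ.contDiffOn _) r ⟨(half_lt_self hr.1).le, le_rfl⟩)
    refine lintegral_congr_ae ?_
    filter_upwards [(hmem n.1).coeFn_toLp, (hmem n.2).coeFn_toLp] with θ e1 e2
    simp only [hf, Pi.sub_apply, e1, e2]
  obtain ⟨v, hv⟩ := cauchySeq_tendsto_of_complete hcau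
  have hr0 : r ≠ 0 := hr.1.ne'
  have hvv : ∀ θ : Space N, r⁻¹ • r • θ = θ := fun θ => by rw [smul_smul, inv_mul_cancel₀ hr0, one_smul]
  -- The limit `v` lives on the unit half-sphere and is transported back to `H_r`.
  refine ⟨fun Y => v (r⁻¹ • Y), ?_, ρ, ⟨hrρ, hρR⟩, φ, hφ, ?_⟩
  · rw [memLp_weightedSphere_iff a hr.1]
    simp only [hvv]
    exact Lp.memLp v
  · rw [tendsto_weightedSphere_iff a hr.1]
    simp only [hvv]
    rw [Lp.tendsto_Lp_iff_tendsto_eLpNorm'] at hv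
    have := (tendsto_eLpNorm_two_iff (f := fun n => (⇑(f n) - ⇑v : Space N → ℝ))).1 hv
    refine this.congr fun n => lintegral_congr_ae ?_
    filter_upwards [(hmem n).coeFn_toLp] with θ e1
    simp only [hf, Pi.sub_apply, e1]

lemma IsTrace.memLp {a R r : ℝ} (hr : 0 < r) {V : Space N → ℝ} {G : Space N → Space N}
    {u : Space N → ℝ} (hu : IsTrace a R V G r u) :
    MemLp (fun θ => u (r • θ)) 2 (weightedSphere N a 1) :=
  (memLp_weightedSphere_iff a hr).1 hu.1

/-- Every smooth approximation of `V` in `H¹(D_ρ)` converges to the trace on `H_r`. -/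
lemma IsTrace.tendsto {a R r ρ : ℝ} (hr : 0 < r) (hrρ : r < ρ) (hρR : ρ < R) {V : Space N → ℝ}
    {G : Space N → Space N} (hV : HasH1LocGradient a R V G) {u : Space N → ℝ}
    (hu : IsTrace a R V G r u) {φ : ℕ → Space N → ℝ}
    (hφc : ∀ n, ContDiffOn ℝ 1 (φ n) (halfBall N ρ))
    (hφ : Tendsto (fun n => ∫⁻ Y, ‖φ n Y - V Y‖ₑ ^ 2 ∂(weightedVolume a (halfBall N ρ)) +
      ∫⁻ Y, ‖gradient (φ n) Y - G Y‖ₑ ^ 2 ∂(weightedVolume a (halfBall N ρ))) atTop (𝓝 0)) :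
    Tendsto (fun n => ∫⁻ θ, ‖φ n (r • θ) - u (r • θ)‖ₑ ^ 2 ∂(weightedSphere N a 1))
      atTop (𝓝 0) := by
  obtain ⟨-, ρ', ⟨hρ', -⟩, ψ, hψ, hψu⟩ := hu
  rw [tendsto_weightedSphere_iff a hr] at hψu
  -- The given sequence and the one defining the trace live on different half-balls; they are
  -- compared on the smaller one, which still contains `H_r`.
  set t := min ρ ρ' with ht
  have hrt : r < t := lt_min hrρ hρ'
  have hmono : weightedVolume a (halfBall N t) ≤ weightedVolume a (halfBall N ρ) :=
    weightedVolume_mono a (min_le_left _ _)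
  have hψ2 := hψ.mono (min_le_right ρ ρ')
  obtain ⟨hV1, hG1, -⟩ := hV t ⟨hr.trans hrt, (min_le_left _ _).trans_lt hρR⟩
  obtain ⟨C, hC, hle⟩ := lintegral_sphere_sub_le N a (r₁ := r / 2) (r₂ := r) (half_pos hr)
    (half_lt_self hr) hrt
  have hφ2 := fun n => (hφc n).mono (halfBall_mono (N := N) (min_le_left ρ ρ'))
  have hlim : Tendsto (fun n => 2 * (C * ((∫⁻ Y, ‖φ n Y - V Y‖ₑ ^ 2 ∂(weightedVolume a (halfBall N ρ)) +
      ∫⁻ Y, ‖gradient (φ n) Y - G Y‖ₑ ^ 2 ∂(weightedVolume a (halfBall N ρ))) +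
      (∫⁻ Y, ‖ψ n Y - V Y‖ₑ ^ 2 ∂(weightedVolume a (halfBall N t)) +
      ∫⁻ Y, ‖gradient (ψ n) Y - G Y‖ₑ ^ 2 ∂(weightedVolume a (halfBall N t)))) +
      ∫⁻ θ, ‖ψ n (r • θ) - u (r • θ)‖ₑ ^ 2 ∂(weightedSphere N a 1))) atTop (𝓝 0) := by
    have h1 := (ENNReal.Tendsto.const_mul (hφ.add hψ2.tendsto_sq) (Or.inr hC)).add hψu
    simpa using ENNReal.Tendsto.const_mul h1 (Or.inr ENNReal.ofNat_ne_top)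
  refine tendsto_of_tendsto_of_tendsto_of_le_of_le tendsto_const_nhds hlim
    (fun _ => zero_le) fun n => ?_
  have hrt' : r ∈ Ioo 0 t := ⟨hr, hrt⟩
  have hm1 := aestronglyMeasurable_sphere_of_continuousOn a (hφ2 n).continuousOn hrt'
  have hm2 := aestronglyMeasurable_sphere_of_continuousOn a (hψ2.contDiffOn n).continuousOn hrt'
  have e1 := lintegral_enorm_add_sq_le (g := fun θ => ψ n (r • θ) - u (r • θ)) (hm1.sub hm2)
  simp only [Pi.sub_apply, sub_add_sub_cancel] at e1
  refine e1.trans ?_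
  gcongr
  refine (hle V G hV1.1 hG1.1 (φ n) (ψ n) (hφ2 n) (hψ2.contDiffOn n) r
    ⟨(half_lt_self hr).le, le_rfl⟩).trans ?_
  gcongr

/-! ### Almost every radius: slices, energy and height -/

lemma ae_radialMeasure_iff {a ρ : ℝ} {p : ℝ → Prop} :
    (∀ᵐ s ∂(radialMeasure N a ρ), p s) ↔ ∀ᵐ s, s ∈ Ioo 0 ρ → p s := by
  rw [radialMeasure, ae_withDensity_iff (measurable_rpow_ofReal _), ae_restrict_iff' measurableSet_Ioo]
  refine eventually_congr (ae_of_all _ fun s => ?_)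
  refine ⟨fun h hs => h hs (ofReal_rpow_ne_zero hs.1 _), fun h hs _ => h hs⟩

lemma ae_memLp_sphere {E : Type*} [NormedAddCommGroup E] {a ρ : ℝ} {F : Space N → E}
    (hF : MemLp F 2 (weightedVolume a (halfBall N ρ))) :
    ∀ᵐ s, s ∈ Ioo 0 ρ → MemLp (fun θ => F (s • θ)) 2 (weightedSphere N a 1) := by
  rw [← ae_radialMeasure_iff (N := N) (a := a)]
  have hm : AEStronglyMeasurable (fun p : ℝ × Space N => F (p.1 • p.2))
      ((radialMeasure N a ρ).prod (weightedSphere N a 1)) :=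
    hF.1.comp_quasiMeasurePreserving (measurePreserving_polar a ρ).quasiMeasurePreserving
  have hfin : ∫⁻ s, ∫⁻ θ, ‖F (s • θ)‖ₑ ^ 2 ∂(weightedSphere N a 1) ∂(radialMeasure N a ρ) ≠ ⊤ := by
    have := MemLp.lintegral_sq_lt_top hF
    rw [weightedVolume_halfBall_eq_map] at this hF
    rw [lintegral_map' (hF.1.enorm.pow_const 2) measurable_dilate.aemeasurable,
      lintegral_prod _ (hm.enorm.pow_const 2)] at this
    exact this.ne
  filter_upwards [hm.prodMk_left,
    ae_lt_top' (hm.enorm.pow_const 2).lintegral_prod_right' hfin] with s h1 h2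
  exact (memLp_two_iff h1).2 h2

/-- The Bochner integral over a half-ball in polar coordinates. -/
lemma integral_weightedVolume_halfBall {a ρ : ℝ} {F : Space N → ℝ}
    (hF : Integrable F (weightedVolume a (halfBall N ρ))) :
    IntegrableOn (fun s => s ^ (N + a) * ∫ θ, F (s • θ) ∂(weightedSphere N a 1)) (Ioo 0 ρ) ∧
    ∫ Y, F Y ∂(weightedVolume a (halfBall N ρ)) =
      ∫ s in Ioo 0 ρ, s ^ (N + a) * ∫ θ, F (s • θ) ∂(weightedSphere N a 1) := by
  have hm : AEMeasurable (fun s : ℝ => ENNReal.ofReal (s ^ (N + a))) (volume.restrict (Ioo 0 ρ)) :=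
    (measurable_rpow_ofReal _).aemeasurable
  have hlt : ∀ᵐ s ∂(volume.restrict (Ioo 0 ρ)), ENNReal.ofReal (s ^ (N + a)) < ⊤ :=
    ae_of_all _ fun _ => ENNReal.ofReal_lt_top
  have hI : Integrable (fun p : ℝ × Space N => F (p.1 • p.2))
      ((radialMeasure N a ρ).prod (weightedSphere N a 1)) :=
    (measurePreserving_polar a ρ).integrable_comp_of_integrable hF
  have hcongr : ∀ s ∈ Ioo 0 ρ, (ENNReal.ofReal (s ^ (N + a))).toReal •
      ∫ θ, F (s • θ) ∂(weightedSphere N a 1) = s ^ (N + a) * ∫ θ, F (s • θ) ∂(weightedSphere N a 1) :=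
    fun s hs => by rw [ENNReal.toReal_ofReal (Real.rpow_nonneg hs.1.le _), smul_eq_mul]
  constructor
  · have := hI.integral_prod_left
    rw [radialMeasure, integrable_withDensity_iff_integrable_smul₀' hm hlt] at this
    exact (integrableOn_congr_fun hcongr measurableSet_Ioo).1 this
  · rw [weightedVolume_halfBall_eq_map] at hF ⊢
    rw [integral_map measurable_dilate.aemeasurable hF.1, integral_prod _ hI, radialMeasure,
      integral_withDensity_eq_integral_toReal_smul₀ hm hlt]
    exact setIntegral_congr_fun measurableSet_Ioo hcongr

lemma MemLp.integrable_norm_sq {α E : Type*} [MeasurableSpace α] {μ : Measure α}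
    [NormedAddCommGroup E] {f : α → E} (hf : MemLp f 2 μ) : Integrable (fun x => ‖f x‖ ^ 2) μ :=
  hf.norm.integrable_sq

lemma energyD_eq {a r ρ : ℝ} (hr : r ∈ Ioo 0 ρ) {G : Space N → Space N}
    (hG : MemLp G 2 (weightedVolume a (halfBall N ρ))) :
    energyD a r G = ∫ s in 0..r, s ^ (N + a) * ∫ θ, ‖G (s • θ)‖ ^ 2 ∂(weightedSphere N a 1) := by
  have hG' : MemLp G 2 (weightedVolume a (halfBall N r)) :=
    hG.mono_measure (weightedVolume_mono a hr.2.le)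
  rw [energyD, (integral_weightedVolume_halfBall (MemLp.integrable_norm_sq hG')).2,
    intervalIntegral.integral_of_le hr.1.le, integral_Ioc_eq_integral_Ioo]

lemma intervalIntegrable_energy {a ρ : ℝ} (hρ : 0 < ρ) {G : Space N → Space N}
    (hG : MemLp G 2 (weightedVolume a (halfBall N ρ))) :
    IntervalIntegrable (fun s => s ^ (N + a) * ∫ θ, ‖G (s • θ)‖ ^ 2 ∂(weightedSphere N a 1))
      volume 0 ρ := by
  rw [intervalIntegrable_iff_integrableOn_Ioo_of_le hρ.le]
  exact (integral_weightedVolume_halfBall (MemLp.integrable_norm_sq hG)).1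

/-- In polar coordinates the energy is the primitive of an integrable function, so the Lebesgue
differentiation theorem applies. -/
lemma ae_hasDerivAt_energyD {a ρ : ℝ} {G : Space N → Space N}
    (hG : MemLp G 2 (weightedVolume a (halfBall N ρ))) :
    ∀ᵐ r, r ∈ Ioo 0 ρ → HasDerivAt (fun s => energyD a s G)
      (r ^ (N + a) * ∫ θ, ‖G (r • θ)‖ ^ 2 ∂(weightedSphere N a 1)) r := by
  rcases le_or_gt ρ 0 with hρ | hρ
  · exact ae_of_all _ fun r hr => absurd (hr.1.trans hr.2) (not_lt.2 hρ)
  filter_upwards [(intervalIntegrable_energy hρ hG).ae_hasDerivAt_integral] with r hr hrI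
  rw [uIcc_of_le hρ.le] at hr
  refine (hr ⟨hrI.1.le, hrI.2.le⟩ 0 ⟨le_rfl, hρ.le⟩).congr_of_eventuallyEq ?_
  filter_upwards [isOpen_Ioo.mem_nhds hrI] with s hs using energyD_eq hs hG

/-- `L²` convergence on almost every half-sphere, along a subsequence depending on the radius. -/
lemma SmoothApprox.ae_exists_sphere {a ρ : ℝ} {φ : ℕ → Space N → ℝ} {V : Space N → ℝ}
    {G : Space N → Space N} (hV : AEStronglyMeasurable V (weightedVolume a (halfBall N ρ)))
    (hG : AEStronglyMeasurable G (weightedVolume a (halfBall N ρ)))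
    (hφ : SmoothApprox a (halfBall N ρ) φ V G) :
    ∀ᵐ r, r ∈ Ioo 0 ρ → ∀ ε : ℝ≥0∞, 0 < ε → ∃ᶠ n in atTop,
      ∫⁻ θ, ‖φ n (r • θ) - V (r • θ)‖ₑ ^ 2 ∂(weightedSphere N a 1) < ε ∧
      ∫⁻ θ, ‖gradient (φ n) (r • θ) - G (r • θ)‖ₑ ^ 2 ∂(weightedSphere N a 1) < ε := by
  rw [← ae_radialMeasure_iff (N := N) (a := a)]
  set F : ℕ → Space N → ℝ≥0∞ := fun n Y => ‖φ n Y - V Y‖ₑ ^ 2 + ‖gradient (φ n) Y - G Y‖ₑ ^ 2 with hFdef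
  have hm1 : ∀ n, AEMeasurable (fun Y => ‖φ n Y - V Y‖ₑ ^ 2) (weightedVolume a (halfBall N ρ)) :=
    fun n => ((hφ.1 n).2.1.1.sub hV).enorm.pow_const 2
  have hm2 : ∀ n, AEMeasurable (fun Y => ‖gradient (φ n) Y - G Y‖ₑ ^ 2)
      (weightedVolume a (halfBall N ρ)) := fun n => ((hφ.1 n).2.2.1.sub hG).enorm.pow_const 2
  have hFm : ∀ n, AEMeasurable (fun p : ℝ × Space N => F n (p.1 • p.2))
      ((radialMeasure N a ρ).prod (weightedSphere N a 1)) := fun n =>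
    ((hm1 n).add (hm2 n)).comp_quasiMeasurePreserving (measurePreserving_polar a ρ).quasiMeasurePreserving
  have hlim : Tendsto (fun n => ∫⁻ s, ∫⁻ θ, F n (s • θ) ∂(weightedSphere N a 1) ∂(radialMeasure N a ρ))
      atTop (𝓝 0) := by
    refine hφ.tendsto_sq.congr fun n => ?_
    have h12 := (hm1 n).add (hm2 n)
    rw [← lintegral_add_left' (hm1 n), ← lintegral_prod _ (hFm n)]
    rw [weightedVolume_halfBall_eq_map] at h12 ⊢
    exact lintegral_map' h12 measurable_dilate.aemeasurable
  have hEm : ∀ n, AEMeasurable (fun s => ∫⁻ θ, F n (s • θ) ∂(weightedSphere N a 1))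
      (radialMeasure N a ρ) := fun n => (hFm n).lintegral_prod_right'
  -- The errors on spheres tend to zero in `L¹` of the radius, so by Fatou their lower limit
  -- vanishes at almost every radius. The measurable representatives are needed because the errors
  -- are only almost everywhere measurable in `s`.
  have hfatou : ∫⁻ s, liminf (fun n => (hEm n).mk _ s) atTop ∂(radialMeasure N a ρ) = 0 := by
    refine le_antisymm ((lintegral_liminf_le fun n => (hEm n).measurable_mk).trans ?_) zero_le
    refine (Tendsto.liminf_eq (hlim.congr fun n => ?_)).le
    exact lintegral_congr_ae (hEm n).ae_eq_mk
  rw [lintegral_eq_zero_iff (.liminf fun n => (hEm n).measurable_mk)] at hfatou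
  filter_upwards [hfatou, ae_all_iff.2 fun n => (hEm n).ae_eq_mk] with s hs hmk ε hε
  have hs' : liminf (fun n => ∫⁻ θ, F n (s • θ) ∂(weightedSphere N a 1)) atTop < ε := by
    simp only [hmk]
    rw [hs]; exact hε
  refine (frequently_lt_of_liminf_lt (by isBoundedDefault) hs').mono fun n hn => ⟨?_, ?_⟩
  · exact (lintegral_mono fun θ => le_self_add).trans_lt hn
  · exact (lintegral_mono fun θ => le_add_self).trans_lt hn

/-- `u` and `G` are `L²` limits on `H_r` of smooth functions and of their gradients. -/
def SphereApprox (a r : ℝ) (u : Space N → ℝ) (G : Space N → Space N) : Prop :=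
  ∀ ε : ℝ≥0∞, 0 < ε → ∃ ρ > r, ∃ φ : Space N → ℝ, ContDiffOn ℝ ∞ φ (halfBall N ρ) ∧
    ∫⁻ θ, ‖φ (r • θ) - u (r • θ)‖ₑ ^ 2 ∂(weightedSphere N a 1) < ε ∧
    ∫⁻ θ, ‖gradient φ (r • θ) - G (r • θ)‖ₑ ^ 2 ∂(weightedSphere N a 1) < ε

/-- Since `V` is only locally in `H¹`, statements are proved below each `ρ < R`; countably many `ρ`
suffice. -/
lemma ae_of_ae_Ioo {R : ℝ} {p : ℝ → Prop}
    (h : ∀ ρ ∈ Ioo 0 R, ∀ᵐ r, r ∈ Ioo 0 ρ → p r) : ∀ᵐ r, r ∈ Ioo 0 R → p r := by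
  rcases le_or_gt R 0 with hR | hR
  · exact ae_of_all _ fun r hr => absurd (hr.1.trans hr.2) (not_lt.2 hR)
  obtain ⟨u, -, hu, hlim⟩ := exists_seq_strictMono_tendsto' hR
  have := ae_all_iff.2 fun n => h (u n) (hu n)
  filter_upwards [this] with r hr hrI
  obtain ⟨n, hn⟩ := ((tendsto_order.1 hlim).1 r hrI.2).exists
  exact hr n ⟨hrI.1, hn⟩

/-- On almost every half-sphere, `V` agrees with its trace. -/
lemma ae_trace_eq {a R : ℝ} {V : Space N → ℝ} {G : Space N → Space N}
    (hV : HasH1LocGradient a R V G) {T : ℝ → Space N → ℝ}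
    (hT : ∀ r ∈ Ioo 0 R, IsTrace a R V G r (T r)) :
    ∀ᵐ r, r ∈ Ioo 0 R → (fun θ => V (r • θ)) =ᵐ[weightedSphere N a 1] fun θ => T r (r • θ) := by
  refine ae_of_ae_Ioo fun ρ hρ => ?_
  obtain ⟨hV1, hG1, φ, hφ⟩ := hV ρ hρ
  filter_upwards [hφ.ae_exists_sphere hV1.1 hG1.1, ae_memLp_sphere hV1] with r hr hVr hrI
  have hT1 := hT r ⟨hrI.1, hrI.2.trans hρ.2⟩
  have hlim := hT1.tendsto hrI.1 hrI.2 hρ.2 hV hφ.contDiffOn hφ.tendsto_sq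
  have hTm := hT1.memLp hrI.1
  have hzero : ∫⁻ θ, ‖V (r • θ) - T r (r • θ)‖ₑ ^ 2 ∂(weightedSphere N a 1) = 0 := by
    refine le_antisymm (ENNReal.le_of_forall_pos_le_add fun ε hε _ => ?_) zero_le
    -- Two errors of size `ε/4`, doubled by the quadratic triangle inequality, add up to `ε`.
    -- Closeness to `V` holds for infinitely many `n` and closeness to the trace for all large `n`,
    -- so some `n` has both.
    have hε' : (0 : ℝ≥0∞) < ε / 4 := by
      rw [ENNReal.div_pos_iff]; exact ⟨by simpa using hε.ne', by simp⟩
    obtain ⟨n, hn1, hn2⟩ := ((hr hrI _ hε').and_eventually (hlim.eventually (gt_mem_nhds hε'))).exists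
    have hφm := memLp_sphere_of_contDiffOn (hφ.contDiffOn n) (hφ.1 n).2.1 (hφ.1 n).2.2 hrI
    have e := lintegral_enorm_add_sq_le (μ := weightedSphere N a 1)
      (f := fun θ => V (r • θ) - φ n (r • θ)) (g := fun θ => φ n (r • θ) - T r (r • θ))
      ((hVr hrI).1.sub hφm.1)
    simp only [sub_add_sub_cancel] at e
    refine e.trans ?_
    have s1 : ∫⁻ θ, ‖V (r • θ) - φ n (r • θ)‖ₑ ^ 2 ∂(weightedSphere N a 1) =
        ∫⁻ θ, ‖φ n (r • θ) - V (r • θ)‖ₑ ^ 2 ∂(weightedSphere N a 1) := by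
      simp_rw [← edist_eq_enorm_sub, edist_comm]
    rw [s1, zero_add]
    calc 2 * (_ + _) ≤ 2 * ((ε : ℝ≥0∞) / 4 + ε / 4) := by
          gcongr
          exact hn1.1.le
      _ = ε := by
        rw [← two_mul, ← mul_assoc]
        norm_num
        exact ENNReal.mul_div_cancel (by simp) (by simp)
  have hm : AEMeasurable (fun θ => ‖V (r • θ) - T r (r • θ)‖ₑ ^ 2) (weightedSphere N a 1) :=
    ((hVr hrI).1.sub hTm.1).enorm.pow_const 2
  rw [lintegral_eq_zero_iff' hm] at hzero
  filter_upwards [hzero] with θ hθ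
  simpa [sub_eq_zero] using hθ

lemma ae_sphereApprox {a R : ℝ} {V : Space N → ℝ} {G : Space N → Space N}
    (hV : HasH1LocGradient a R V G) :
    ∀ᵐ r, r ∈ Ioo 0 R → SphereApprox a r V G := by
  refine ae_of_ae_Ioo fun ρ hρ => ?_
  obtain ⟨hV1, hG1, φ, hφ⟩ := hV ρ hρ
  filter_upwards [hφ.ae_exists_sphere hV1.1 hG1.1] with r hr hrI ε hε
  obtain ⟨n, hn⟩ := (hr hrI ε hε).exists
  exact ⟨ρ, hrI.2, φ n, (hφ.1 n).1, hn⟩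

lemma SphereApprox.congr {a r : ℝ} {u v : Space N → ℝ} {G : Space N → Space N}
    (h : SphereApprox a r u G)
    (huv : (fun θ => u (r • θ)) =ᵐ[weightedSphere N a 1] fun θ => v (r • θ)) :
    SphereApprox a r v G := by
  intro ε hε
  obtain ⟨ρ, hρ, φ, hφ, h1, h2⟩ := h ε hε
  refine ⟨ρ, hρ, φ, hφ, lt_of_eq_of_lt (lintegral_congr_ae ?_) h1, h2⟩
  filter_upwards [huv] with θ hθ
  rw [hθ]

lemma memLp_shell_inner {a r₁ r₂ ρ : ℝ} (h₁ : 0 < r₁) (h₁₂ : r₁ ≤ r₂) (h₂ : r₂ < ρ)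
    {G : Space N → Space N} (hG : MemLp G 2 (weightedVolume a (halfBall N ρ))) :
    MemLp (fun p : ℝ × Space N => inner ℝ p.2 (G (p.1 • p.2))) 2 (shellMeasure N a r₁ r₂) := by
  have h := memLp_shell a h₁ h₁₂ h₂ hG
  refine h.mono (measurable_snd.aestronglyMeasurable.inner h.1) ?_
  filter_upwards [ae_shell] with p hp
  refine (norm_inner_le_norm _ _).trans ?_
  rw [hp.2.1, one_mul]

/-- The increment of `r ↦ ∫ V(rθ)² dσ(θ)`. -/
lemma height_sub {a R : ℝ} {V : Space N → ℝ} {G : Space N → Space N}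
    (hV : HasH1LocGradient a R V G) {T : ℝ → Space N → ℝ}
    (hT : ∀ r ∈ Ioo 0 R, IsTrace a R V G r (T r)) {r₁ r₂ : ℝ} (h₁ : 0 < r₁) (h₁₂ : r₁ ≤ r₂)
    (h₂ : r₂ < R) :
    IntervalIntegrable (fun s => ∫ θ, 2 * (V (s • θ) * inner ℝ θ (G (s • θ)))
      ∂(weightedSphere N a 1)) volume r₁ r₂ ∧
    ∫ θ, T r₂ (r₂ • θ) ^ 2 ∂(weightedSphere N a 1) - ∫ θ, T r₁ (r₁ • θ) ^ 2 ∂(weightedSphere N a 1) =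
      ∫ s in r₁..r₂, ∫ θ, 2 * (V (s • θ) * inner ℝ θ (G (s • θ))) ∂(weightedSphere N a 1) := by
  obtain ⟨ρ, hρ, hρR⟩ := exists_between h₂
  have hρ0 : 0 < ρ := (h₁.trans_le h₁₂).trans hρ
  obtain ⟨hV1, hG1, φ, hφ⟩ := hV ρ ⟨hρ0, hρR⟩
  have hVs := memLp_shell a h₁ h₁₂ hρ hV1
  have hGs := memLp_shell_inner h₁ h₁₂ hρ hG1
  have hφs := fun n => memLp_shell a h₁ h₁₂ hρ (hφ.1 n).2.1
  have hgs := fun n => memLp_shell_inner h₁ h₁₂ hρ (hφ.1 n).2.2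
  have hInt {f g : ℝ × Space N → ℝ} (hf : MemLp f 2 (shellMeasure N a r₁ r₂))
      (hg : MemLp g 2 (shellMeasure N a r₁ r₂)) :
      Integrable (fun p => 2 * (f p * g p)) (shellMeasure N a r₁ r₂) :=
    (hf.integrable_mul hg).const_mul 2
  have hI := hInt hVs hGs
  have hlimr {r : ℝ} (hr0 : 0 < r) (hr : r < ρ) :
      Tendsto (fun n => ∫ θ, φ n (r • θ) ^ 2 ∂(weightedSphere N a 1)) atTop
        (𝓝 (∫ θ, T r (r • θ) ^ 2 ∂(weightedSphere N a 1))) := by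
    have hT1 := hT r ⟨hr0, hr.trans hρR⟩
    have hm : ∀ n, MemLp (fun θ => φ n (r • θ)) 2 (weightedSphere N a 1) := fun n =>
      memLp_sphere_of_contDiffOn (hφ.contDiffOn n) (hφ.1 n).2.1 (hφ.1 n).2.2 ⟨hr0, hr⟩
    have hl := hT1.tendsto hr0 hr hρR hV hφ.contDiffOn hφ.tendsto_sq
    have := tendsto_integral_inner (Eventually.of_forall hm) (Eventually.of_forall hm)
      (hT1.memLp hr0) (hT1.memLp hr0) hl hl
    simpa [sq] using this
  obtain ⟨C, hC, hle⟩ := lintegral_shell_le N a h₁ h₁₂ hρ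
  -- The right-hand side converges because both factors converge in `L²` of the shell.
  have hlimI : Tendsto (fun n => ∫ p, 2 * (φ n (p.1 • p.2) * inner ℝ p.2 (gradient (φ n) (p.1 • p.2)))
      ∂(shellMeasure N a r₁ r₂)) atTop
      (𝓝 (∫ p, 2 * (V (p.1 • p.2) * inner ℝ p.2 (G (p.1 • p.2))) ∂(shellMeasure N a r₁ r₂))) := by
    have l1 : Tendsto (fun n => ∫⁻ p, ‖φ n (p.1 • p.2) - V (p.1 • p.2)‖ₑ ^ 2
        ∂(shellMeasure N a r₁ r₂)) atTop (𝓝 0) := by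
      have := ENNReal.Tendsto.const_mul (tendsto_eLpNorm_two_iff.1 hφ.2.1) (Or.inr hC)
      rw [mul_zero] at this
      exact tendsto_of_tendsto_of_tendsto_of_le_of_le tendsto_const_nhds this (fun _ => zero_le)
        fun n => hle _ (((hφ.1 n).2.1.1.sub hV1.1).enorm.pow_const 2)
    have l2 : Tendsto (fun n => ∫⁻ p : ℝ × Space N, ‖inner ℝ p.2 (gradient (φ n) (p.1 • p.2)) -
        inner ℝ p.2 (G (p.1 • p.2))‖ₑ ^ 2 ∂(shellMeasure N a r₁ r₂)) atTop (𝓝 0) := by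
      have := ENNReal.Tendsto.const_mul (tendsto_eLpNorm_two_iff.1 hφ.2.2) (Or.inr hC)
      rw [mul_zero] at this
      refine tendsto_of_tendsto_of_tendsto_of_le_of_le tendsto_const_nhds this (fun _ => zero_le)
        fun n => le_trans ?_ (hle _ (((hφ.1 n).2.2.1.sub hG1.1).enorm.pow_const 2))
      refine lintegral_mono_ae ?_
      filter_upwards [ae_shell] with p hp
      gcongr
      rw [← inner_sub_right, ← ofReal_norm, ← ofReal_norm]
      refine ENNReal.ofReal_le_ofReal ((norm_inner_le_norm _ _).trans ?_)
      rw [hp.2.1, one_mul]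
    have := (tendsto_integral_inner (Eventually.of_forall hφs) (Eventually.of_forall hgs)
      hVs hGs l1 l2).const_mul 2
    simp only [← integral_const_mul] at this
    simpa only [RCLike.inner_apply, conj_trivial, mul_comm (inner ℝ _ _)] using this
  have hsub : Icc r₁ r₂ ⊆ Ioo 0 ρ := fun s hs => ⟨h₁.trans_le hs.1, hs.2.trans_lt hρ⟩
  -- For each smooth approximant: Fubini, then the fundamental theorem of calculus for `φ²` on each
  -- ray.
  have hftc : ∀ n, ∫ p, 2 * (φ n (p.1 • p.2) * inner ℝ p.2 (gradient (φ n) (p.1 • p.2)))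
      ∂(shellMeasure N a r₁ r₂) = ∫ θ, φ n (r₂ • θ) ^ 2 ∂(weightedSphere N a 1) -
        ∫ θ, φ n (r₁ • θ) ^ 2 ∂(weightedSphere N a 1) := by
    intro n
    have hm : ∀ r ∈ Ioo 0 ρ, Integrable (fun θ => φ n (r • θ) ^ 2) (weightedSphere N a 1) := fun r hr =>
      (memLp_sphere_of_contDiffOn (hφ.contDiffOn n) (hφ.1 n).2.1 (hφ.1 n).2.2 hr).integrable_sq
    have hIn := hInt (hφs n) (hgs n)
    rw [shellMeasure] at hIn ⊢
    rw [integral_prod_symm _ hIn, ← integral_sub (hm _ (hsub ⟨h₁₂, le_rfl⟩)) (hm _ (hsub ⟨le_rfl, h₁₂⟩))]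
    refine integral_congr_ae ?_
    filter_upwards [ae_weightedSphere_one N a] with θ hθ
    have hcg := continuousOn_gradient (isOpen_halfBall ρ) (hφ.contDiffOn n)
    have hd : ∀ s ∈ uIcc r₁ r₂, HasDerivAt (fun s => φ n (s • θ) ^ 2)
        (2 * (φ n (s • θ) * inner ℝ θ (gradient (φ n) (s • θ)))) s := by
      intro s hs
      rw [uIcc_of_le h₁₂] at hs
      have := (hasDerivAt_ray (hφ.contDiffOn n) hθ (hsub hs)).fun_pow 2
      simpa [mul_assoc] using this
    rw [← intervalIntegral.integral_of_le h₁₂]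
    refine intervalIntegral.integral_eq_sub_of_hasDerivAt hd (ContinuousOn.intervalIntegrable ?_)
    rw [uIcc_of_le h₁₂]
    exact (continuousOn_const.mul ((continuousOn_ray (hφ.contDiffOn n).continuousOn hθ).mul
      (continuousOn_const.inner (continuousOn_ray hcg hθ)))).mono hsub
  have heq := tendsto_nhds_unique (hlimI.congr hftc)
    ((hlimr (h₁.trans_le h₁₂) hρ).sub (hlimr h₁ (h₁₂.trans_lt hρ)))
  rw [shellMeasure] at hI heq
  constructor
  · rw [intervalIntegrable_iff_integrableOn_Ioc_of_le h₁₂]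
    exact hI.integral_prod_left
  · rw [← heq, integral_prod _ hI, intervalIntegral.integral_of_le h₁₂]

/-- The increments in `height_sub` start from a positive radius, so the Lebesgue differentiation
theorem is applied on `(δ, ρ)` for a sequence `δ → 0`. The increments involve the traces at every
radius, while the integrand involves `V` itself. -/
lemma ae_hasDerivAt_height {a R : ℝ} {V : Space N → ℝ} {G : Space N → Space N}
    (hV : HasH1LocGradient a R V G) {T : ℝ → Space N → ℝ}
    (hT : ∀ r ∈ Ioo 0 R, IsTrace a R V G r (T r)) :
    ∀ᵐ r, r ∈ Ioo 0 R → HasDerivAt (fun s => ∫ θ, T s (s • θ) ^ 2 ∂(weightedSphere N a 1))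
      (∫ θ, 2 * (V (r • θ) * inner ℝ θ (G (r • θ))) ∂(weightedSphere N a 1)) r := by
  refine ae_of_ae_Ioo fun ρ hρ => ?_
  have key : ∀ δ ∈ Ioo 0 ρ, ∀ᵐ r, r ∈ Ioo δ ρ →
      HasDerivAt (fun s => ∫ θ, T s (s • θ) ^ 2 ∂(weightedSphere N a 1))
      (∫ θ, 2 * (V (r • θ) * inner ℝ θ (G (r • θ))) ∂(weightedSphere N a 1)) r := by
    intro δ hδ
    have hI := (height_sub hV hT hδ.1 hδ.2.le hρ.2).1
    filter_upwards [hI.ae_hasDerivAt_integral] with r hr hrI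
    rw [uIcc_of_le hδ.2.le] at hr
    have := (hr ⟨hrI.1.le, hrI.2.le⟩ δ ⟨le_rfl, hδ.2.le⟩).const_add
      (∫ θ, T δ (δ • θ) ^ 2 ∂(weightedSphere N a 1))
    refine this.congr_of_eventuallyEq ?_
    filter_upwards [isOpen_Ioo.mem_nhds hrI] with s hs
    rw [← (height_sub hV hT hδ.1 hs.1.le (hs.2.trans hρ.2)).2]; ring
  obtain ⟨u, -, hu, hlim⟩ := exists_seq_strictAnti_tendsto' hρ.1
  filter_upwards [ae_all_iff.2 fun n => key (u n) (hu n)] with r hr hrI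
  obtain ⟨n, hn⟩ := ((tendsto_order.1 hlim).2 r hrI.1).exists
  exact hr n ⟨hn, hrI.2⟩

/-! ### The homogeneous extension and its energy -/

/-- The extension of a function on `H_r` that is homogeneous of degree `q`. -/
def radialExt {E : Type*} [NormedAddCommGroup E] [NormedSpace ℝ E] (q r : ℝ) (F : Space N → E)
    (Y : Space N) : E :=
  (‖Y‖ / r) ^ q • F ((r / ‖Y‖) • Y)

lemma homExt_eq_radialExt (h r : ℝ) (u : Space N → ℝ) : homExt h r u = radialExt h r u := rfl

section RadialExt

variable {E : Type*} [NormedAddCommGroup E] [NormedSpace ℝ E]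

lemma radialExt_smul {q r s : ℝ} (hs : 0 < s) {θ : Space N} (hθ : ‖θ‖ = 1) (F : Space N → E) :
    radialExt q r F (s • θ) = (s / r) ^ q • F (r • θ) := by
  have hn : ‖s • θ‖ = s := by rw [norm_smul, hθ, mul_one, Real.norm_of_nonneg hs.le]
  rw [radialExt, hn, smul_smul, div_mul_cancel₀ _ hs.ne']

lemma ae_radialMeasure_pos (N : ℕ) (a ρ : ℝ) : ∀ᵐ s ∂(radialMeasure N a ρ), 0 < s :=
  ae_radialMeasure_iff.2 (ae_of_all _ fun _ hs => hs.1)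

/-- On `H_r` the function is measurable only up to null sets, so what is needed is that `Y ↦ Y/‖Y‖`
pulls null sets of the sphere back to null sets. In polar coordinates this map is the second
projection. -/
lemma aestronglyMeasurable_radialExt {a q r : ℝ} {F : Space N → E}
    (hF : AEStronglyMeasurable (fun θ => F (r • θ)) (weightedSphere N a 1)) :
    AEStronglyMeasurable (radialExt q r F) (weightedVolume a (halfBall N r)) := by
  have hm : Measurable fun Y : Space N => ‖Y‖⁻¹ • Y := measurable_norm.inv.smul measurable_id
  have hq : Measure.QuasiMeasurePreserving (fun Y : Space N => ‖Y‖⁻¹ • Y)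
      (weightedVolume a (halfBall N r)) (weightedSphere N a 1) := by
    refine ⟨hm, ?_⟩
    rw [weightedVolume_halfBall_eq_map, Measure.map_map hm measurable_dilate]
    have hae : ((fun Y : Space N => ‖Y‖⁻¹ • Y) ∘ fun p : ℝ × Space N => p.1 • p.2)
        =ᵐ[(radialMeasure N a r).prod (weightedSphere N a 1)] Prod.snd := by
      have h1 : ∀ᵐ p ∂((radialMeasure N a r).prod (weightedSphere N a 1)), 0 < p.1 :=
        Measure.quasiMeasurePreserving_fst.ae (ae_radialMeasure_pos N a r)
      have h2 : ∀ᵐ p ∂((radialMeasure N a r).prod (weightedSphere N a 1)), ‖p.2‖ = 1 ∧ 0 < p.2 0 :=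
        Measure.quasiMeasurePreserving_snd.ae (ae_weightedSphere_one N a)
      filter_upwards [h1, h2] with p h1 h2
      have hn : ‖p.1 • p.2‖ = p.1 := by rw [norm_smul, h2.1, mul_one, Real.norm_of_nonneg h1.le]
      simp only [Function.comp_apply, hn]
      rw [smul_smul, inv_mul_cancel₀ h1.ne', one_smul]
    rw [Measure.map_congr hae]
    exact Measure.quasiMeasurePreserving_snd.absolutelyContinuous
  have h1 := hF.comp_quasiMeasurePreserving hq
  have h2 : AEStronglyMeasurable (fun Y : Space N => (‖Y‖ / r) ^ q) (weightedVolume a (halfBall N r)) := by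
    have : Measurable fun Y : Space N => (‖Y‖ / r) ^ q := by fun_prop
    exact this.aestronglyMeasurable
  refine (h2.smul h1).congr (ae_of_all _ fun Y => ?_)
  simp only [Pi.smul_apply', Function.comp_apply, radialExt, smul_smul, div_eq_mul_inv]

/-- The radial integral is that of `s^(N+a+2q)`, which converges at 0 exactly under `hq`. With `q =
h - 1`, the degree of the gradient, the condition reads `A > 0`. -/
lemma lintegral_radialExt_le (a : ℝ) {q r : ℝ} (hr : 0 < r) (hq : 0 < N + a + 2 * q + 1) :
    ∃ K : ℝ≥0∞, K ≠ ⊤ ∧ ∀ F : Space N → E,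
      AEStronglyMeasurable (fun θ => F (r • θ)) (weightedSphere N a 1) →
      ∫⁻ Y, ‖radialExt q r F Y‖ₑ ^ 2 ∂(weightedVolume a (halfBall N r)) ≤
        K * ∫⁻ θ, ‖F (r • θ)‖ₑ ^ 2 ∂(weightedSphere N a 1) := by
  refine ⟨∫⁻ s in Ioo 0 r, ENNReal.ofReal (s ^ (N + a) * ((s / r) ^ q) ^ 2), ?_, fun F hF => ?_⟩
  · have hI : IntegrableOn (fun s : ℝ => s ^ (N + a + 2 * q) * (r ^ (2 * q))⁻¹) (Ioo 0 r) := by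
      refine Integrable.mul_const ?_ _
      rw [← IntegrableOn, intervalIntegral.integrableOn_Ioo_rpow_iff hr]
      linarith
    refine (lt_of_eq_of_lt (setLIntegral_congr_fun measurableSet_Ioo fun s hs => ?_)
      hI.lintegral_lt_top).ne
    rw [← Real.rpow_natCast, ← Real.rpow_mul (div_nonneg hs.1.le hr.le), Real.div_rpow hs.1.le hr.le,
      Real.rpow_add hs.1 (N + a), Nat.cast_ofNat, mul_comm q 2, mul_assoc, div_eq_mul_inv]
  · have hm := (aestronglyMeasurable_radialExt (q := q) hF).enorm.pow_const 2
    have hmeas : Measurable fun s : ℝ => ENNReal.ofReal (s ^ (N + a) * ((s / r) ^ q) ^ 2) := by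
      fun_prop
    rw [lintegral_weightedVolume_halfBall' a r hm, ← lintegral_mul_const'' _ hmeas.aemeasurable]
    refine setLIntegral_mono' measurableSet_Ioo fun s hs => ?_
    rw [ENNReal.ofReal_mul (Real.rpow_nonneg hs.1.le _), mul_assoc]
    refine mul_le_mul_right (le_of_eq ?_) _
    rw [← lintegral_const_mul' _ _ ENNReal.ofReal_ne_top]
    refine lintegral_congr_ae ?_
    filter_upwards [ae_weightedSphere_one N a] with θ hθ
    rw [radialExt_smul hs.1 hθ.1, enorm_smul, mul_pow, enorm_sq_real]

end RadialExt

/-- The gradient on `H_r` of the `h`-homogeneous extension of a function with value `t` and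
gradient `g` at `Z ∈ H_r`. -/
def homCore (h r t : ℝ) (g Z : Space N) : Space N :=
  (h / r ^ 2 * t) • Z + g - (inner ℝ Z g / r ^ 2) • Z

/-- The gradient of the `h`-homogeneous extension. -/
def homGrad (h r : ℝ) (u : Space N → ℝ) (G : Space N → Space N) : Space N → Space N :=
  radialExt (h - 1) r fun Z => homCore h r (u Z) (G Z) Z

lemma homCore_sub (h r t t' : ℝ) (g g' Z : Space N) :
    homCore h r t g Z - homCore h r t' g' Z = homCore h r (t - t') (g - g') Z := by
  simp only [homCore, inner_sub_right]
  module

/-- Pythagoras: the radial part of `g` is replaced by `h t / r` and the tangential part is kept. -/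
lemma norm_homCore_sq {h r : ℝ} (hr : 0 < r) (t : ℝ) (g : Space N) {Z : Space N} (hZ : ‖Z‖ = r) :
    ‖homCore h r t g Z‖ ^ 2 = h ^ 2 / r ^ 2 * t ^ 2 + ‖g‖ ^ 2 - inner ℝ Z g ^ 2 / r ^ 2 := by
  have e : homCore h r t g Z = g + (h / r ^ 2 * t - inner ℝ Z g / r ^ 2) • Z := by
    simp only [homCore]; module
  rw [e, norm_add_sq_real, inner_smul_right, norm_smul, mul_pow, hZ, Real.norm_eq_abs, sq_abs,
    real_inner_comm]
  field_simp
  ring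

lemma enorm_homCore_sq_le {h r : ℝ} (hr : 0 < r) (t : ℝ) (g : Space N) {Z : Space N} (hZ : ‖Z‖ = r) :
    ‖homCore h r t g Z‖ₑ ^ 2 ≤ ENNReal.ofReal (h ^ 2 / r ^ 2 + 1) * (‖t‖ₑ ^ 2 + ‖g‖ₑ ^ 2) := by
  rw [enorm_sq_eq_ofReal, norm_homCore_sq hr t g hZ, enorm_sq_real, enorm_sq_eq_ofReal,
    ← ENNReal.ofReal_add (by positivity) (by positivity), ← ENNReal.ofReal_mul (by positivity)]
  refine ENNReal.ofReal_le_ofReal ?_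
  have h1 : 0 ≤ inner ℝ Z g ^ 2 / r ^ 2 := by positivity
  have h2 : 0 ≤ h ^ 2 / r ^ 2 * ‖g‖ ^ 2 := by positivity
  nlinarith [sq_nonneg t]

lemma aestronglyMeasurable_homCore {a h r : ℝ} {u : Space N → ℝ} {G : Space N → Space N}
    (hu : AEStronglyMeasurable (fun θ => u (r • θ)) (weightedSphere N a 1))
    (hG : AEStronglyMeasurable (fun θ => G (r • θ)) (weightedSphere N a 1)) :
    AEStronglyMeasurable (fun θ => homCore h r (u (r • θ)) (G (r • θ)) (r • θ))
      (weightedSphere N a 1) := by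
  have hid : AEStronglyMeasurable (fun θ : Space N => r • θ) (weightedSphere N a 1) :=
    (measurable_const_smul r).aestronglyMeasurable
  unfold homCore
  have h1 := ((hu.const_mul (h / r ^ 2)).smul hid).add hG
  have h0 : AEStronglyMeasurable (fun θ => (inner ℝ (r • θ) (G (r • θ)) : ℝ) / r ^ 2)
      (weightedSphere N a 1) := by
    simp only [div_eq_mul_inv]
    exact (hid.inner hG).mul_const _
  have h2 := h0.smul hid
  exact h1.sub h2

lemma lintegral_homCore_le {a h r : ℝ} (hr : 0 < r) {u : Space N → ℝ} {G : Space N → Space N}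
    (hu : AEStronglyMeasurable (fun θ => u (r • θ)) (weightedSphere N a 1)) :
    ∫⁻ θ, ‖homCore h r (u (r • θ)) (G (r • θ)) (r • θ)‖ₑ ^ 2 ∂(weightedSphere N a 1) ≤
      ENNReal.ofReal (h ^ 2 / r ^ 2 + 1) * (∫⁻ θ, ‖u (r • θ)‖ₑ ^ 2 ∂(weightedSphere N a 1) +
        ∫⁻ θ, ‖G (r • θ)‖ₑ ^ 2 ∂(weightedSphere N a 1)) := by
  rw [← lintegral_add_left' (hu.enorm.pow_const 2), ← lintegral_const_mul' _ _ ENNReal.ofReal_ne_top]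
  refine lintegral_mono_ae ?_
  filter_upwards [ae_weightedSphere_one N a] with θ hθ
  refine enorm_homCore_sq_le hr _ _ ?_
  rw [norm_smul, hθ.1, mul_one, Real.norm_of_nonneg hr.le]

lemma hasFDerivAt_norm {Y : Space N} (hY : Y ≠ 0) :
    HasFDerivAt (fun Y : Space N => ‖Y‖) (‖Y‖⁻¹ • innerSL ℝ Y) Y := by
  have h1 := (hasStrictFDerivAt_norm_sq Y).hasFDerivAt.sqrt (by simpa using hY)
  simp only [Real.sqrt_sq (norm_nonneg _)] at h1
  convert! h1 using 1
  ext v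
  have : ‖Y‖ ≠ 0 := norm_ne_zero_iff.2 hY
  simp
  field_simp

lemma mem_halfBall_scale {r ρ : ℝ} (hr : 0 < r) (hρ : r < ρ) {Y : Space N} (hY : Y ∈ halfBall N r) :
    Y ≠ 0 ∧ (r / ‖Y‖) • Y ∈ halfBall N ρ ∧ ‖(r / ‖Y‖) • Y‖ = r := by
  have hY0 : Y ≠ 0 := by
    rintro rfl
    have := hY.1
    simp at this
  have hn : 0 < ‖Y‖ := norm_pos_iff.2 hY0
  have hnorm : ‖(r / ‖Y‖) • Y‖ = r := by
    rw [norm_smul, Real.norm_of_nonneg (by positivity), div_mul_cancel₀ _ hn.ne']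
  refine ⟨hY0, ⟨?_, hnorm.trans_lt hρ⟩, hnorm⟩
  have : 0 < r / ‖Y‖ * Y 0 := mul_pos (by positivity) hY.1
  simpa using this

lemma contDiffOn_homExt {h r ρ : ℝ} (hr : 0 < r) (hρ : r < ρ) {φ : Space N → ℝ}
    (hφ : ContDiffOn ℝ ∞ φ (halfBall N ρ)) : ContDiffOn ℝ ∞ (homExt h r φ) (halfBall N r) := by
  intro Y hY
  obtain ⟨hY0, hZ, -⟩ := mem_halfBall_scale hr hρ hY
  have hn : ‖Y‖ ≠ 0 := norm_ne_zero_iff.2 hY0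
  have h1 : ContDiffAt ℝ ∞ (fun Y : Space N => ‖Y‖) Y := contDiffAt_norm ℝ hY0
  have h2 : ContDiffAt ℝ ∞ (fun Y : Space N => (‖Y‖ / r) ^ h) Y :=
    (h1.div_const r).rpow_const_of_ne (by positivity)
  have h3 : ContDiffAt ℝ ∞ (fun Y : Space N => (r / ‖Y‖) • Y) Y :=
    (contDiffAt_const.div h1 hn).smul contDiffAt_id
  have h4 : ContDiffAt ℝ ∞ (fun Y => φ ((r / ‖Y‖) • Y)) Y :=
    ContDiffAt.comp (f := fun Y : Space N => (r / ‖Y‖) • Y) Y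
      (hφ.contDiffAt ((isOpen_halfBall ρ).mem_nhds hZ)) h3
  exact (h2.mul h4).contDiffWithinAt

lemma gradient_homExt {h r ρ : ℝ} (hr : 0 < r) (hρ : r < ρ) {φ : Space N → ℝ}
    (hφ : ContDiffOn ℝ 1 φ (halfBall N ρ)) {Y : Space N} (hY : Y ∈ halfBall N r) :
    gradient (homExt h r φ) Y = homGrad h r φ (gradient φ) Y := by
  obtain ⟨hY0, hZ, -⟩ := mem_halfBall_scale hr hρ hY
  have hn : 0 < ‖Y‖ := norm_pos_iff.2 hY0
  have h1 := hasFDerivAt_norm hY0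
  have h2 : HasFDerivAt (fun Y : Space N => (‖Y‖ / r) ^ h) _ Y :=
    (h1.mul_const r⁻¹).rpow_const (p := h) (Or.inl (by positivity))
  have h3 : HasFDerivAt (fun Y : Space N => (r / ‖Y‖) • Y) _ Y :=
    (((hasDerivAt_inv hn.ne').comp_hasFDerivAt Y h1).const_mul r).smul (hasFDerivAt_id Y)
  have h4 : HasFDerivAt (fun Y => φ ((r / ‖Y‖) • Y)) _ Y :=
    HasFDerivAt.comp (f := fun Y : Space N => (r / ‖Y‖) • Y) Y
      (hasGradientAt_of_contDiffOn (isOpen_halfBall ρ) hφ hZ).hasFDerivAt h3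
  have h5 := h2.mul h4
  -- The chain rule gives one factor `1/‖Y‖` next to `(‖Y‖/r)^h`; writing this power as
  -- `(‖Y‖/r)^(h-1) · ‖Y‖/r` exhibits the degree `h - 1`.
  refine (hasGradientAt_iff_hasFDerivAt.2 (h5.congr_fderiv ?_)).gradient
  ext v
  set g := gradient φ ((r / ‖Y‖) • Y) with hg
  have hpow : (‖Y‖ / r) ^ h = (‖Y‖ / r) ^ (h - 1) * (‖Y‖ / r) := by
    rw [← Real.rpow_add_one (by positivity), sub_add_cancel]
  simp only [homGrad, radialExt, homCore, ← hg, hpow, ← div_eq_mul_inv]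
  simp [inner_smul_left, inner_smul_right]
  rw [real_inner_comm Y g]
  field_simp
  ring

lemma memLp_homExt {a h r : ℝ} (hr : 0 < r) (hA : 0 < expA N a h) {u : Space N → ℝ}
    (hu : MemLp (fun θ => u (r • θ)) 2 (weightedSphere N a 1)) :
    MemLp (homExt h r u) 2 (weightedVolume a (halfBall N r)) := by
  rw [expA] at hA
  obtain ⟨K, hK, hle⟩ := lintegral_radialExt_le (E := ℝ) (N := N) a (q := h) hr (by linarith)
  rw [homExt_eq_radialExt, memLp_two_iff (aestronglyMeasurable_radialExt hu.1)]
  exact (hle u hu.1).trans_lt (ENNReal.mul_lt_top hK.lt_top (MemLp.lintegral_sq_lt_top hu))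

lemma memLp_homCore {a h r : ℝ} (hr : 0 < r) {u : Space N → ℝ} {G : Space N → Space N}
    (hu : MemLp (fun θ => u (r • θ)) 2 (weightedSphere N a 1))
    (hG : MemLp (fun θ => G (r • θ)) 2 (weightedSphere N a 1)) :
    MemLp (fun θ => homCore h r (u (r • θ)) (G (r • θ)) (r • θ)) 2 (weightedSphere N a 1) := by
  rw [memLp_two_iff (aestronglyMeasurable_homCore hu.1 hG.1)]
  exact (lintegral_homCore_le hr hu.1).trans_lt (ENNReal.mul_lt_top ENNReal.ofReal_lt_top
    (ENNReal.add_lt_top.2 ⟨MemLp.lintegral_sq_lt_top hu, MemLp.lintegral_sq_lt_top hG⟩))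

lemma memLp_homGrad {a h r : ℝ} (hr : 0 < r) (hA : 0 < expA N a h) {u : Space N → ℝ}
    {G : Space N → Space N} (hu : MemLp (fun θ => u (r • θ)) 2 (weightedSphere N a 1))
    (hG : MemLp (fun θ => G (r • θ)) 2 (weightedSphere N a 1)) :
    MemLp (homGrad h r u G) 2 (weightedVolume a (halfBall N r)) := by
  rw [expA] at hA
  obtain ⟨K, hK, hle⟩ := lintegral_radialExt_le (E := Space N) (N := N) a (q := h - 1) hr (by linarith)
  have hc := memLp_homCore (h := h) hr hu hG
  have hm : AEStronglyMeasurable (homGrad h r u G) (weightedVolume a (halfBall N r)) :=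
    aestronglyMeasurable_radialExt (F := fun Z => homCore h r (u Z) (G Z) Z) hc.1
  rw [memLp_two_iff hm]
  exact (hle (fun Z => homCore h r (u Z) (G Z) Z) hc.1).trans_lt
    (ENNReal.mul_lt_top hK.lt_top (MemLp.lintegral_sq_lt_top hc))

lemma memLp_of_sub {α E : Type*} [MeasurableSpace α] {μ : Measure α} [NormedAddCommGroup E]
    {f g : α → E} (hf : AEStronglyMeasurable f μ) (hg : MemLp g 2 μ)
    (h : ∫⁻ x, ‖f x - g x‖ₑ ^ 2 ∂μ < ⊤) : MemLp f 2 μ := by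
  have : MemLp (fun x => f x - g x) 2 μ := (memLp_two_iff (hf.sub hg.1)).2 h
  exact (memLp_congr_ae (ae_of_all _ fun x => by simp)).1 (this.add hg)

/-- The homogeneous extension of a function on `H_r` that is approximated by smooth functions
together with its gradient belongs to the weighted Sobolev space. -/
lemma SphereApprox.hasH1Gradient_homExt {a h r : ℝ} (hr : 0 < r) (hA : 0 < expA N a h)
    {u : Space N → ℝ} {G : Space N → Space N} (hS : SphereApprox a r u G)
    (hu : MemLp (fun θ => u (r • θ)) 2 (weightedSphere N a 1))
    (hG : MemLp (fun θ => G (r • θ)) 2 (weightedSphere N a 1)) :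
    HasH1Gradient a (halfBall N r) (homExt h r u) (homGrad h r u G) := by
  refine ⟨memLp_homExt hr hA hu, memLp_homGrad hr hA hu hG, ?_⟩
  have hA' := hA
  rw [expA] at hA'
  obtain ⟨K₁, hK₁, hle₁⟩ := lintegral_radialExt_le (E := ℝ) (N := N) a (q := h) hr (by linarith)
  obtain ⟨K₂, hK₂, hle₂⟩ := lintegral_radialExt_le (E := Space N) (N := N) a (q := h - 1) hr
    (by linarith)
  -- Approximants on `H_r` with error `1/(n+1)`. Each is defined on its own half-ball beyond `H_r`,
  -- but all their homogeneous extensions are smooth on `D_r`.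
  choose ρ hρ φ hφ h1 h2 using fun n : ℕ => hS ((n : ℝ≥0∞) + 1)⁻¹ (by simp)
  have hlim0 : Tendsto (fun n : ℕ => ((n : ℝ≥0∞) + 1)⁻¹) atTop (𝓝 0) := by
    have := (tendsto_add_atTop_iff_nat 1).2 ENNReal.tendsto_inv_nat_nhds_zero
    simpa using this
  have hφ1 : ∀ n, ContDiffOn ℝ 1 (φ n) (halfBall N (ρ n)) := fun n =>
    (hφ n).of_le (by exact_mod_cast le_top)
  have hfin : ∀ n : ℕ, ((n : ℝ≥0∞) + 1)⁻¹ < ⊤ := fun n => by simp [ENNReal.inv_lt_top]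
  have hmφ : ∀ n, MemLp (fun θ => φ n (r • θ)) 2 (weightedSphere N a 1) := fun n =>
    memLp_of_sub (aestronglyMeasurable_sphere_of_continuousOn a (hφ n).continuousOn ⟨hr, hρ n⟩) hu
      ((h1 n).trans (hfin n))
  have hmg : ∀ n, MemLp (fun θ => gradient (φ n) (r • θ)) 2 (weightedSphere N a 1) := fun n =>
    memLp_of_sub (aestronglyMeasurable_sphere_of_continuousOn a
      (continuousOn_gradient (isOpen_halfBall _) (hφ1 n)) ⟨hr, hρ n⟩) hG ((h2 n).trans (hfin n))
  have hgr : ∀ n, gradient (homExt h r (φ n)) =ᵐ[weightedVolume a (halfBall N r)]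
      homGrad h r (φ n) (gradient (φ n)) := fun n => by
    filter_upwards [ae_mem_halfBall a r] with Y hY using gradient_homExt hr (hρ n) (hφ1 n) hY
  refine ⟨fun n => homExt h r (φ n), fun n => ⟨contDiffOn_homExt hr (hρ n) (hφ n),
    memLp_homExt hr hA (hmφ n), (memLp_congr_ae (hgr n)).2 (memLp_homGrad hr hA (hmφ n) (hmg n))⟩,
    tendsto_eLpNorm_two_iff.2 ?_, tendsto_eLpNorm_two_iff.2 ?_⟩
  · have hl : Tendsto (fun n : ℕ => K₁ * ((n : ℝ≥0∞) + 1)⁻¹) atTop (𝓝 0) := by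
      simpa using ENNReal.Tendsto.const_mul hlim0 (Or.inr hK₁)
    refine tendsto_of_tendsto_of_tendsto_of_le_of_le tendsto_const_nhds hl (fun _ => zero_le)
      fun n => ?_
    have := hle₁ (fun Y => φ n Y - u Y) ((hmφ n).1.sub hu.1)
    refine le_trans (le_of_eq (lintegral_congr fun Y => ?_))
      (this.trans (mul_le_mul_right (h1 n).le _))
    simp only [homExt, radialExt, smul_eq_mul, mul_sub]
  · have hl : Tendsto (fun n : ℕ => K₂ * (ENNReal.ofReal (h ^ 2 / r ^ 2 + 1) *
        (((n : ℝ≥0∞) + 1)⁻¹ + ((n : ℝ≥0∞) + 1)⁻¹))) atTop (𝓝 0) := by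
      have := ENNReal.Tendsto.const_mul (ENNReal.Tendsto.const_mul (hlim0.add hlim0)
        (Or.inr (ENNReal.ofReal_ne_top (r := h ^ 2 / r ^ 2 + 1)))) (Or.inr hK₂)
      simpa using this
    refine tendsto_of_tendsto_of_tendsto_of_le_of_le tendsto_const_nhds hl (fun _ => zero_le)
      fun n => ?_
    have hs1 : AEStronglyMeasurable (fun θ => φ n (r • θ) - u (r • θ)) (weightedSphere N a 1) :=
      (hmφ n).1.sub hu.1
    have hs2 : AEStronglyMeasurable (fun θ => gradient (φ n) (r • θ) - G (r • θ))
      (weightedSphere N a 1) := (hmg n).1.sub hG.1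
    have := hle₂ (fun Y => homCore h r (φ n Y - u Y) (gradient (φ n) Y - G Y) Y)
      (aestronglyMeasurable_homCore (u := fun Y => φ n Y - u Y)
        (G := fun Y => gradient (φ n) Y - G Y) hs1 hs2)
    refine le_trans (le_of_eq (lintegral_congr_ae ?_)) (this.trans ?_)
    · filter_upwards [hgr n] with Y hY
      rw [hY]
      simp only [homGrad, radialExt, ← smul_sub, homCore_sub]
    · refine mul_le_mul_right ((lintegral_homCore_le (u := fun Y => φ n Y - u Y)
        (G := fun Y => gradient (φ n) Y - G Y) hr hs1).trans ?_) _
      exact mul_le_mul_right (add_le_add (h1 n).le (h2 n).le) _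

/-- Homogeneity separates the variables: `|∇V̄|²` at `sθ` is `(s/r)^(2h-2)` times its value on
`H_r`, and `N + a + 2h - 2 = A - 1` integrates to `r^A / A`. -/
lemma energyD_homGrad {a h r : ℝ} (hr : 0 < r) (hA : 0 < expA N a h) {u : Space N → ℝ}
    {G : Space N → Space N} (hu : MemLp (fun θ => u (r • θ)) 2 (weightedSphere N a 1))
    (hG : MemLp (fun θ => G (r • θ)) 2 (weightedSphere N a 1)) :
    energyD a r (homGrad h r u G) = r ^ (N + a) * r / expA N a h *
      (h ^ 2 / r ^ 2 * ∫ θ, u (r • θ) ^ 2 ∂(weightedSphere N a 1) +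
        ∫ θ, ‖G (r • θ)‖ ^ 2 ∂(weightedSphere N a 1) -
        ∫ θ, inner ℝ θ (G (r • θ)) ^ 2 ∂(weightedSphere N a 1)) := by
  have hA' := hA
  rw [expA] at hA'
  have hm := memLp_homGrad (h := h) hr hA hu hG
  rw [energyD, (integral_weightedVolume_halfBall (MemLp.integrable_norm_sq hm)).2]
  set J := h ^ 2 / r ^ 2 * ∫ θ, u (r • θ) ^ 2 ∂(weightedSphere N a 1) +
        ∫ θ, ‖G (r • θ)‖ ^ 2 ∂(weightedSphere N a 1) -
        ∫ θ, inner ℝ θ (G (r • θ)) ^ 2 ∂(weightedSphere N a 1) with hJ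
  have hg : MemLp (fun θ => inner ℝ θ (G (r • θ))) 2 (weightedSphere N a 1) := by
    refine hG.mono (measurable_id.aestronglyMeasurable.inner hG.1) ?_
    filter_upwards [ae_weightedSphere_one N a] with θ hθ
    refine (norm_inner_le_norm _ _).trans ?_
    rw [hθ.1, one_mul]
  have hinner : ∀ s ∈ Ioo 0 r, s ^ (N + a) * ∫ θ, ‖homGrad h r u G (s • θ)‖ ^ 2 ∂(weightedSphere N a 1)
      = s ^ (expA N a h - 1) * ((r ^ (2 * h - 2))⁻¹ * J) := by
    intro s hs
    have e1 : ∫ θ, ‖homGrad h r u G (s • θ)‖ ^ 2 ∂(weightedSphere N a 1) =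
        ∫ θ, ((s / r) ^ (h - 1)) ^ 2 * (h ^ 2 / r ^ 2 * u (r • θ) ^ 2 + ‖G (r • θ)‖ ^ 2 -
          inner ℝ θ (G (r • θ)) ^ 2) ∂(weightedSphere N a 1) := by
      refine integral_congr_ae ?_
      filter_upwards [ae_weightedSphere_one N a] with θ hθ
      have hn : ‖r • θ‖ = r := by rw [norm_smul, hθ.1, mul_one, Real.norm_of_nonneg hr.le]
      rw [homGrad, radialExt_smul hs.1 hθ.1, norm_smul, mul_pow, Real.norm_eq_abs, sq_abs,
        norm_homCore_sq hr _ _ hn, inner_smul_left]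
      congr 2
      simp only [conj_trivial]
      field_simp
    have e2 : ((s / r) ^ (h - 1)) ^ 2 = s ^ (2 * h - 2) * (r ^ (2 * h - 2))⁻¹ := by
      rw [← Real.rpow_natCast, ← Real.rpow_mul (div_nonneg hs.1.le hr.le),
        Real.div_rpow hs.1.le hr.le, div_eq_mul_inv]
      congr 2 <;> push_cast <;> ring_nf
    have e3 : s ^ (expA N a h - 1) = s ^ (N + a) * s ^ (2 * h - 2) := by
      rw [← Real.rpow_add hs.1, expA]; ring_nf
    have i1 := hu.integrable_sq.const_mul (h ^ 2 / r ^ 2)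
    have i2 := MemLp.integrable_norm_sq hG
    have i3 := hg.integrable_sq
    have e4 := integral_sub (i1.add i2) i3
    simp only [Pi.add_apply] at e4
    rw [e1, integral_const_mul, e4, integral_add i1 i2, integral_const_mul, e2, e3]
    ring
  rw [setIntegral_congr_fun measurableSet_Ioo hinner, integral_mul_const, ← integral_Ioc_eq_integral_Ioo,
    ← intervalIntegral.integral_of_le hr.le, integral_rpow (Or.inl (by linarith)), sub_add_cancel,
    Real.zero_rpow hA.ne', sub_zero]
  have e4 : r ^ expA N a h = r ^ (N + a) * r * r ^ (2 * h - 2) := by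
    rw [← Real.rpow_add_one hr.ne', ← Real.rpow_add hr, expA]; ring_nf
  have : r ^ (2 * h - 2) ≠ 0 := (Real.rpow_pos_of_pos hr _).ne'
  rw [e4]
  field_simp

/-! ### The Weiss identity at a good radius, and almost everywhere -/

/-- The Weiss identity at a radius at which the energy and the height are differentiable with the
expected derivatives. -/
lemma weissIdentityAt_of_hasDerivAt {a h r : ℝ} (hr : 0 < r) (hA : 0 < expA N a h)
    {T : ℝ → Space N → ℝ} {G : Space N → Space N} (hS : SphereApprox a r (T r) G)
    (hu : MemLp (fun θ => T r (r • θ)) 2 (weightedSphere N a 1))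
    (hG : MemLp (fun θ => G (r • θ)) 2 (weightedSphere N a 1))
    (hD : HasDerivAt (fun s => energyD a s G)
      (r ^ (N + a) * ∫ θ, ‖G (r • θ)‖ ^ 2 ∂(weightedSphere N a 1)) r)
    (hH : HasDerivAt (fun s => ∫ θ, T s (s • θ) ^ 2 ∂(weightedSphere N a 1))
      (∫ θ, 2 * (T r (r • θ) * inner ℝ θ (G (r • θ))) ∂(weightedSphere N a 1)) r) :
    WeissIdentityAt a h T G r := by
  have hg : MemLp (fun θ => inner ℝ θ (G (r • θ))) 2 (weightedSphere N a 1) := by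
    refine hG.mono (measurable_id.aestronglyMeasurable.inner hG.1) ?_
    filter_upwards [ae_weightedSphere_one N a] with θ hθ
    refine (norm_inner_le_norm _ _).trans ?_
    rw [hθ.1, one_mul]
  have hdiff : MemLp (fun θ => r * inner ℝ θ (G (r • θ)) - h * T r (r • θ)) 2 (weightedSphere N a 1) :=
    (hg.const_mul r).sub (hu.const_mul h)
  have hinn : ∀ θ : Space N, inner ℝ (r • θ) (G (r • θ)) = r * inner ℝ θ (G (r • θ)) := fun θ => by
    rw [inner_smul_left]; rfl
  refine ⟨?_, homGrad h r (T r) G, hS.hasH1Gradient_homExt hr hA hu hG, ?_⟩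
  · rw [integrable_weightedSphere_iff a hr]
    simp only [hinn]
    exact hdiff.integrable_sq
  have hsplit : ∫ Y, (inner ℝ Y (G Y) - h * T r Y) ^ 2 ∂(weightedSphere N a r) =
      r ^ (N + a) * (r ^ 2 * ∫ θ, inner ℝ θ (G (r • θ)) ^ 2 ∂(weightedSphere N a 1) -
        r * h * ∫ θ, 2 * (T r (r • θ) * inner ℝ θ (G (r • θ))) ∂(weightedSphere N a 1) +
        h ^ 2 * ∫ θ, T r (r • θ) ^ 2 ∂(weightedSphere N a 1)) := by
    rw [integral_weightedSphere a hr]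
    simp only [hinn]
    have i1 := hg.integrable_sq.const_mul (r ^ 2)
    have i2 := (((hu.integrable_mul hg).const_mul 2).const_mul (r * h))
    have i3 := hu.integrable_sq.const_mul (h ^ 2)
    simp only [Pi.mul_apply] at i2
    have e1 := integral_add (i1.sub i2) i3
    simp only [Pi.sub_apply] at e1
    rw [integral_sub i1 i2] at e1
    simp only [integral_const_mul] at e1 ⊢
    rw [← e1]
    congr 1
    refine integral_congr_ae (ae_of_all _ fun θ => ?_)
    simp only
    ring
  -- The extension coincides with `V` on `H_r`, so the two heights cancel in the difference of Weiss
  -- functionals.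
  have hbar : heightH a r (homExt h r (T r)) = r ^ (N + a) * ∫ θ, T r (r • θ) ^ 2 ∂(weightedSphere N a 1) := by
    rw [heightH, integral_weightedSphere a hr]
    congr 1
    refine integral_congr_ae ?_
    filter_upwards [ae_weightedSphere_one N a] with θ hθ
    rw [homExt_eq_radialExt, radialExt_smul hr hθ.1, div_self hr.ne', Real.one_rpow, one_smul]
  have hheight : ∀ s > 0, heightH a s (T s) = s ^ (N + a) * ∫ θ, T s (s • θ) ^ 2 ∂(weightedSphere N a 1) :=
    fun s hs => by rw [heightH, integral_weightedSphere a hs]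
  set A := expA N a h with hAdef
  set X := ∫ θ, T r (r • θ) ^ 2 ∂(weightedSphere N a 1) with hX
  set P := ∫ θ, ‖G (r • θ)‖ ^ 2 ∂(weightedSphere N a 1) with hP
  set Q := ∫ θ, inner ℝ θ (G (r • θ)) ^ 2 ∂(weightedSphere N a 1) with hQ
  set S := ∫ θ, 2 * (T r (r • θ) * inner ℝ θ (G (r • θ))) ∂(weightedSphere N a 1) with hSdef
  have hA1 : HasDerivAt (fun s : ℝ => 1 / s ^ A) (-(A * r ^ (A - 1)) / (r ^ A) ^ 2) r := by
    have := (Real.hasDerivAt_rpow_const (x := r) (p := A) (Or.inl hr.ne')).fun_inv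
      (Real.rpow_pos_of_pos hr A).ne'
    simpa only [one_div] using this
  have hA2 : HasDerivAt (fun s : ℝ => h / s ^ (A + 1))
      (h * (-((A + 1) * r ^ (A + 1 - 1)) / (r ^ (A + 1)) ^ 2)) r := by
    have := ((Real.hasDerivAt_rpow_const (x := r) (p := A + 1) (Or.inl hr.ne')).fun_inv
      (Real.rpow_pos_of_pos hr (A + 1)).ne').const_mul h
    simpa only [div_eq_mul_inv] using this
  have hq := Real.hasDerivAt_rpow_const (x := r) (p := N + a) (Or.inl hr.ne')
  have hmain := (hA1.mul hD).sub (hA2.mul (hq.mul hH))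
  have hev : (fun s => weissW a h s (T s) G) =ᶠ[𝓝 r]
      fun s => 1 / s ^ A * energyD a s G - h / s ^ (A + 1) *
        (s ^ (N + a) * ∫ θ, T s (s • θ) ^ 2 ∂(weightedSphere N a 1)) := by
    filter_upwards [lt_mem_nhds hr] with s hs
    rw [weissW, hheight s hs]
  refine (hmain.congr_of_eventuallyEq hev).congr_deriv ?_
  simp only [weissW]
  rw [hsplit, hbar, hheight r hr, energyD_homGrad hr hA hu hG, ← hX, ← hP, ← hQ, ← hAdef]
  have p1 : r ^ (A - 1) = r ^ A / r := by rw [Real.rpow_sub_one hr.ne']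
  have p2 : r ^ (A + 1) = r ^ A * r := by rw [Real.rpow_add_one hr.ne']
  have p3 : r ^ (A + 2) = r ^ A * r ^ 2 := by
    rw [Real.rpow_add hr]; norm_num
  have p4 : r ^ (N + a - 1) = r ^ (N + a) / r := by rw [Real.rpow_sub_one hr.ne']
  -- The coefficient of the height in the derivative, `-(A+1) + (N+a)`, becomes `-2h`. This gives
  -- `2h²` in total: one `h²` belongs to the energy of the extension, the other to the square `(Y·∇V
  -- - hV)²`.
  have hAq : (N : ℝ) + a = A - 2 * h + 1 := by rw [hAdef, expA]; ring
  have hrA : r ^ A ≠ 0 := (Real.rpow_pos_of_pos hr A).ne'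
  rw [add_sub_cancel_right, p1, p2, p3, p4]
  simp only [Pi.mul_apply]
  rw [← hX]
  generalize r ^ A = rA at *
  generalize r ^ (N + a) = rq at *
  generalize energyD a r G = D at *
  rw [hAq]
  have hA0 : A ≠ 0 := hA.ne'
  field_simp
  ring

/-- The Weiss identity holds at almost every radius. -/
lemma ae_weissIdentityAt {a h R : ℝ} (hA : 0 < expA N a h) {V : Space N → ℝ} {G : Space N → Space N}
    (hV : HasH1LocGradient a R V G) {T : ℝ → Space N → ℝ}
    (hT : ∀ r ∈ Ioo 0 R, IsTrace a R V G r (T r)) :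
    ∀ᵐ r, r ∈ Ioo 0 R → WeissIdentityAt a h T G r := by
  have hGm : ∀ᵐ r, r ∈ Ioo 0 R → MemLp (fun θ => G (r • θ)) 2 (weightedSphere N a 1) :=
    ae_of_ae_Ioo fun ρ hρ => ae_memLp_sphere (hV ρ hρ).2.1
  have hD : ∀ᵐ r, r ∈ Ioo 0 R → HasDerivAt (fun s => energyD a s G)
      (r ^ (N + a) * ∫ θ, ‖G (r • θ)‖ ^ 2 ∂(weightedSphere N a 1)) r :=
    ae_of_ae_Ioo fun ρ hρ => ae_hasDerivAt_energyD (hV ρ hρ).2.1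
  filter_upwards [hGm, hD, ae_hasDerivAt_height hV hT, ae_trace_eq hV hT, ae_sphereApprox hV]
    with r h1 h2 h3 h4 h5 hr
  refine weissIdentityAt_of_hasDerivAt hr.1 hA ((h5 hr).congr (h4 hr)) ((hT r hr).memLp hr.1) (h1 hr)
    (h2 hr) ?_
  convert h3 hr using 1
  refine integral_congr_ae ?_
  filter_upwards [h4 hr] with θ hθ
  rw [hθ]

/-! ### A radial bump and integration by parts on moving balls -/

/-- A radial bump function supported in the closed unit ball. -/
def bump (z : Space N) : ℝ := Real.smoothTransition (1 - ‖z‖ ^ 2)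

lemma contDiff_bump : ContDiff ℝ ∞ (bump (N := N)) :=
  Real.smoothTransition.contDiff.comp (contDiff_const.sub (contDiff_norm_sq ℝ))

lemma bump_nonneg (z : Space N) : 0 ≤ bump z := Real.smoothTransition.nonneg _

lemma bump_le_one (z : Space N) : bump z ≤ 1 := Real.smoothTransition.le_one _

lemma bump_eq_zero {z : Space N} (hz : z ∉ Metric.closedBall (0 : Space N) 1) : bump z = 0 := by
  refine Real.smoothTransition.zero_of_nonpos ?_
  have : 1 < ‖z‖ := by simpa using hz
  nlinarith

lemma tsupport_bump_subset : tsupport (bump (N := N)) ⊆ Metric.closedBall 0 1 :=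
  closure_minimal (fun z hz => by_contra fun h => hz (bump_eq_zero h)) Metric.isClosed_closedBall

lemma hasCompactSupport_bump : HasCompactSupport (bump (N := N)) :=
  (isCompact_closedBall _ _).of_isClosed_subset (isClosed_tsupport _) tsupport_bump_subset

lemma integrable_bump : Integrable (bump (N := N)) :=
  contDiff_bump.continuous.integrable_of_hasCompactSupport hasCompactSupport_bump

lemma integral_bump_pos : 0 < ∫ z : Space N, bump z := by
  refine (integral_pos_iff_support_of_nonneg bump_nonneg integrable_bump).2 ?_
  refine lt_of_lt_of_le (Metric.measure_ball_pos volume (0 : Space N) one_pos) (measure_mono fun z hz => ?_)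
  have hz' : ‖z‖ < 1 := by simpa using hz
  exact (Real.smoothTransition.pos_of_pos (by nlinarith [norm_nonneg z])).ne'

/-- Radial symmetry: the gradient of the bump at `z` is a multiple of `z`. -/
lemma fderiv_bump_apply (z v : Space N) :
    fderiv ℝ bump z v = -2 * deriv Real.smoothTransition (1 - ‖z‖ ^ 2) * inner ℝ z v := by
  have h1 : HasFDerivAt (fun z : Space N => 1 - ‖z‖ ^ 2) (-(2 • innerSL ℝ z)) z :=
    (hasStrictFDerivAt_norm_sq z).hasFDerivAt.const_sub 1
  have h2 : HasDerivAt Real.smoothTransition _ (1 - ‖z‖ ^ 2) :=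
    ((Real.smoothTransition.contDiff (n := 1)).differentiable (by norm_num) _).hasDerivAt
  have h3 : HasFDerivAt bump _ z := h2.comp_hasFDerivAt z h1
  rw [h3.fderiv]
  simp
  ring

/-- A `C¹` function supported in the closed unit ball is integrated by parts against a function
composed with an affine map. -/
lemma integral_mul_fderiv_affine {Ω : Set (Space N)} (hΩ : IsOpen Ω) {k g : Space N → ℝ}
    (hk : ContDiff ℝ 1 k) (hks : tsupport k ⊆ Metric.closedBall 0 1) (hg : ContDiffOn ℝ 1 g Ω)
    {x : Space N} {τ : ℝ} (hτ : τ ≠ 0) (hx : ∀ z ∈ Metric.closedBall (0 : Space N) 1, x + τ • z ∈ Ω)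
    (v : Space N) :
    ∫ z, k z * fderiv ℝ g (x + τ • z) v = -(τ⁻¹ * ∫ z, fderiv ℝ k z v * g (x + τ • z)) := by
  have hmaps : MapsTo (fun z : Space N => x + τ • z) (Metric.closedBall 0 1) Ω := hx
  have hc : ContinuousOn (fun z : Space N => x + τ • z) (Metric.closedBall 0 1) := by fun_prop
  have hgc : ContinuousOn (fun z => g (x + τ • z)) (Metric.closedBall 0 1) :=
    hg.continuousOn.comp hc hmaps
  have hg'c : ContinuousOn (fun z => fderiv ℝ g (x + τ • z) v) (Metric.closedBall 0 1) :=
    ((hg.continuousOn_fderiv_of_isOpen hΩ le_rfl).clm_apply continuousOn_const).comp hc hmaps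
  have hk0 : ∀ z, z ∉ Metric.closedBall (0 : Space N) 1 → k z = 0 := fun z hz =>
    image_eq_zero_of_notMem_tsupport fun h => hz (hks h)
  have hk'0 : ∀ z, z ∉ Metric.closedBall (0 : Space N) 1 → fderiv ℝ k z = 0 := fun z hz =>
    image_eq_zero_of_notMem_tsupport fun h => hz (hks (tsupport_fderiv_subset ℝ h))
  have hkc := hk.continuous
  have hk'c : Continuous fun z => fderiv ℝ k z v := (hk.continuous_fderiv one_ne_zero).clm_apply continuous_const
  have hint {u w : Space N → ℝ} (hu : Continuous u) (hw : ContinuousOn w (Metric.closedBall 0 1))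
      (h0 : ∀ z, z ∉ Metric.closedBall (0 : Space N) 1 → u z = 0) :
      Integrable (fun z => u z * w z) := by
    refine IntegrableOn.integrable_of_forall_notMem_eq_zero
      ((hu.continuousOn.mul hw).integrableOn_compact (isCompact_closedBall _ _)) fun z hz => ?_
    rw [h0 z hz, zero_mul]
  have h1 := integral_bilinear_hasFDerivAt_right_eq_neg_left_of_integrable (μ := volume) (v := v)
    (B := ContinuousLinearMap.mul ℝ ℝ) (f := k) (f' := fun z => fderiv ℝ k z)
    (g := fun z => g (x + τ • z)) (g' := fun z => τ • fderiv ℝ g (x + τ • z))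
    (hint hk'c hgc fun z hz => by rw [hk'0 z hz]; rfl)
    (hint hkc (hg'c.const_smul τ) hk0)
    (hint hkc hgc hk0)
    (fun z _ => (hk.differentiable (by norm_num) z).hasFDerivAt)
    (fun z hz => by
      have hd := ((hg.differentiableOn (by norm_num)).differentiableAt
        (hΩ.mem_nhds (hx z (hks hz)))).hasFDerivAt
      have ha : HasFDerivAt (fun z : Space N => x + τ • z) (τ • ContinuousLinearMap.id ℝ (Space N)) z :=
        ((hasFDerivAt_id z).const_smul τ).const_add x
      have := HasFDerivAt.comp (f := fun z : Space N => x + τ • z) z hd ha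
      refine this.congr_fderiv ?_
      ext w
      simp)
  simp only [ContinuousLinearMap.mul_apply', smul_apply, smul_eq_mul] at h1
  have h2 : ∫ z, k z * (τ * fderiv ℝ g (x + τ • z) v) = τ * ∫ z, k z * fderiv ℝ g (x + τ • z) v := by
    rw [← integral_const_mul]
    congr 1
    ext z
    ring
  rw [h2] at h1
  -- Differentiating `g (x + τ z)` in `z` yields a factor `τ`, hence the `τ⁻¹` in the result.
  rw [← mul_neg, ← h1, inv_mul_cancel_left₀ hτ]

/-- The standard basis vectors. -/
def basisVec (i : Fin (N + 1)) : Space N := EuclideanSpace.single i 1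

lemma basisVec_inner (i : Fin (N + 1)) (z : Space N) : inner ℝ z (basisVec i) = z i := by
  simp [basisVec, EuclideanSpace.inner_single_right]

lemma sum_coord_smul (z : Space N) : ∑ j, z j • basisVec j = z := by
  ext i
  simp [basisVec, Finset.sum_apply, Pi.single_apply]

lemma clm_apply_eq_sum (L : Space N →L[ℝ] ℝ) (z : Space N) : L z = ∑ j, z j * L (basisVec j) := by
  conv_lhs => rw [← sum_coord_smul z]
  simp

lemma gradient_coord (V : Space N → ℝ) (Y : Space N) (i : Fin (N + 1)) :
    gradient V Y i = fderiv ℝ V Y (basisVec i) := by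
  rw [← basisVec_inner, inner_gradient_left]

lemma contDiff_coord_mul_bump (j : Fin (N + 1)) : ContDiff ℝ 1 fun z : Space N => z j * bump z := by
  have h1 : ContDiff ℝ 1 fun z : Space N => z j := by fun_prop
  exact h1.mul (contDiff_bump.of_le (by exact_mod_cast le_top))

lemma tsupport_coord_mul_bump_subset (j : Fin (N + 1)) :
    tsupport (fun z : Space N => z j * bump z) ⊆ Metric.closedBall 0 1 :=
  (tsupport_mul_subset_right (f := fun z : Space N => z j)).trans tsupport_bump_subset

/-- The field `z ↦ bump z • z` is curl-free, because the gradient of the bump is radial. This is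
what allows mixed second derivatives to be collected into a Laplacian. -/
lemma fderiv_coord_mul_bump (i j : Fin (N + 1)) (z : Space N) :
    fderiv ℝ (fun z : Space N => z j * bump z) z (basisVec i) =
      fderiv ℝ (fun z : Space N => z i * bump z) z (basisVec j) := by
  have hb : HasFDerivAt bump (fderiv ℝ bump z) z :=
    (contDiff_bump.differentiable (by simp) z).hasFDerivAt
  have hc (j : Fin (N + 1)) : HasFDerivAt (fun z : Space N => z j)
      (EuclideanSpace.proj j : Space N →L[ℝ] ℝ) z :=
    (EuclideanSpace.proj (𝕜 := ℝ) j).hasFDerivAt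
  have e (j : Fin (N + 1)) : HasFDerivAt (fun z : Space N => z j * bump z) _ z := (hc j).mul hb
  rw [(e j).fderiv, (e i).fderiv]
  simp [fderiv_bump_apply, basisVec_inner]
  rcases eq_or_ne i j with rfl | hij
  · ring
  · simp [basisVec, hij, hij.symm]
    ring

section SecondDerivatives

variable {Ω : Set (Space N)} {V : Space N → ℝ}

lemma contDiffOn_fderiv_apply (hΩ : IsOpen Ω) (hV : ContDiffOn ℝ 2 V Ω) (v : Space N) :
    ContDiffOn ℝ 1 (fun Y => fderiv ℝ V Y v) Ω :=
  (hV.fderiv_of_isOpen hΩ (by norm_num)).clm_apply contDiffOn_const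

lemma fderiv_fderiv_apply (hΩ : IsOpen Ω) (hV : ContDiffOn ℝ 2 V Ω) {Y : Space N} (hY : Y ∈ Ω)
    (v w : Space N) : fderiv ℝ (fun Y => fderiv ℝ V Y v) Y w = fderiv ℝ (fderiv ℝ V) Y w v := by
  have h1 : DifferentiableAt ℝ (fderiv ℝ V) Y :=
    ((hV.fderiv_of_isOpen hΩ (m := 1) (by norm_num)).differentiableOn (by norm_num)).differentiableAt
      (hΩ.mem_nhds hY)
  have := h1.hasFDerivAt.clm_apply (hasFDerivAt_const v Y)
  rw [this.fderiv]
  simp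

lemma fderiv_fderiv_comm (hΩ : IsOpen Ω) (hV : ContDiffOn ℝ 2 V Ω) {Y : Space N} (hY : Y ∈ Ω)
    (v w : Space N) : fderiv ℝ (fun Y => fderiv ℝ V Y v) Y w = fderiv ℝ (fun Y => fderiv ℝ V Y w) Y v := by
  rw [fderiv_fderiv_apply hΩ hV hY, fderiv_fderiv_apply hΩ hV hY]
  have := (hV.contDiffAt (hΩ.mem_nhds hY)).isSymmSndFDerivAt (by simp)
  exact this w v

lemma laplacian_eq_sum (hΩ : IsOpen Ω) (hV : ContDiffOn ℝ 2 V Ω) {Y : Space N} (hY : Y ∈ Ω) :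
    Laplacian.laplacian V Y = ∑ j, fderiv ℝ (fun Y => fderiv ℝ V Y (basisVec j)) Y (basisVec j) := by
  rw [InnerProductSpace.laplacian_eq_iteratedFDeriv_orthonormalBasis V
    (EuclideanSpace.basisFun (Fin (N + 1)) ℝ)]
  refine Finset.sum_congr rfl fun j _ => ?_
  rw [fderiv_fderiv_apply hΩ hV hY, iteratedFDeriv_two_apply]
  simp [basisVec]

lemma continuousOn_laplacian (hΩ : IsOpen Ω) (hV : ContDiffOn ℝ 2 V Ω) :
    ContinuousOn (Laplacian.laplacian V) Ω := by
  refine ContinuousOn.congr ?_ fun Y hY => laplacian_eq_sum hΩ hV hY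
  exact continuousOn_finsetSum _ fun j _ =>
    ((contDiffOn_fderiv_apply hΩ hV (basisVec j)).continuousOn_fderiv_of_isOpen hΩ le_rfl).clm_apply
      continuousOn_const

/-- The derivative of a mollification of `∂ᵢV` along a path of balls of growing radius. -/
lemma integral_bump_mul_fderiv (hΩ : IsOpen Ω) (hV : ContDiffOn ℝ 2 V Ω) (i : Fin (N + 1))
    {x v : Space N} {τ q : ℝ} (hτ : τ ≠ 0)
    (hx : ∀ z ∈ Metric.closedBall (0 : Space N) 1, x + τ • z ∈ Ω) :
    ∫ z, bump z * fderiv ℝ (fun Y => fderiv ℝ V Y (basisVec i)) (x + τ • z) (v + q • z) =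
      -(τ⁻¹ * ∫ z, fderiv ℝ bump z (basisVec i) * fderiv ℝ V (x + τ • z) v) +
        q * ∫ z, (z i * bump z) * Laplacian.laplacian V (x + τ • z) := by
  set g : Fin (N + 1) → Space N → ℝ := fun j Y => fderiv ℝ V Y (basisVec j) with hgdef
  have hg : ∀ j, ContDiffOn ℝ 1 (g j) Ω := fun j => contDiffOn_fderiv_apply hΩ hV _
  have hmaps : MapsTo (fun z : Space N => x + τ • z) (Metric.closedBall 0 1) Ω := hx
  have hc : ContinuousOn (fun z : Space N => x + τ • z) (Metric.closedBall 0 1) := by fun_prop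
  have hint {u w : Space N → ℝ} (hu : Continuous u)
      (hw : ContinuousOn w (Metric.closedBall 0 1)) (h0 : tsupport u ⊆ Metric.closedBall 0 1) :
      Integrable (fun z => u z * w z) := by
    refine IntegrableOn.integrable_of_forall_notMem_eq_zero
      ((hu.continuousOn.mul hw).integrableOn_compact (isCompact_closedBall _ _)) fun z hz => ?_
    rw [image_eq_zero_of_notMem_tsupport fun h => hz (h0 h), zero_mul]
  have hg'c (j : Fin (N + 1)) (w : Space N) :
      ContinuousOn (fun z => fderiv ℝ (g j) (x + τ • z) w) (Metric.closedBall 0 1) :=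
    (((hg j).continuousOn_fderiv_of_isOpen hΩ le_rfl).clm_apply continuousOn_const).comp hc hmaps
  have hb1 : ContDiff ℝ 1 (bump (N := N)) := contDiff_bump.of_le (by exact_mod_cast le_top)
  have hexp : ∀ z : Space N, bump z * fderiv ℝ (g i) (x + τ • z) (v + q • z) =
      bump z * fderiv ℝ (g i) (x + τ • z) v +
        ∑ j, q * ((z j * bump z) * fderiv ℝ (g i) (x + τ • z) (basisVec j)) := by
    intro z
    rw [map_add, map_smul, clm_apply_eq_sum _ z, smul_eq_mul, mul_add, Finset.mul_sum,
      Finset.mul_sum]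
    congr 1
    exact Finset.sum_congr rfl fun j _ => by ring
  have hswap : ∀ z ∈ Metric.closedBall (0 : Space N) 1, ∀ w, fderiv ℝ (g i) (x + τ • z) w =
      fderiv ℝ (fun Y => fderiv ℝ V Y w) (x + τ • z) (basisVec i) := fun z hz w =>
    fderiv_fderiv_comm hΩ hV (hx z hz) _ _
  have hcongr {u w w' : Space N → ℝ} (h0 : tsupport u ⊆ Metric.closedBall 0 1)
      (h : ∀ z ∈ Metric.closedBall (0 : Space N) 1, w z = w' z) :
      ∫ z, u z * w z = ∫ z, u z * w' z := by
    refine integral_congr_ae (ae_of_all _ fun z => ?_)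
    by_cases hz : z ∈ Metric.closedBall (0 : Space N) 1
    · simp only [h z hz]
    · simp only [image_eq_zero_of_notMem_tsupport fun h => hz (h0 h), zero_mul]
  -- Along the fixed direction `v` the derivatives are exchanged and `∂ᵢ` is moved onto the bump,
  -- leaving only `∂ᵥV`.
  have hfirst : ∫ z, bump z * fderiv ℝ (g i) (x + τ • z) v =
      -(τ⁻¹ * ∫ z, fderiv ℝ bump z (basisVec i) * fderiv ℝ V (x + τ • z) v) := by
    rw [hcongr tsupport_bump_subset fun z hz => hswap z hz v]
    exact integral_mul_fderiv_affine hΩ hb1 tsupport_bump_subset (contDiffOn_fderiv_apply hΩ hV v) hτ hx _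
  -- One integration by parts in the direction `i`, and one backwards in the direction `j`; the two
  -- sides meet since the field is curl-free. Summation over `j` produces `ΔV`.
  have hsecond : ∀ j, ∫ z, (z j * bump z) * fderiv ℝ (g i) (x + τ • z) (basisVec j) =
      ∫ z, (z i * bump z) * fderiv ℝ (g j) (x + τ • z) (basisVec j) := by
    intro j
    rw [hcongr (tsupport_coord_mul_bump_subset j) fun z hz => hswap z hz (basisVec j),
      integral_mul_fderiv_affine hΩ (contDiff_coord_mul_bump j) (tsupport_coord_mul_bump_subset j)
        (hg j) hτ hx,
      integral_mul_fderiv_affine hΩ (contDiff_coord_mul_bump i) (tsupport_coord_mul_bump_subset i)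
        (hg j) hτ hx]
    simp only [fderiv_coord_mul_bump i j]
  have hi1 := hint contDiff_bump.continuous (hg'c i v) tsupport_bump_subset
  have hi2 := fun j => (hint (contDiff_coord_mul_bump j).continuous (hg'c i (basisVec j))
    (tsupport_coord_mul_bump_subset j)).const_mul q
  have hi3 := fun j => hint (contDiff_coord_mul_bump i).continuous (hg'c j (basisVec j))
    (tsupport_coord_mul_bump_subset i)
  calc ∫ z, bump z * fderiv ℝ (g i) (x + τ • z) (v + q • z)
      = ∫ z, (bump z * fderiv ℝ (g i) (x + τ • z) v +
        ∑ j, q * ((z j * bump z) * fderiv ℝ (g i) (x + τ • z) (basisVec j))) := by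
        simp only [hexp]
    _ = (∫ z, bump z * fderiv ℝ (g i) (x + τ • z) v) +
        ∑ j, q * ∫ z, (z j * bump z) * fderiv ℝ (g i) (x + τ • z) (basisVec j) := by
        rw [integral_add hi1 (integrable_finsetSum _ fun j _ => hi2 j),
          integral_finsetSum _ fun j _ => hi2 j]
        simp only [integral_const_mul]
    _ = _ := by
        rw [hfirst]
        congr 1
        simp only [hsecond]
        rw [← Finset.mul_sum, ← integral_finsetSum _ fun j _ => hi3 j]
        simp only [← Finset.mul_sum]
        congr 1
        exact (hcongr (tsupport_coord_mul_bump_subset i) fun z hz =>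
          laplacian_eq_sum hΩ hV (hx z hz)).symm

end SecondDerivatives

/-! ### Balls rising from a point, and the representation of the gradient -/

/-- The height at time `s` of the centre of the ball moving away from a point of height `t`. -/
def liftHeight (t s : ℝ) : ℝ := √(t ^ 2 + s ^ 2)

/-- The point with relative position `z` in the ball of radius `s / 2` that has moved away
from `X` for the time `s`. -/
def lift (X : Space N) (s : ℝ) (z : Space N) : Space N :=
  (X + (liftHeight (X 0) s - X 0) • basisVec 0) + (s / 2) • z

section LiftHeight

variable {t s : ℝ}

lemma le_liftHeight_right : s ≤ liftHeight t s := Real.le_sqrt_of_sq_le (by nlinarith)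

lemma le_liftHeight_left : t ≤ liftHeight t s := Real.le_sqrt_of_sq_le (by nlinarith)

lemma liftHeight_pos (ht : 0 < t) : 0 < liftHeight t s := ht.trans_le le_liftHeight_left

lemma liftHeight_le (ht : 0 ≤ t) (hs : 0 ≤ s) : liftHeight t s ≤ t + s :=
  Real.sqrt_le_iff.2 ⟨by positivity, by nlinarith [mul_nonneg ht hs]⟩

lemma hasDerivAt_liftHeight (ht : 0 < t) : HasDerivAt (liftHeight t) (s / liftHeight t s) s := by
  have h : HasDerivAt (fun s => t ^ 2 + s ^ 2) (2 * s) s := by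
    simpa using ((hasDerivAt_id s).fun_pow 2).const_add (t ^ 2)
  have := h.sqrt (by positivity)
  refine this.congr_deriv ?_
  rw [liftHeight]
  field_simp

@[fun_prop]
lemma continuous_liftHeight : Continuous fun p : ℝ × ℝ => liftHeight p.1 p.2 := by
  unfold liftHeight
  fun_prop

end LiftHeight

lemma basisVec_zero_apply : (basisVec 0 : Space N) 0 = 1 := by simp [basisVec]

lemma norm_basisVec (i : Fin (N + 1)) : ‖(basisVec i : Space N)‖ = 1 := by simp [basisVec]

lemma abs_coord_le (z : Space N) (i : Fin (N + 1)) : |z i| ≤ ‖z‖ := by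
  simpa using PiLp.norm_apply_le z i

lemma lift_zero {X : Space N} (hX : 0 < X 0) (z : Space N) : lift X 0 z = X := by
  simp [lift, liftHeight, Real.sqrt_sq hX.le]

lemma lift_coord_zero (X : Space N) (s : ℝ) (z : Space N) :
    lift X s z 0 = liftHeight (X 0) s + s / 2 * z 0 := by
  simp [lift, basisVec_zero_apply]

section LiftBounds

variable {X z : Space N} {s : ℝ}

/-- The radius `s/2` is at most half the height of the centre, so the ball stays away from the flat
boundary at a distance comparable with that height. -/
lemma lift_coord_bounds (hs : 0 ≤ s) (hz : z ∈ Metric.closedBall (0 : Space N) 1) :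
    liftHeight (X 0) s / 2 ≤ lift X s z 0 ∧ lift X s z 0 ≤ 3 / 2 * liftHeight (X 0) s := by
  have hz' : ‖z‖ ≤ 1 := by simpa using hz
  have h := abs_le.1 ((abs_coord_le z 0).trans hz')
  have := le_liftHeight_right (t := X 0) (s := s)
  rw [lift_coord_zero]
  constructor <;> nlinarith

lemma norm_lift_sub_le (hX : 0 < X 0) (hs : 0 ≤ s) (hz : z ∈ Metric.closedBall (0 : Space N) 1) :
    ‖lift X s z - X‖ ≤ 3 / 2 * s := by
  have hz' : ‖z‖ ≤ 1 := by simpa using hz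
  have h1 : lift X s z - X = (liftHeight (X 0) s - X 0) • basisVec 0 + (s / 2) • z := by
    rw [lift]; abel
  rw [h1]
  refine (norm_add_le _ _).trans ?_
  rw [norm_smul, norm_smul, norm_basisVec, Real.norm_eq_abs, Real.norm_eq_abs,
    abs_of_nonneg (sub_nonneg.2 le_liftHeight_left), abs_of_nonneg (by positivity : (0 : ℝ) ≤ s / 2)]
  nlinarith [liftHeight_le hX.le hs, norm_nonneg z]

lemma norm_lift_le (hX : 0 < X 0) (hs : 0 ≤ s) (hz : z ∈ Metric.closedBall (0 : Space N) 1) :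
    ‖lift X s z‖ ≤ ‖X‖ + 3 / 2 * s := by
  have := norm_lift_sub_le hX hs hz
  calc ‖lift X s z‖ = ‖X + (lift X s z - X)‖ := by rw [add_sub_cancel]
    _ ≤ _ := (norm_add_le _ _).trans (by gcongr)

lemma lift_mem_halfBall {ρ c : ℝ} (hX : 0 < X 0) (hρ : ‖X‖ + 2 * c < ρ) (hs : s ∈ Icc 0 c)
    (hz : z ∈ Metric.closedBall (0 : Space N) 1) : lift X s z ∈ halfBall N ρ :=
  ⟨(half_pos (liftHeight_pos hX)).trans_le (lift_coord_bounds hs.1 hz).1,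
    (norm_lift_le hX hs.1 hz).trans_lt (by linarith [hs.1, hs.2])⟩

end LiftBounds

/-- The velocity of the curve `s ↦ lift X s z`. -/
def liftVel (X : Space N) (s : ℝ) (z : Space N) : Space N :=
  (s / liftHeight (X 0) s) • basisVec 0 + (1 / 2 : ℝ) • z

lemma hasDerivAt_lift {X : Space N} (hX : 0 < X 0) (z : Space N) (s : ℝ) :
    HasDerivAt (fun s => lift X s z) (liftVel X s z) s := by
  have h1 := (((hasDerivAt_liftHeight (s := s) hX).sub_const (X 0)).smul_const
    (basisVec 0 : Space N)).const_add X
  have h2 := ((hasDerivAt_id s).div_const 2).smul_const z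
  exact h1.add h2

lemma continuous_lift : Continuous fun p : Space N × ℝ × Space N => lift p.1 p.2.1 p.2.2 := by
  unfold lift liftHeight
  fun_prop

/-- Averaging the fundamental theorem of calculus along the curves `s ↦ lift X s z`. -/
lemma integral_bump_mul_eq {ρ c : ℝ} {X : Space N} {g : Space N → ℝ}
    (hg : ContDiffOn ℝ 1 g (halfBall N ρ)) (hX : 0 < X 0) (hc : 0 ≤ c) (hρ : ‖X‖ + 2 * c < ρ) :
    (∫ z : Space N, bump z) * g X = (∫ z, bump z * g (lift X c z)) -
      ∫ s in 0..c, ∫ z, bump z * fderiv ℝ g (lift X s z) (liftVel X s z) := by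
  set B := Metric.closedBall (0 : Space N) 1 with hB
  have hmem : ∀ s ∈ Icc 0 c, ∀ z ∈ B, lift X s z ∈ halfBall N ρ := fun s hs z hz =>
    lift_mem_halfBall hX hρ hs hz
  have hpos : ∀ s, liftHeight (X 0) s ≠ 0 := fun s => (liftHeight_pos hX).ne'
  have hwc : Continuous fun p : ℝ × Space N => liftVel X p.1 p.2 := by
    have h1 : Continuous fun p : ℝ × Space N => liftHeight (X 0) p.1 :=
      continuous_liftHeight.comp (by fun_prop : Continuous fun p : ℝ × Space N => (X 0, p.1))
    have : Continuous fun p : ℝ × Space N => p.1 / liftHeight (X 0) p.1 :=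
      continuous_fst.div h1 fun p => hpos _
    have h2 : Continuous fun p : ℝ × Space N => (1 / 2 : ℝ) • p.2 := by fun_prop
    exact (this.smul continuous_const).add h2
  have hlc : Continuous fun p : ℝ × Space N => lift X p.1 p.2 :=
    continuous_lift.comp (by fun_prop : Continuous fun p : ℝ × Space N => (X, p.1, p.2))
  have hDc : ContinuousOn (fun p : ℝ × Space N => fderiv ℝ g (lift X p.1 p.2) (liftVel X p.1 p.2))
      (Icc 0 c ×ˢ B) :=
    ((hg.continuousOn_fderiv_of_isOpen (isOpen_halfBall ρ) le_rfl).comp hlc.continuousOn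
      fun p hp => hmem _ hp.1 _ hp.2).clm_apply hwc.continuousOn
  -- All curves start at `X`, whatever `z` is. The formula is averaged over `z` with the bump as
  -- weight and the order of integration is exchanged.
  have hftc : ∀ z ∈ B, ∫ s in 0..c, fderiv ℝ g (lift X s z) (liftVel X s z) = g (lift X c z) - g X := by
    intro z hz
    have hd : ∀ s ∈ uIcc 0 c, HasDerivAt (fun s => g (lift X s z))
        (fderiv ℝ g (lift X s z) (liftVel X s z)) s := by
      intro s hs
      rw [uIcc_of_le hc] at hs
      have hd : HasFDerivAt g (fderiv ℝ g (lift X s z)) (lift X s z) :=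
        ((hg.differentiableOn one_ne_zero).differentiableAt
          ((isOpen_halfBall ρ).mem_nhds (hmem s hs z hz))).hasFDerivAt
      exact HasFDerivAt.comp_hasDerivAt (f := fun s => lift X s z) s hd (hasDerivAt_lift hX z s)
    have hi : IntervalIntegrable (fun s => fderiv ℝ g (lift X s z) (liftVel X s z)) volume 0 c := by
      refine ContinuousOn.intervalIntegrable ?_
      rw [uIcc_of_le hc]
      exact hDc.comp (f := fun s : ℝ => (s, z)) (by fun_prop) fun s hs => ⟨hs, hz⟩
    rw [intervalIntegral.integral_eq_sub_of_hasDerivAt hd hi, lift_zero hX]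
  have hset (F : Space N → ℝ) : ∫ z, bump z * F z = ∫ z in B, bump z * F z :=
    (setIntegral_eq_integral_of_forall_compl_eq_zero fun z hz => by
      rw [bump_eq_zero hz, zero_mul]).symm
  have hbc : Continuous (bump (N := N)) := contDiff_bump.continuous
  have hFint : IntegrableOn (Function.uncurry fun s z => bump z * fderiv ℝ g (lift X s z) (liftVel X s z))
      (Ioc 0 c ×ˢ B) (volume.prod volume) := by
    refine IntegrableOn.mono_set ?_ (prod_mono_left Ioc_subset_Icc_self)
    exact ((hbc.comp continuous_snd).continuousOn.mul hDc).integrableOn_compact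
      (isCompact_Icc.prod (isCompact_closedBall _ _))
  have hgc : ContinuousOn (fun z => g (lift X c z)) B :=
    hg.continuousOn.comp (hlc.comp (by fun_prop : Continuous fun z : Space N => (c, z))).continuousOn
      fun z hz => hmem c ⟨hc, le_rfl⟩ z hz
  have hK := isCompact_closedBall (0 : Space N) 1
  simp only [hset]
  rw [intervalIntegral.integral_of_le hc, integral_integral_swap (by
    rw [Measure.prod_restrict]; exact hFint)]
  have h1 : ∫ z in B, ∫ s in Ioc 0 c, bump z * fderiv ℝ g (lift X s z) (liftVel X s z) =
      ∫ z in B, (bump z * g (lift X c z) - bump z * g X) := by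
    refine setIntegral_congr_fun Metric.isClosed_closedBall.measurableSet fun z hz => ?_
    rw [integral_const_mul, ← intervalIntegral.integral_of_le hc, hftc z hz, mul_sub]
  have hi1 : IntegrableOn (fun z => bump z * g (lift X c z)) B :=
    (hbc.continuousOn.mul hgc).integrableOn_compact hK
  have hi2 : IntegrableOn (fun z => bump z * g X) B :=
    (hbc.continuousOn.mul continuousOn_const).integrableOn_compact hK
  rw [h1, integral_sub hi1 hi2, integral_mul_const,
    ← setIntegral_eq_integral_of_forall_compl_eq_zero (s := B) fun z hz => bump_eq_zero hz]
  ring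

lemma exists_fderiv_bump_bound (N : ℕ) : ∃ C : ℝ, 0 ≤ C ∧
    ∀ (z : Space N) (i : Fin (N + 1)), |fderiv ℝ bump z (basisVec i)| ≤ C := by
  have hc : Continuous (fderiv ℝ (bump (N := N))) := contDiff_bump.continuous_fderiv (by simp)
  obtain ⟨C, hC⟩ := (hasCompactSupport_bump (N := N)).fderiv ℝ |>.exists_bound_of_continuous hc
  refine ⟨C, (norm_nonneg _).trans (hC 0), fun z i => ?_⟩
  have := (fderiv ℝ bump z).le_opNorm (basisVec i)
  rw [norm_basisVec, mul_one] at this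
  exact this.trans (hC z)

/-- The powers with exponent in `(-1, 1)` of comparable numbers are comparable. -/
lemma rpow_neg_le_two_mul {a p y : ℝ} (ha : a ∈ Ioo (-1 : ℝ) 1) (hp : 0 < p) (h1 : p / 2 ≤ y)
    (h2 : y ≤ 3 / 2 * p) : y ^ (-a) ≤ 2 * p ^ (-a) := by
  rcases le_total 0 a with h | h
  · calc y ^ (-a) ≤ (p / 2) ^ (-a) := Real.rpow_le_rpow_of_nonpos (by positivity) h1 (by linarith)
      _ = 2 ^ a * p ^ (-a) := by
        rw [Real.div_rpow hp.le (by norm_num), Real.rpow_neg (x := 2) (by norm_num), div_inv_eq_mul,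
          mul_comm]
      _ ≤ 2 ^ (1 : ℝ) * p ^ (-a) := by
        gcongr
        · norm_num
        · exact ha.2.le
      _ = _ := by rw [Real.rpow_one]
  · calc y ^ (-a) ≤ (2 * p) ^ (-a) :=
        Real.rpow_le_rpow (by linarith) (by linarith) (by linarith)
      _ = 2 ^ (-a) * p ^ (-a) := Real.mul_rpow (by norm_num) hp.le
      _ ≤ 2 ^ (1 : ℝ) * p ^ (-a) := by
        gcongr
        · norm_num
        · linarith [ha.1]
      _ = _ := by rw [Real.rpow_one]

/-- Interior representation of the gradient of `V` in terms of the weighted Laplacian and of the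
normal derivative of `V`, integrated along a cone that leaves the boundary. -/
lemma exists_gradient_bound (N : ℕ) {a : ℝ} (ha : a ∈ Ioo (-1 : ℝ) 1) : ∃ K : ℝ, 0 ≤ K ∧
    ∀ (V : Space N → ℝ) (ρ c ε M L : ℝ) (X : Space N) (i : Fin (N + 1)),
      ContDiffOn ℝ 2 V (halfBall N ρ) → 0 ≤ M → 0 ≤ L →
      (∀ Y ∈ halfBall N ρ, Y 0 < ε → |gradient V Y 0| ≤ M * (Y 0) ^ (-a)) →
      0 < X 0 → X 0 < c → ‖X‖ + 2 * c < ρ → 3 * c ≤ ε →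
      (∀ z ∈ Metric.closedBall (0 : Space N) 1, |gradient V (lift X c z) i| ≤ L) →
      ENNReal.ofReal (∫ z : Space N, bump z) * ‖gradient V X i‖ₑ ≤
        ENNReal.ofReal ((∫ z : Space N, bump z) * L) +
        ∫⁻ s in Ioc 0 c, ∫⁻ z in Metric.closedBall (0 : Space N) 1,
          (ENNReal.ofReal (K * M * liftHeight (X 0) s ^ (-a - 1)) +
            ‖weightedLaplacian a V (lift X s z)‖ₑ) := by
  obtain ⟨C, hC0, hC⟩ := exists_fderiv_bump_bound N
  -- `4C` bounds the term in which a derivative falls on the bump; the other `4` bounds `a/y₀ ·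
  -- ∂₀V`, the difference between the two Laplacians, using `|a| ≤ 1`.
  refine ⟨4 * C + 4, by positivity, fun V ρ c ε M L X i hV hM hL hbd hX hXc hρ hε hLb => ?_⟩
  set B := Metric.closedBall (0 : Space N) 1 with hB
  set g : Space N → ℝ := fun Y => fderiv ℝ V Y (basisVec i) with hg
  have hgr : ∀ Y, gradient V Y i = g Y := fun Y => gradient_coord V Y i
  have hc : 0 < c := hX.trans hXc
  have hset {F : Space N → ℝ} (hF : ∀ z, z ∉ B → F z = 0) : ∫ z, F z = ∫ z in B, F z :=
    (setIntegral_eq_integral_of_forall_compl_eq_zero hF).symm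
  have hrep := integral_bump_mul_eq (contDiffOn_fderiv_apply (isOpen_halfBall ρ) hV (basisVec i))
    hX hc.le hρ
  have hfirst : ‖∫ z, bump z * g (lift X c z)‖ₑ ≤ ENNReal.ofReal ((∫ z : Space N, bump z) * L) := by
    rw [Real.enorm_eq_ofReal_abs]
    refine ENNReal.ofReal_le_ofReal ?_
    rw [← integral_mul_const]
    refine norm_integral_le_of_norm_le (f := fun z => bump z * g (lift X c z))
      (integrable_bump.mul_const L) (ae_of_all _ fun z => ?_)
    by_cases hz : z ∈ B
    · rw [norm_mul, Real.norm_of_nonneg (bump_nonneg z)]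
      refine mul_le_mul_of_nonneg_left ?_ (bump_nonneg z)
      rw [Real.norm_eq_abs, ← hgr]
      exact hLb z hz
    · simp [bump_eq_zero hz]
  have hsecond : ∀ s ∈ Ioc 0 c, ‖∫ z, bump z * fderiv ℝ g (lift X s z) (liftVel X s z)‖ₑ ≤
      ∫⁻ z in B, (ENNReal.ofReal ((4 * C + 4) * M * liftHeight (X 0) s ^ (-a - 1)) +
            ‖weightedLaplacian a V (lift X s z)‖ₑ) := by
    intro s hs
    set p := liftHeight (X 0) s with hp
    have hp0 : 0 < p := liftHeight_pos hX
    have hpc : p < 2 * c := (liftHeight_le hX.le hs.1.le).trans_lt (by linarith [hs.2])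
    have hmem : ∀ z ∈ B, lift X s z ∈ halfBall N ρ := fun z hz =>
      lift_mem_halfBall hX hρ ⟨hs.1.le, hs.2⟩ hz
    have hV0 : ∀ z ∈ B, |fderiv ℝ V (lift X s z) (basisVec 0)| ≤ 2 * M * p ^ (-a) := by
      intro z hz
      have h := lift_coord_bounds (X := X) hs.1.le hz
      rw [← gradient_coord]
      refine (hbd _ (hmem z hz) (h.2.trans_lt (by linarith))).trans ?_
      calc M * lift X s z 0 ^ (-a) ≤ M * (2 * p ^ (-a)) :=
            mul_le_mul_of_nonneg_left (rpow_neg_le_two_mul ha hp0 h.1 h.2) hM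
        _ = _ := by ring
    have hpa : p ^ (-a) = p * p ^ (-a - 1) := by
      rw [Real.rpow_sub_one hp0.ne']; field_simp
    set P := p ^ (-a - 1) with hP
    have hP0 : 0 < P := Real.rpow_pos_of_pos hp0 _
    -- The velocity of the curves is `(s/p) e₀ + z/2`, and `τ = s/2` is the radius of the ball.
    have key := integral_bump_mul_fderiv (isOpen_halfBall ρ) hV i (v := (s / p) • basisVec 0)
      (q := 1 / 2) (half_pos hs.1).ne' (x := X + (p - X 0) • basisVec 0) hmem
    -- The loss `1/τ = 2/s` is compensated by the vertical speed `s/p`, leaving `2/p`. This is the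
    -- reason for the height `√(t² + s²)`: a centre rising at unit speed would leave a
    -- non-integrable `1/s`.
    have e1 : ∫ z, bump z * fderiv ℝ g (lift X s z) (liftVel X s z) =
        (∫ z in B, -(2 / p) * (fderiv ℝ bump z (basisVec i) * fderiv ℝ V (lift X s z) (basisVec 0))) +
        ∫ z in B, 1 / 2 * ((z i * bump z) * Laplacian.laplacian V (lift X s z)) := by
      refine key.trans ?_
      rw [← hset, ← hset, integral_const_mul, integral_const_mul]
      · congr 1
        simp only [map_smul, smul_eq_mul]
        rw [neg_mul, ← integral_const_mul, ← integral_const_mul]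
        congr 2
        ext z
        have := hs.1.ne'
        simp only [lift]
        field_simp
        rw [hp]
      · intro z hz
        rw [bump_eq_zero hz]; simp
      · intro z hz
        rw [image_eq_zero_of_notMem_tsupport fun h =>
          hz (tsupport_bump_subset (tsupport_fderiv_subset ℝ h))]
        simp
    rw [e1]
    refine (enorm_add_le _ _).trans ?_
    have hle : ∀ z ∈ B, ‖z‖ ≤ 1 := fun z hz => by simpa [hB] using hz
    calc _ ≤ (∫⁻ z in B, ENNReal.ofReal (4 * C * M * P)) + ∫⁻ z in B,
          (ENNReal.ofReal (4 * M * P) + ‖weightedLaplacian a V (lift X s z)‖ₑ) := by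
          refine add_le_add ((enorm_integral_le_lintegral_enorm _).trans
            (setLIntegral_mono' Metric.isClosed_closedBall.measurableSet fun z hz => ?_))
            ((enorm_integral_le_lintegral_enorm _).trans
            (setLIntegral_mono' Metric.isClosed_closedBall.measurableSet fun z hz => ?_))
          · rw [Real.enorm_eq_ofReal_abs]
            refine ENNReal.ofReal_le_ofReal ?_
            rw [abs_mul, abs_mul, abs_neg, abs_of_pos (by positivity : 0 < 2 / p)]
            calc 2 / p * (|fderiv ℝ bump z (basisVec i)| * |fderiv ℝ V (lift X s z) (basisVec 0)|)
                ≤ 2 / p * (C * (2 * M * p ^ (-a))) := by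
                  gcongr
                  · exact hC z i
                  · exact hV0 z hz
              _ = _ := by rw [hpa]; field_simp; ring
          · have h0 := (lift_coord_bounds (X := X) hs.1.le hz).1
            have hY0 : 0 < lift X s z 0 := (hmem z hz).1
            rw [Real.enorm_eq_ofReal_abs, Real.enorm_eq_ofReal_abs,
              ← ENNReal.ofReal_add (by positivity) (abs_nonneg _)]
            refine ENNReal.ofReal_le_ofReal ?_
            have hL : Laplacian.laplacian V (lift X s z) = weightedLaplacian a V (lift X s z) -
                a / lift X s z 0 * fderiv ℝ V (lift X s z) (basisVec 0) := by
              rw [weightedLaplacian, gradient_coord]; ring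
            have h3 : |a / lift X s z 0 * fderiv ℝ V (lift X s z) (basisVec 0)| ≤ 4 * M * P := by
              rw [abs_mul, abs_div, abs_of_pos hY0]
              calc |a| / lift X s z 0 * |fderiv ℝ V (lift X s z) (basisVec 0)|
                  ≤ 1 / (p / 2) * (2 * M * p ^ (-a)) := by
                    gcongr
                    · exact (abs_lt.2 ha).le
                    · exact hV0 z hz
                _ = _ := by rw [hpa]; field_simp; ring
            have h4 : |z i * bump z| ≤ 1 := by
              rw [abs_mul, abs_of_nonneg (bump_nonneg z)]
              exact mul_le_one₀ ((abs_coord_le z i).trans (hle z hz)) (bump_nonneg z) (bump_le_one z)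
            have h5 := abs_sub (weightedLaplacian a V (lift X s z))
              (a / lift X s z 0 * fderiv ℝ V (lift X s z) (basisVec 0))
            rw [← hL] at h5
            rw [abs_mul, abs_mul, abs_of_pos (by norm_num : (0 : ℝ) < 1 / 2)]
            have h6 : |z i * bump z| * |Laplacian.laplacian V (lift X s z)| ≤
                1 * |Laplacian.laplacian V (lift X s z)| := by gcongr
            nlinarith [abs_nonneg (Laplacian.laplacian V (lift X s z))]
      _ = _ := by
        rw [← lintegral_add_left measurable_const]
        refine lintegral_congr fun z => ?_
        rw [← add_assoc, ← ENNReal.ofReal_add (by positivity) (by positivity)]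
        congr 2
        ring
  calc ENNReal.ofReal (∫ z : Space N, bump z) * ‖gradient V X i‖ₑ
      = ‖(∫ z : Space N, bump z) * g X‖ₑ := by
        rw [enorm_mul, hgr, Real.enorm_of_nonneg integral_bump_pos.le]
    _ ≤ ‖∫ z, bump z * g (lift X c z)‖ₑ +
        ‖∫ s in 0..c, ∫ z, bump z * fderiv ℝ g (lift X s z) (liftVel X s z)‖ₑ := by
        rw [hrep]
        exact enorm_sub_le
    _ ≤ _ := by
        refine add_le_add hfirst ?_
        rw [intervalIntegral.integral_of_le hc.le]
        exact (enorm_integral_le_lintegral_enorm _).trans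
          (setLIntegral_mono' measurableSet_Ioc hsecond)

/-! ### Powers of the height on balls, spheres and caps -/

lemma lintegral_rpow_Ioc {q c : ℝ} (hq : -1 < q) (hc : 0 ≤ c) :
    ∫⁻ s in Ioc 0 c, ENNReal.ofReal (s ^ q) = ENNReal.ofReal (c ^ (q + 1) / (q + 1)) := by
  have hi : IntervalIntegrable (fun s : ℝ => s ^ q) volume 0 c :=
    intervalIntegral.intervalIntegrable_rpow' hq
  rw [← ofReal_integral_eq_lintegral_ofReal
    ((intervalIntegrable_iff_integrableOn_Ioc_of_le hc).1 hi)
    ((ae_restrict_mem measurableSet_Ioc).mono fun s hs => Real.rpow_nonneg hs.1.le _),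
    ← intervalIntegral.integral_of_le hc, integral_rpow (Or.inl hq),
    Real.zero_rpow (by linarith), sub_zero]

/-- The half-ball lies in a cube, on which the weight is a product of functions of one variable;
only `t^q` on `(0, 1]` requires `q > -1`. -/
lemma lintegral_weight_halfBall_one_lt_top (N : ℕ) {q : ℝ} (hq : -1 < q) :
    ∫⁻ Y in halfBall N 1, ENNReal.ofReal ((Y 0) ^ q) < ⊤ := by
  set f : Fin (N + 1) → ℝ → ℝ := fun i =>
    if i = 0 then (Ioc 0 1).indicator fun t => t ^ q else (Ioc (-1) 1).indicator 1 with hf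
  have hfi : ∀ i, Integrable (f i) := by
    intro i
    by_cases hi : i = 0
    · simp only [hf, if_pos hi]
      rw [integrable_indicator_iff measurableSet_Ioc]
      exact (intervalIntegrable_iff_integrableOn_Ioc_of_le zero_le_one).1
        (intervalIntegral.intervalIntegrable_rpow' hq)
    · simp only [hf, if_neg hi]
      rw [integrable_indicator_iff measurableSet_Ioc]
      exact integrableOn_const (by simp)
  have h1 : Integrable (fun x : Fin (N + 1) → ℝ => ∏ i, f i (x i)) := Integrable.fintype_prod hfi
  have h2 : Integrable (fun Y : Space N => ∏ i, f i (Y i)) :=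
    ((PiLp.volume_preserving_ofLp (Fin (N + 1))).integrable_comp h1.aestronglyMeasurable).2 h1
  refine lt_of_le_of_lt ?_ h2.lintegral_lt_top
  rw [← lintegral_indicator (measurableSet_halfBall 1)]
  refine lintegral_mono fun Y => ?_
  by_cases hY : Y ∈ halfBall N 1
  · rw [indicator_of_mem hY]
    refine ENNReal.ofReal_le_ofReal ?_
    have hle : ∀ i, |Y i| < 1 := fun i => (abs_coord_le Y i).trans_lt hY.2
    rw [Finset.prod_eq_single (0 : Fin (N + 1))]
    · simp only [hf, if_true]
      rw [indicator_of_mem (show Y 0 ∈ Ioc (0 : ℝ) 1 from ⟨hY.1, (abs_lt.1 (hle 0)).2.le⟩)]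
    · intro i _ hi
      simp only [hf, if_neg hi]
      rw [indicator_of_mem (show Y i ∈ Ioc (-1 : ℝ) 1 from
        ⟨(abs_lt.1 (hle i)).1, (abs_lt.1 (hle i)).2.le⟩)]
      rfl
    · simp
  · rw [indicator_of_notMem hY]
    exact zero_le

lemma weightedVolume_univ (a ρ : ℝ) : weightedVolume a (halfBall N ρ) univ =
    ∫⁻ Y in halfBall N ρ, ENNReal.ofReal ((Y 0) ^ a) := by
  rw [weightedVolume, withDensity_apply _ MeasurableSet.univ, Measure.restrict_univ]

lemma weightedVolume_univ_eq {a ρ : ℝ} (ha : -1 < a) (hρ : 0 ≤ ρ) :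
    weightedVolume a (halfBall N ρ) univ =
      ENNReal.ofReal (ρ ^ (N + a + 1) / (N + a + 1)) * weightedSphere N a 1 univ := by
  have h := lintegral_weightedVolume_halfBall (N := N) a ρ (F := fun _ => 1) measurable_const
  have hN : (0 : ℝ) ≤ N := N.cast_nonneg
  rw [lintegral_one] at h
  rw [h]
  simp only [lintegral_one]
  rw [lintegral_mul_const _ (measurable_rpow_ofReal _), setLIntegral_congr Ioo_ae_eq_Ioc,
    lintegral_rpow_Ioc (by linarith) hρ]

/-- In polar coordinates the mass of the sphere is a positive multiple of that of the half-ball. -/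
lemma weightedSphere_univ_lt_top (N : ℕ) {q : ℝ} (hq : -1 < q) :
    weightedSphere N q 1 univ < ⊤ := by
  have h1 := lintegral_weight_halfBall_one_lt_top N hq
  have hN : (0 : ℝ) ≤ N := N.cast_nonneg
  rw [← weightedVolume_univ, weightedVolume_univ_eq hq zero_le_one] at h1
  refine ENNReal.lt_top_of_mul_ne_top_right h1.ne ?_
  have : 0 < (N : ℝ) + q + 1 := by linarith
  simp [this]

lemma isFiniteMeasure_weightedSphere (N : ℕ) {q : ℝ} (hq : -1 < q) :
    IsFiniteMeasure (weightedSphere N q 1) := ⟨weightedSphere_univ_lt_top N hq⟩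

/-- The weight `y₀ ^ p`, `-1 < p ≤ 0`, on balls of arbitrary centre. -/
lemma lintegral_ball_rpow_le (N : ℕ) {p : ℝ} (hp : -1 < p) (hp0 : p ≤ 0) :
    ∃ C : ℝ≥0∞, C ≠ ⊤ ∧ ∀ (Y : Space N) (ρ : ℝ), 0 < ρ →
      ∫⁻ x in {x : Space N | 0 < x 0 ∧ ‖x - Y‖ < ρ}, ENNReal.ofReal ((x 0) ^ p) ≤
        C * ENNReal.ofReal (ρ ^ (N + 1 + p)) := by
  have hN : (0 : ℝ) ≤ N := N.cast_nonneg
  have hσ := weightedSphere_univ_lt_top N hp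
  -- The first summand is for points of height at least `ρ`, where the weight is at most `ρ^p`. The
  -- lower points, if there are any, lie in the half-ball of radius `3ρ` about the projection `Y'`
  -- of `Y` onto the flat boundary, whence the second summand.
  refine ⟨volume (Metric.ball (0 : Space N) 1) +
    ENNReal.ofReal (3 ^ (N + p + 1) / (N + p + 1)) * weightedSphere N p 1 univ,
    ENNReal.add_ne_top.2 ⟨measure_ball_lt_top.ne, ENNReal.mul_ne_top ENNReal.ofReal_ne_top hσ.ne⟩,
    fun Y ρ hρ => ?_⟩
  set S := {x : Space N | 0 < x 0 ∧ ‖x - Y‖ < ρ} with hS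
  have hSm : MeasurableSet S :=
    by
    have : MeasurableSet {x : Space N | ‖x - Y‖ < ρ} :=
      measurableSet_lt (by fun_prop) measurable_const
    exact measurableSet_upper.inter this
  set Y' : Space N := Y - Y 0 • basisVec 0 with hY'
  set H := (halfBall N (3 * ρ)).indicator fun x : Space N => ENNReal.ofReal ((x 0) ^ p) with hH
  have hpt : ∀ x ∈ S, ENNReal.ofReal ((x 0) ^ p) ≤ ENNReal.ofReal (ρ ^ p) + H (x - Y') := by
    intro x hx
    rcases le_or_gt ρ (x 0) with h | h
    · exact (ENNReal.ofReal_le_ofReal (Real.rpow_le_rpow_of_nonpos hρ h hp0)).trans le_self_add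
    · have hc : (x - Y') 0 = x 0 := by simp [hY', basisVec_zero_apply]
      have h1 : |Y 0| ≤ 2 * ρ := by
        have h2 : |x 0 - Y 0| < ρ := (abs_coord_le (x - Y) 0).trans_lt hx.2
        have := abs_lt.1 h2
        rw [abs_le]
        constructor <;> linarith [hx.1]
      have h2 : x - Y' ∈ halfBall N (3 * ρ) := by
        refine ⟨by rw [hc]; exact hx.1, ?_⟩
        have : x - Y' = (x - Y) + Y 0 • basisVec 0 := by rw [hY']; abel
        rw [this]
        refine (norm_add_le _ _).trans_lt ?_
        rw [norm_smul, norm_basisVec, Real.norm_eq_abs]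
        linarith [hx.2]
      rw [hH, indicator_of_mem h2, hc]
      exact le_add_self
  have hball : volume S ≤ ENNReal.ofReal (ρ ^ (N + 1)) * volume (Metric.ball (0 : Space N) 1) := by
    calc volume S ≤ volume (Metric.ball Y ρ) := measure_mono fun x hx => by
          rw [Metric.mem_ball, dist_eq_norm]; exact hx.2
      _ = _ := by
        rw [Measure.addHaar_ball _ _ hρ.le]
        simp
  calc ∫⁻ x in S, ENNReal.ofReal ((x 0) ^ p)
      ≤ ∫⁻ x in S, (ENNReal.ofReal (ρ ^ p) + H (x - Y')) := setLIntegral_mono' hSm hpt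
    _ = ENNReal.ofReal (ρ ^ p) * volume S + ∫⁻ x in S, H (x - Y') := by
      rw [lintegral_add_left measurable_const, lintegral_const, Measure.restrict_apply_univ]
    _ ≤ ENNReal.ofReal (ρ ^ p) *
          (ENNReal.ofReal (ρ ^ (N + 1)) * volume (Metric.ball (0 : Space N) 1)) +
        ∫⁻ x, H (x - Y') := by
      gcongr
      exact Measure.restrict_le_self
    _ = _ := by
      rw [lintegral_sub_right_eq_self H Y', hH, lintegral_indicator (measurableSet_halfBall _),
        ← weightedVolume_univ, weightedVolume_univ_eq hp (by positivity), add_mul, ← mul_assoc,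
        ← ENNReal.ofReal_mul (by positivity), mul_comm (volume _), mul_right_comm,
        ← ENNReal.ofReal_mul (by have : 0 < (N : ℝ) + p + 1 := by linarith
                                 positivity)]
      congr 3
      · rw [← Real.rpow_natCast, ← Real.rpow_add hρ]
        congr 1
        push_cast
        ring
      · rw [Real.mul_rpow (by norm_num) hρ.le, add_right_comm]
        ring_nf

/-- The weight `y₀ ^ p`, `-1 < p ≤ 0`, on spherical caps of arbitrary centre. -/
lemma weightedSphere_cap_le (N : ℕ) {p : ℝ} (hp : -1 < p) (hp0 : p ≤ 0) {r₁ r₂ : ℝ} (h₁ : 0 < r₁)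
    (h₁₂ : r₁ ≤ r₂) :
    ∃ C : ℝ≥0∞, C ≠ ⊤ ∧ ∀ (Y : Space N), ∀ r ∈ Icc r₁ r₂, ∀ s, 0 < s → s ≤ r₁ / 2 →
      weightedSphere N p 1 {θ | ‖r • θ - Y‖ < 2 * s} ≤ C * ENNReal.ofReal (s ^ (N + p)) := by
  obtain ⟨C₁, hC₁, hle⟩ := lintegral_shell_le N p (half_pos h₁) (by linarith : r₁ / 2 ≤ r₂)
    (lt_add_one r₂)
  obtain ⟨C₂, hC₂, hball⟩ := lintegral_ball_rpow_le N hp hp0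
  refine ⟨C₁ * C₂ * ENNReal.ofReal (3 ^ (N + 1 + p)),
    ENNReal.mul_ne_top (ENNReal.mul_ne_top hC₁ hC₂) ENNReal.ofReal_ne_top, fun Y r hr s hs hsr => ?_⟩
  set U := {x : Space N | ‖x - Y‖ < 3 * s} with hU
  set S := {θ : Space N | ‖r • θ - Y‖ < 2 * s} with hS
  have hUm : MeasurableSet U := measurableSet_lt (by fun_prop) measurable_const
  have h1 := hle (U.indicator 1) (measurable_one.indicator hUm).aemeasurable
  have hSm : MeasurableSet S := measurableSet_lt (by fun_prop) measurable_const
  -- The cap is thickened radially by `s`: all `tθ` with `r - s < t ≤ r` lie in the ball of radius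
  -- `3s` about `Y`. The condition `s ≤ r₁/2` keeps them in the shell.
  have hlow : ENNReal.ofReal s * weightedSphere N p 1 S ≤
      ∫⁻ q, U.indicator 1 (q.1 • q.2) ∂(shellMeasure N p (r₁ / 2) r₂) := by
    have hm : Measurable fun q : ℝ × Space N => U.indicator (1 : Space N → ℝ≥0∞) (q.1 • q.2) :=
      (measurable_one.indicator hUm).comp measurable_dilate
    rw [shellMeasure, lintegral_prod _ hm.aemeasurable]
    calc ENNReal.ofReal s * weightedSphere N p 1 S
        = ∫⁻ _ in Ioc (r - s) r, weightedSphere N p 1 S := by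
          rw [setLIntegral_const, Real.volume_Ioc, sub_sub_cancel, mul_comm]
      _ ≤ ∫⁻ t in Ioc (r - s) r, ∫⁻ θ, U.indicator (1 : Space N → ℝ≥0∞) (t • θ)
            ∂(weightedSphere N p 1) := by
          refine setLIntegral_mono' measurableSet_Ioc fun t ht => ?_
          rw [← lintegral_indicator_one hSm]
          refine lintegral_mono_ae ?_
          filter_upwards [ae_weightedSphere_one N p] with θ hθ
          by_cases hθS : θ ∈ S
          · have : t • θ ∈ U := by
              have e : t • θ - Y = (r • θ - Y) + (t - r) • θ := by rw [sub_smul]; abel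
              change ‖t • θ - Y‖ < 3 * s
              rw [e]
              refine (norm_add_le _ _).trans_lt ?_
              rw [norm_smul, hθ.1, Real.norm_eq_abs, abs_sub_comm, abs_of_nonneg (by linarith [ht.2])]
              have : ‖r • θ - Y‖ < 2 * s := hθS
              linarith [ht.1]
            rw [indicator_of_mem hθS, indicator_of_mem this]
            rfl
          · rw [indicator_of_notMem hθS]
            exact zero_le
      _ ≤ _ := lintegral_mono_set (Ioc_subset_Ioc (by linarith [hr.1]) hr.2)
  have hup : ∫⁻ x, U.indicator 1 x ∂(weightedVolume p (halfBall N (r₂ + 1))) ≤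
      C₂ * ENNReal.ofReal ((3 * s) ^ (N + 1 + p)) := by
    refine le_trans ?_ (hball Y (3 * s) (by positivity))
    rw [lintegral_indicator_one hUm, weightedVolume, withDensity_apply _ hUm,
      Measure.restrict_restrict hUm]
    exact lintegral_mono_set fun x hx => ⟨hx.2.1, hx.1⟩
  have hs0 : ENNReal.ofReal s ≠ 0 := by simpa using hs
  have h2 := hlow.trans (h1.trans (mul_le_mul_right hup C₁))
  rw [← ENNReal.mul_le_mul_iff_right hs0 ENNReal.ofReal_ne_top]
  refine h2.trans (le_of_eq ?_)
  have e : (3 * s) ^ ((N : ℝ) + 1 + p) = s * (3 ^ ((N : ℝ) + 1 + p) * s ^ ((N : ℝ) + p)) := by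
    rw [Real.mul_rpow (by norm_num) hs.le, show (N : ℝ) + 1 + p = (N + p) + 1 by ring,
      Real.rpow_add_one hs.ne' ((N : ℝ) + p)]
    ring
  rw [e, ENNReal.ofReal_mul hs.le, ENNReal.ofReal_mul (by positivity)]
  ring

/-- The Cauchy–Schwarz inequality for the Lebesgue integral. -/
lemma sq_lintegral_mul_le {α : Type*} [MeasurableSpace α] (μ : Measure α) {u v : α → ℝ≥0∞}
    (hu : AEMeasurable u μ) (hv : AEMeasurable v μ) :
    (∫⁻ x, u x * v x ∂μ) ^ 2 ≤ (∫⁻ x, u x ^ 2 ∂μ) * ∫⁻ x, v x ^ 2 ∂μ := by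
  have h := ENNReal.lintegral_mul_le_Lp_mul_Lq μ Real.HolderConjugate.two_two hu hv
  have hs : ∀ x : ℝ≥0∞, (x ^ (1 / 2 : ℝ)) ^ 2 = x := fun x => by
    rw [← ENNReal.rpow_natCast, ← ENNReal.rpow_mul]; norm_num
  calc (∫⁻ x, u x * v x ∂μ) ^ 2 ≤ _ := pow_le_pow_left₀ zero_le h 2
    _ = _ := by
      rw [mul_pow, hs, hs]
      simp

set_option maxHeartbeats 1000000 in
/-- Integrating over the curves `s ↦ lift X s z` for all `X` on a half-sphere amounts to integrating
over a half-ball. -/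
lemma lintegral_lift_le (N : ℕ) {p κ r₁ r₂ c : ℝ} (hp : -1 < p) (hp0 : p ≤ 0) (h₁ : 0 < r₁)
    (h₁₂ : r₁ ≤ r₂) (hκ : κ < 1 + p) (hc : c ≤ r₁ / 2) :
    ∃ C : ℝ≥0∞, C ≠ ⊤ ∧ ∀ F : Space N → ℝ≥0∞, Measurable F → ∀ r ∈ Icc r₁ r₂,
      ∫⁻ θ, (∫⁻ s in Ioc 0 c, ∫⁻ z in Metric.closedBall (0 : Space N) 1,
        ENNReal.ofReal (s ^ (1 - κ)) * F (lift (r • θ) s z)) ∂(weightedSphere N p 1) ≤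
      C * ∫⁻ Y in {Y : Space N | 0 < Y 0}, ENNReal.ofReal ((Y 0) ^ (1 + p - κ)) * F Y := by
  obtain ⟨C, hC, hcap⟩ := weightedSphere_cap_le N hp hp0 h₁ h₁₂
  refine ⟨ENNReal.ofReal (2 ^ (N + 1)) * C * ENNReal.ofReal (2 ^ (1 + p - κ) / (1 + p - κ)),
    ENNReal.mul_ne_top (ENNReal.mul_ne_top ENNReal.ofReal_ne_top hC) ENNReal.ofReal_ne_top,
    fun F hF r hr => ?_⟩
  have hr0 : 0 < r := h₁.trans_le hr.1
  -- Necessary conditions for `Y` to be reached from `rθ` at time `s`: its height is at least `s/2`,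
  -- and its distance from `rθ` is at most `3s/2 < 2s`.
  set Q : Set (Space N × ℝ × Space N) :=
    {q | q.2.1 ≤ 2 * q.2.2 0 ∧ ‖r • q.1 - q.2.2‖ < 2 * q.2.1} with hQ
  have hQm : MeasurableSet Q := by
    have h1 : Measurable fun q : Space N × ℝ × Space N => 2 * q.2.2 0 :=
      ((measurable_coord 0).comp (measurable_snd.comp measurable_snd)).const_mul 2
    have h2 : Measurable fun q : Space N × ℝ × Space N => ‖r • q.1 - q.2.2‖ := by fun_prop
    exact (measurableSet_le (by fun_prop) h1).inter (measurableSet_lt h2 (by fun_prop))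
  -- The change of variables `z ↦ Y` has Jacobian `(2/s)^(N+1)`, which combines with `s^(1-κ)` into
  -- `2^(N+1) s^(-N-κ)`.
  set Φ : Space N → ℝ → Space N → ℝ≥0∞ := fun θ s Y =>
    ENNReal.ofReal (2 ^ (N + 1) * s ^ (-(N : ℝ) - κ)) * Q.indicator (fun q => F q.2.2) (θ, s, Y)
    with hΦ
  have hΦm : Measurable fun q : Space N × ℝ × Space N => Φ q.1 q.2.1 q.2.2 := by
    refine Measurable.mul ?_ ((hF.comp (measurable_snd.comp measurable_snd)).indicator hQm)
    have : Measurable fun s : ℝ => ENNReal.ofReal (2 ^ (N + 1) * s ^ (-(N : ℝ) - κ)) := by fun_prop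
    exact this.comp (measurable_fst.comp measurable_snd)
  set ν : Measure ℝ := volume.restrict (Ioc 0 c) with hν
  set σ := weightedSphere N p 1 with hσ
  have hstep : ∀ θ : Space N, (‖θ‖ = 1 ∧ 0 < θ 0) → ∀ s ∈ Ioc 0 c,
      ∫⁻ z in Metric.closedBall (0 : Space N) 1,
        ENNReal.ofReal (s ^ (1 - κ)) * F (lift (r • θ) s z) ≤ ∫⁻ Y, Φ θ s Y := by
    intro θ hθ s hs
    have hX : 0 < (r • θ) 0 := by simpa using mul_pos hr0 hθ.2
    set x : Space N := r • θ + (liftHeight ((r • θ) 0) s - (r • θ) 0) • basisVec 0 with hx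
    set W : Space N → ℝ≥0∞ := fun Y => Q.indicator (fun q => F q.2.2) (θ, s, Y) with hW
    have hWm : Measurable W :=
      ((hF.comp (measurable_snd.comp measurable_snd)).indicator hQm).comp
        (measurable_const.prodMk (measurable_const.prodMk measurable_id))
    have hle : ∀ z ∈ Metric.closedBall (0 : Space N) 1,
        F (lift (r • θ) s z) ≤ W (x + (s / 2) • z) := by
      intro z hz
      have hm : (θ, s, lift (r • θ) s z) ∈ Q := by
        refine ⟨?_, ?_⟩
        · have := (lift_coord_bounds (X := r • θ) hs.1.le hz).1
          have h2 := le_liftHeight_right (t := (r • θ) 0) (s := s)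
          simp only
          linarith
        · have := norm_lift_sub_le hX hs.1.le hz
          rw [norm_sub_rev] at this
          exact this.trans_lt (by simp only; linarith [hs.1])
      change _ ≤ W (lift (r • θ) s z)
      rw [hW]
      simp only
      rw [indicator_of_mem hm]
    have hWx : Measurable fun w => W (x + w) := hWm.comp (measurable_const_add x)
    have hWz : Measurable fun z => W (x + (s / 2) • z) := hWx.comp (measurable_const_smul (s / 2))
    have hs2 : s / 2 ≠ 0 := (half_pos hs.1).ne'
    have hsub : ∫⁻ z, W (x + (s / 2) • z) =
        ENNReal.ofReal (2 ^ (N + 1) * s ^ (-(N : ℝ) - 1)) * ∫⁻ Y, W Y := by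
      have h1 : ∫⁻ z, W (x + (s / 2) • z) =
          ∫⁻ w, W (x + w) ∂(Measure.map ((s / 2) • ·) (volume : Measure (Space N))) := by
        rw [lintegral_map hWx (measurable_const_smul (s / 2))]
      rw [h1, Measure.map_addHaar_smul _ hs2, lintegral_smul_measure, lintegral_add_left_eq_self,
        smul_eq_mul]
      congr 2
      have := hs.1
      rw [finrank_euclideanSpace_fin, abs_of_pos (by positivity), div_pow, inv_div, div_eq_mul_inv,
        show -(N : ℝ) - 1 = -((N + 1 : ℕ) : ℝ) by push_cast; ring, Real.rpow_neg this.le,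
        Real.rpow_natCast]
    calc _ ≤ ∫⁻ z in Metric.closedBall (0 : Space N) 1,
          ENNReal.ofReal (s ^ (1 - κ)) * W (x + (s / 2) • z) :=
          setLIntegral_mono' Metric.isClosed_closedBall.measurableSet fun z hz =>
            mul_le_mul_right (hle z hz) _
      _ ≤ ∫⁻ z, ENNReal.ofReal (s ^ (1 - κ)) * W (x + (s / 2) • z) := setLIntegral_le_lintegral _ _
      _ = ∫⁻ Y, Φ θ s Y := by
        have := hs.1
        rw [lintegral_const_mul _ hWz, hsub, lintegral_const_mul _ hWm,
          ← mul_assoc, ← ENNReal.ofReal_mul (by positivity)]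
        congr 2
        rw [mul_left_comm, ← Real.rpow_add this]
        congr 2
        ring
  -- For fixed `Y` and `s` the admissible `θ` form a cap of mass `O(s^(N+p))`, so `s^(p-κ)` remains.
  have hcapΦ : ∀ s ∈ Ioc 0 c, ∀ Y, ∫⁻ θ, Φ θ s Y ∂σ ≤ ENNReal.ofReal (2 ^ (N + 1)) * C *
      (F Y * (Ioc 0 (2 * Y 0)).indicator (fun s => ENNReal.ofReal (s ^ (p - κ))) s) := by
    intro s hs Y
    by_cases hsY : s ≤ 2 * Y 0
    · rw [indicator_of_mem (show s ∈ Ioc 0 (2 * Y 0) from ⟨hs.1, hsY⟩)]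
      have hSm : MeasurableSet {θ : Space N | ‖r • θ - Y‖ < 2 * s} :=
        measurableSet_lt (by fun_prop) measurable_const
      have e : ∀ θ, Φ θ s Y = ENNReal.ofReal (2 ^ (N + 1) * s ^ (-(N : ℝ) - κ)) * F Y *
          {θ : Space N | ‖r • θ - Y‖ < 2 * s}.indicator 1 θ := by
        intro θ
        rw [hΦ, mul_assoc]
        simp only
        congr 1
        by_cases hθ : ‖r • θ - Y‖ < 2 * s
        · rw [indicator_of_mem (show (θ, s, Y) ∈ Q from ⟨hsY, hθ⟩),
            indicator_of_mem (show θ ∈ {θ : Space N | ‖r • θ - Y‖ < 2 * s} from hθ), Pi.one_apply,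
            mul_one]
        · rw [indicator_of_notMem (fun h : (θ, s, Y) ∈ Q => hθ h.2),
            indicator_of_notMem (fun h : θ ∈ {θ : Space N | ‖r • θ - Y‖ < 2 * s} => hθ h), mul_zero]
      simp only [e]
      rw [lintegral_const_mul _ (measurable_one.indicator hSm), lintegral_indicator_one hSm]
      calc _ ≤ ENNReal.ofReal (2 ^ (N + 1) * s ^ (-(N : ℝ) - κ)) * F Y *
            (C * ENNReal.ofReal (s ^ (N + p))) :=
            mul_le_mul_right (hcap Y r hr s hs.1 (hs.2.trans hc)) _
        _ = _ := by
          have := hs.1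
          have e2 : s ^ (p - κ) = s ^ (-(N : ℝ) - κ) * s ^ (N + p) := by
            rw [← Real.rpow_add this]
            congr 1
            ring
          rw [e2, ENNReal.ofReal_mul (by positivity), ENNReal.ofReal_mul (by positivity)]
          ring
    · have : ∀ θ, Φ θ s Y = 0 := fun θ => by
        rw [hΦ]
        simp only
        rw [indicator_of_notMem (fun h : (θ, s, Y) ∈ Q => hsY h.1), mul_zero]
      simp [this]
  have hκ' : 0 < 1 + p - κ := by linarith
  -- Only times `s ≤ 2 Y₀` contribute, and `p - κ > -1`.
  have hfin : ∀ Y : Space N, ∫⁻ s in Ioc 0 c,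
      (Ioc 0 (2 * Y 0)).indicator (fun s => ENNReal.ofReal (s ^ (p - κ))) s ≤
      {Y : Space N | 0 < Y 0}.indicator (fun Y => ENNReal.ofReal (2 ^ (1 + p - κ) / (1 + p - κ)) *
        ENNReal.ofReal ((Y 0) ^ (1 + p - κ))) Y := by
    intro Y
    by_cases hY : 0 < Y 0
    · rw [indicator_of_mem (show Y ∈ {Y : Space N | 0 < Y 0} from hY)]
      refine (setLIntegral_le_lintegral _ _).trans ?_
      rw [lintegral_indicator measurableSet_Ioc, lintegral_rpow_Ioc (by linarith) (by linarith),
        ← ENNReal.ofReal_mul (by positivity), show p - κ + 1 = 1 + p - κ by ring,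
        Real.mul_rpow (by norm_num) hY.le]
      refine ENNReal.ofReal_le_ofReal (le_of_eq (by ring))
    · have : Ioc 0 (2 * Y 0) = ∅ := Ioc_eq_empty (by linarith)
      simp [this]
  have hm1 : Measurable (Function.uncurry fun (θ : Space N) (s : ℝ) => ∫⁻ Y, Φ θ s Y) :=
    Measurable.lintegral_prod_right' (f := fun q : (Space N × ℝ) × Space N => Φ q.1.1 q.1.2 q.2)
      (hΦm.comp (by fun_prop : Measurable fun q : (Space N × ℝ) × Space N => (q.1.1, q.1.2, q.2)))
  have hm2 : ∀ s, Measurable (Function.uncurry fun (θ : Space N) (Y : Space N) => Φ θ s Y) := fun s =>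
    hΦm.comp (by fun_prop : Measurable fun q : Space N × Space N => (q.1, s, q.2))
  have hm3 : Measurable (Function.uncurry fun (s : ℝ) (Y : Space N) => ∫⁻ θ, Φ θ s Y ∂σ) :=
    Measurable.lintegral_prod_right' (f := fun q : (ℝ × Space N) × Space N => Φ q.2 q.1.1 q.1.2)
      (hΦm.comp (by fun_prop : Measurable fun q : (ℝ × Space N) × Space N => (q.2, q.1.1, q.1.2)))
  have hm4 : ∀ Y : Space N, Measurable fun s : ℝ =>
      (Ioc 0 (2 * Y 0)).indicator (fun s => ENNReal.ofReal (s ^ (p - κ))) s := fun Y =>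
    (measurable_rpow_ofReal _).indicator measurableSet_Ioc
  calc _ ≤ ∫⁻ θ, ∫⁻ s, ∫⁻ Y, Φ θ s Y ∂volume ∂ν ∂σ := by
        refine lintegral_mono_ae ?_
        filter_upwards [ae_weightedSphere_one N p] with θ hθ
        exact setLIntegral_mono' measurableSet_Ioc (hstep θ hθ)
    _ = ∫⁻ s, ∫⁻ θ, ∫⁻ Y, Φ θ s Y ∂volume ∂σ ∂ν := lintegral_lintegral_swap hm1.aemeasurable
    _ = ∫⁻ s, ∫⁻ Y, ∫⁻ θ, Φ θ s Y ∂σ ∂volume ∂ν :=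
        lintegral_congr fun s => lintegral_lintegral_swap (hm2 s).aemeasurable
    _ = ∫⁻ Y, ∫⁻ s, ∫⁻ θ, Φ θ s Y ∂σ ∂ν ∂volume := lintegral_lintegral_swap hm3.aemeasurable
    _ ≤ ∫⁻ Y : Space N, ENNReal.ofReal (2 ^ (N + 1)) * C * (F Y * ∫⁻ s in Ioc 0 c,
          (Ioc 0 (2 * Y 0)).indicator (fun s => ENNReal.ofReal (s ^ (p - κ))) s) := by
        refine lintegral_mono fun Y => ?_
        rw [← lintegral_const_mul _ (hm4 Y), ← lintegral_const_mul _ ((hm4 Y).const_mul _)]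
        exact setLIntegral_mono' measurableSet_Ioc fun s hs => hcapΦ s hs Y
    _ ≤ ∫⁻ Y : Space N, ENNReal.ofReal (2 ^ (N + 1)) * C * (F Y *
          {Y : Space N | 0 < Y 0}.indicator (fun Y => ENNReal.ofReal (2 ^ (1 + p - κ) / (1 + p - κ)) *
        ENNReal.ofReal ((Y 0) ^ (1 + p - κ))) Y) :=
        lintegral_mono fun Y => mul_le_mul_right (mul_le_mul_right (hfin Y) _) _
    _ = _ := by
        have hm5 : Measurable ({Y : Space N | 0 < Y 0}.indicator fun Y =>
            ENNReal.ofReal ((Y 0) ^ (1 + p - κ)) * F Y) :=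
          ((measurable_weight _).mul hF).indicator measurableSet_upper
        rw [← lintegral_indicator measurableSet_upper, ← lintegral_const_mul _ hm5]
        refine lintegral_congr fun Y => ?_
        by_cases hY : Y ∈ {Y : Space N | 0 < Y 0}
        · rw [indicator_of_mem hY, indicator_of_mem hY]
          ring
        · rw [indicator_of_notMem hY, indicator_of_notMem hY, mul_zero, mul_zero, mul_zero]

/-! ### No concentration of the gradient at the equator -/

lemma ae_halfSphere_pos (N : ℕ) (r : ℝ) : ∀ᵐ θ ∂(halfSphereMeasure N r), 0 < θ 0 :=
  ae_restrict_mem measurableSet_upper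

/-- Multiplication of the weight by a power of the height. -/
lemma lintegral_weight_mul (a b : ℝ) {S : Set (Space N)} (hS : MeasurableSet S) :
    ∫⁻ θ in S, ENNReal.ofReal ((θ 0) ^ b) ∂(weightedSphere N a 1) = weightedSphere N (a + b) 1 S := by
  rw [weightedSphere, weightedSphere, restrict_withDensity hS,
    lintegral_withDensity_eq_lintegral_mul _ (measurable_weight a) (measurable_weight b),
    withDensity_apply _ hS]
  refine lintegral_congr_ae (ae_restrict_of_ae ?_)
  filter_upwards [ae_halfSphere_pos N 1] with θ hθ
  rw [Pi.mul_apply, Real.rpow_add hθ, ENNReal.ofReal_mul (by positivity)]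

/-- Near the equator, the measure with the larger exponent is much smaller. -/
lemma restrict_weightedSphere_le {a q δ : ℝ} (hqa : q ≤ a) :
    (weightedSphere N a 1).restrict {θ | θ 0 < δ} ≤
      ENNReal.ofReal (δ ^ (a - q)) • (weightedSphere N q 1).restrict {θ | θ 0 < δ} := by
  have hS : MeasurableSet {θ : Space N | θ 0 < δ} := measurableSet_lt (measurable_coord 0) measurable_const
  refine Measure.le_iff.2 fun T hT => ?_
  rw [Measure.smul_apply, Measure.restrict_apply hT, Measure.restrict_apply hT, weightedSphere,
    weightedSphere, withDensity_apply _ (hT.inter hS), withDensity_apply _ (hT.inter hS), smul_eq_mul,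
    ← lintegral_const_mul _ (measurable_weight q)]
  refine lintegral_mono_ae ?_
  filter_upwards [ae_restrict_of_ae (ae_halfSphere_pos N 1), ae_restrict_mem (hT.inter hS)] with θ hθ hθS
  have h1 : (θ 0) ^ a = (θ 0) ^ (a - q) * (θ 0) ^ q := by rw [← Real.rpow_add hθ, sub_add_cancel]
  rw [← ENNReal.ofReal_mul (Real.rpow_nonneg (hθ.le.trans (le_of_lt hθS.2)) _), h1]
  exact ENNReal.ofReal_le_ofReal (mul_le_mul_of_nonneg_right
    (Real.rpow_le_rpow hθ.le (le_of_lt hθS.2) (sub_nonneg.2 hqa)) (by positivity))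

lemma sq_add_three_le (x y z : ℝ≥0∞) : (x + y + z) ^ 2 ≤ 3 * (x ^ 2 + y ^ 2 + z ^ 2) := by
  have h := fun u v w : ℝ => (by nlinarith [sq_nonneg (u - v), sq_nonneg (v - w), sq_nonneg (u - w)] :
    (u + v + w) ^ 2 ≤ 3 * (u ^ 2 + v ^ 2 + w ^ 2))
  rcases eq_or_ne x ⊤ with rfl | hx
  · simp
  rcases eq_or_ne y ⊤ with rfl | hy
  · simp
  rcases eq_or_ne z ⊤ with rfl | hz
  · simp
  lift x to NNReal using hx
  lift y to NNReal using hy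
  lift z to NNReal using hz
  have := h x y z
  exact_mod_cast this

lemma ofReal_rpow_half_sq {s e : ℝ} (hs : 0 < s) :
    ENNReal.ofReal (s ^ (e / 2)) ^ 2 = ENNReal.ofReal (s ^ e) := by
  rw [← ENNReal.ofReal_pow (by positivity), ← Real.rpow_natCast, ← Real.rpow_mul hs.le]
  norm_num

lemma continuousOn_weightedLaplacian (a : ℝ) {V : Space N → ℝ} {ρ : ℝ}
    (hV : ContDiffOn ℝ 2 V (halfBall N ρ)) :
    ContinuousOn (weightedLaplacian a V) (halfBall N ρ) := by
  have h0 : Continuous fun Y : Space N => Y 0 := by fun_prop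
  exact (continuousOn_laplacian (isOpen_halfBall ρ) hV).add
    ((continuousOn_const.div h0.continuousOn fun Y hY => hY.1.ne').mul
      (h0.comp_continuousOn (continuousOn_gradient (isOpen_halfBall ρ) (hV.of_le (by norm_num)))))

set_option maxHeartbeats 1000000 in
/-- Near the flat boundary, the gradient is controlled by a negative power of the height and by the
weighted Laplacian in a cone. -/
lemma exists_gradient_sq_bound {a : ℝ} (ha : a ∈ Ioo (-1 : ℝ) 1) {V : Space N → ℝ}
    {ρ c ε M r₂ b κ₁ κ₂ : ℝ} (hV : ContDiffOn ℝ 2 V (halfBall N ρ)) (hM : 0 ≤ M)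
    (hbd : ∀ Y ∈ halfBall N ρ, Y 0 < ε → |gradient V Y 0| ≤ M * (Y 0) ^ (-a))
    (hc : 0 < c) (hc1 : c ≤ 1) (hρ : r₂ + 2 * c < ρ) (hε : 3 * c ≤ ε)
    (hκ₁ : 0 < κ₁) (hκ₁' : κ₁ ≤ 1) (hb : b = a + κ₁) (hb0 : 0 ≤ b) (hκ₂ : 0 < κ₂) :
    ∃ D E : ℝ≥0∞, D ≠ ⊤ ∧ E ≠ ⊤ ∧ ∀ X : Space N, 0 < X 0 → X 0 < c → ‖X‖ ≤ r₂ →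
      ‖gradient V X‖ₑ ^ 2 ≤ D * ENNReal.ofReal ((X 0) ^ (-(2 * b))) +
        E * ∫⁻ s in Ioc 0 c, ∫⁻ z in Metric.closedBall (0 : Space N) 1, ENNReal.ofReal (s ^ (1 - κ₂)) *
          (halfBall N ρ).indicator (fun Y => ‖weightedLaplacian a V Y‖ₑ ^ 2) (lift X s z) := by
  obtain ⟨K, hK, hgb⟩ := exists_gradient_bound N ha
  set B := Metric.closedBall (0 : Space N) 1 with hB
  -- At the final time `c` the balls lie in this compact set, where continuity bounds the gradient.
  obtain ⟨L, hL⟩ : ∃ L, ∀ Y ∈ {Y : Space N | c / 2 ≤ Y 0 ∧ ‖Y‖ ≤ r₂ + 3 / 2 * c},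
      ‖gradient V Y‖ ≤ L := by
    refine IsCompact.exists_bound_of_continuousOn (Metric.isCompact_of_isClosed_isBounded ?_ ?_)
      ((continuousOn_gradient (isOpen_halfBall ρ) (hV.of_le (by norm_num))).mono ?_)
    · have h1 : Continuous fun Y : Space N => Y 0 := by fun_prop
      exact (isClosed_le continuous_const h1).inter (isClosed_le continuous_norm continuous_const)
    · exact Metric.isBounded_closedBall (x := (0 : Space N)) (r := r₂ + 3 / 2 * c) |>.subset
        fun Y hY => by simpa using hY.2
    · exact fun Y hY => ⟨(half_pos hc).trans_le hY.1, hY.2.trans_lt (by linarith)⟩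
  set I := ∫ z : Space N, bump z with hI
  have hI0 : 0 < I := integral_bump_pos
  have hJ0 : ENNReal.ofReal I ≠ 0 := by simpa using hI0
  set w₀ := volume B with hw₀
  have hw₀t : w₀ ≠ ⊤ := (isCompact_closedBall _ _).measure_lt_top.ne
  set f : Space N → ℝ := (halfBall N ρ).indicator (weightedLaplacian a V) with hf
  have hfm : Measurable f := by
    classical
    have := (continuousOn_weightedLaplacian a hV).measurable_piecewise (g := 0) continuousOn_const (measurableSet_halfBall ρ)
    rwa [piecewise_eq_indicator] at this
  set k₁ := ENNReal.ofReal (c ^ κ₁ / κ₁) with hk₁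
  set k₂ := ENNReal.ofReal (c ^ κ₂ / κ₂) with hk₂
  set J := ENNReal.ofReal I with hJ
  have hJt : J ≠ ⊤ := ENNReal.ofReal_ne_top
  set Q₁ := ENNReal.ofReal (I * max L 0) with hQ₁
  set Q₂ := w₀ * k₁ * ENNReal.ofReal (K * M) with hQ₂
  have hQ₂t : Q₂ ≠ ⊤ := ENNReal.mul_ne_top (ENNReal.mul_ne_top hw₀t ENNReal.ofReal_ne_top)
    ENNReal.ofReal_ne_top
  have hcomp : ∀ X : Space N, 0 < X 0 → X 0 < c → ‖X‖ ≤ r₂ → ∀ i,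
      J ^ 2 * ‖gradient V X i‖ₑ ^ 2 ≤ 3 * ((Q₁ ^ 2 + Q₂ ^ 2) * ENNReal.ofReal ((X 0) ^ (-(2 * b))) +
        w₀ * k₂ * ∫⁻ s in Ioc 0 c, ∫⁻ z in B, ENNReal.ofReal (s ^ (1 - κ₂)) * ‖f (lift X s z)‖ₑ ^ 2) := by
    intro X hX hXc hXr i
    have hmem : ∀ s ∈ Ioc 0 c, ∀ z ∈ B, lift X s z ∈ halfBall N ρ := fun s hs z hz =>
      lift_mem_halfBall hX (by linarith) ⟨hs.1.le, hs.2⟩ hz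
    have h1 := hgb V ρ c ε M (max L 0) X i hV hM (le_max_right _ _) hbd hX hXc (by linarith) hε
      fun z hz => by
        have h2 := lift_coord_bounds (X := X) hc.le hz
        have h3 := le_liftHeight_right (t := X 0) (s := c)
        exact (abs_coord_le _ i).trans ((hL _ ⟨by linarith,
          (norm_lift_le hX hc.le hz).trans (by linarith)⟩).trans (le_max_left _ _))
    have hlm : Measurable fun q : ℝ × Space N => lift X q.1 q.2 :=
      (continuous_lift.comp (by fun_prop : Continuous fun q : ℝ × Space N => (X, q.1, q.2))).measurable
    have hfl : Measurable fun q : ℝ × Space N => ‖f (lift X q.1 q.2)‖ₑ := (hfm.comp hlm).enorm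
    -- Cauchy–Schwarz after writing `1 = s^((κ₂-1)/2) · s^((1-κ₂)/2)`; the first factor is square
    -- integrable because `κ₂ > 0`.
    have hB2 : (∫⁻ s in Ioc 0 c, ∫⁻ z in B, ‖f (lift X s z)‖ₑ) ^ 2 ≤ w₀ * k₂ *
        ∫⁻ s in Ioc 0 c, ∫⁻ z in B, ENNReal.ofReal (s ^ (1 - κ₂)) * ‖f (lift X s z)‖ₑ ^ 2 := by
      set μ : Measure (ℝ × Space N) := (volume.restrict (Ioc 0 c)).prod (volume.restrict B) with hμ
      have hu : Measurable fun q : ℝ × Space N => ENNReal.ofReal (q.1 ^ ((κ₂ - 1) / 2)) :=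
        (measurable_rpow_ofReal _).comp measurable_fst
      have hv : Measurable fun q : ℝ × Space N =>
          ENNReal.ofReal (q.1 ^ ((1 - κ₂) / 2)) * ‖f (lift X q.1 q.2)‖ₑ :=
        ((measurable_rpow_ofReal _).comp measurable_fst).mul hfl
      have h2 := sq_lintegral_mul_le μ hu.aemeasurable hv.aemeasurable
      have huv : Measurable fun q : ℝ × Space N => ENNReal.ofReal (q.1 ^ ((κ₂ - 1) / 2)) *
          (ENNReal.ofReal (q.1 ^ ((1 - κ₂) / 2)) * ‖f (lift X q.1 q.2)‖ₑ) := hu.mul hv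
      rw [lintegral_prod _ huv.aemeasurable, lintegral_prod _ (hu.pow_const 2).aemeasurable,
        lintegral_prod _ (hv.pow_const 2).aemeasurable] at h2
      convert h2 using 1
      · congr 1
        refine setLIntegral_congr_fun measurableSet_Ioc fun s hs => lintegral_congr fun z => ?_
        rw [← mul_assoc, ← ENNReal.ofReal_mul (Real.rpow_nonneg hs.1.le _), ← Real.rpow_add hs.1,
          show (κ₂ - 1) / 2 + (1 - κ₂) / 2 = 0 by ring, Real.rpow_zero]
        simp
      · congr 1
        · have : ∫⁻ s in Ioc 0 c, w₀ * ENNReal.ofReal (s ^ (κ₂ - 1)) = w₀ * k₂ := by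
            rw [lintegral_const_mul _ (measurable_rpow_ofReal _),
              lintegral_rpow_Ioc (by linarith) hc.le, sub_add_cancel]
          rw [← this]
          refine setLIntegral_congr_fun measurableSet_Ioc fun s hs => ?_
          simp only [ofReal_rpow_half_sq hs.1]
          rw [setLIntegral_const, mul_comm]
        · refine setLIntegral_congr_fun measurableSet_Ioc fun s hs => lintegral_congr fun z => ?_
          simp only [mul_pow, ofReal_rpow_half_sq hs.1]
    -- The height `p` of the centre exceeds both `X₀` and `s`, so `p^(-a-1) = p^(-b) p^(κ₁-1) ≤
    -- X₀^(-b) s^(κ₁-1)`, which is integrable in `s`.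
    have hB1 : ∫⁻ s in Ioc 0 c, ∫⁻ z in B,
        (ENNReal.ofReal (K * M * liftHeight (X 0) s ^ (-a - 1)) +
            ‖weightedLaplacian a V (lift X s z)‖ₑ) ≤ Q₂ * ENNReal.ofReal ((X 0) ^ (-b)) +
          ∫⁻ s in Ioc 0 c, ∫⁻ z in B, ‖f (lift X s z)‖ₑ := by
      have e : Q₂ * ENNReal.ofReal ((X 0) ^ (-b)) = ∫⁻ s in Ioc 0 c, w₀ *
          (ENNReal.ofReal (K * M) * ENNReal.ofReal ((X 0) ^ (-b))) * ENNReal.ofReal (s ^ (κ₁ - 1)) := by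
        rw [lintegral_const_mul _ (measurable_rpow_ofReal _),
          lintegral_rpow_Ioc (by linarith) hc.le, sub_add_cancel, hQ₂]
        ring
      rw [e, ← lintegral_add_left ((measurable_rpow_ofReal _).const_mul _)]
      refine setLIntegral_mono' measurableSet_Ioc fun s hs => ?_
      rw [lintegral_add_left measurable_const, setLIntegral_const]
      refine add_le_add ?_ (le_of_eq (setLIntegral_congr_fun Metric.isClosed_closedBall.measurableSet
        fun z hz => by simp only [hf]; rw [indicator_of_mem (hmem s hs z hz)]))
      rw [mul_comm, mul_assoc w₀, ← ENNReal.ofReal_mul (by positivity), ← ENNReal.ofReal_mul (by positivity)]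
      refine mul_le_mul_right (ENNReal.ofReal_le_ofReal ?_) w₀
      rw [mul_assoc (K * M)]
      refine mul_le_mul_of_nonneg_left ?_ (by positivity)
      have hp := liftHeight_pos (s := s) hX
      rw [show -a - 1 = -b + (κ₁ - 1) by rw [hb]; ring, Real.rpow_add hp]
      have := hs.1
      exact mul_le_mul (Real.rpow_le_rpow_of_nonpos hX le_liftHeight_left (by linarith))
        (Real.rpow_le_rpow_of_nonpos hs.1 le_liftHeight_right (by linarith)) (by positivity)
        (by positivity)
    -- As `b ≥ 0` and `X₀ < 1`, the bounded term can be absorbed into the power of the height.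
    have hone : 1 ≤ ENNReal.ofReal ((X 0) ^ (-(2 * b))) := by
      rw [ENNReal.one_le_ofReal]
      exact Real.one_le_rpow_of_pos_of_le_one_of_nonpos hX (by linarith) (by linarith)
    calc J ^ 2 * ‖gradient V X i‖ₑ ^ 2 = (J * ‖gradient V X i‖ₑ) ^ 2 := (mul_pow _ _ _).symm
      _ ≤ (Q₁ + Q₂ * ENNReal.ofReal ((X 0) ^ (-b)) +
          ∫⁻ s in Ioc 0 c, ∫⁻ z in B, ‖f (lift X s z)‖ₑ) ^ 2 := by
        refine pow_le_pow_left₀ zero_le (h1.trans ?_) 2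
        rw [add_assoc]
        exact add_le_add_right hB1 _
      _ ≤ 3 * (Q₁ ^ 2 + (Q₂ * ENNReal.ofReal ((X 0) ^ (-b))) ^ 2 +
          (∫⁻ s in Ioc 0 c, ∫⁻ z in B, ‖f (lift X s z)‖ₑ) ^ 2) := sq_add_three_le _ _ _
      _ ≤ _ := by
        refine mul_le_mul_right (add_le_add ?_ hB2) _
        rw [mul_pow, show -b = -(2 * b) / 2 by ring, ofReal_rpow_half_sq hX, add_mul]
        refine add_le_add_left ?_ _
        calc Q₁ ^ 2 = Q₁ ^ 2 * 1 := (mul_one _).symm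
          _ ≤ _ := mul_le_mul_right hone _
  have hJ2 : J ^ 2 ≠ 0 := pow_ne_zero _ hJ0
  have hJ2t : J ^ 2 ≠ ⊤ := ENNReal.pow_ne_top hJt
  set k := (J ^ 2)⁻¹ * ((N + 1 : ℕ) * 3) with hk
  have hkt : k ≠ ⊤ := ENNReal.mul_ne_top (ENNReal.inv_ne_top.2 hJ2)
    (ENNReal.mul_ne_top (ENNReal.natCast_ne_top _) (by simp))
  refine ⟨k * (Q₁ ^ 2 + Q₂ ^ 2), k * (w₀ * k₂), ENNReal.mul_ne_top hkt (ENNReal.add_ne_top.2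
    ⟨ENNReal.pow_ne_top ENNReal.ofReal_ne_top, ENNReal.pow_ne_top hQ₂t⟩),
    ENNReal.mul_ne_top hkt (ENNReal.mul_ne_top hw₀t ENNReal.ofReal_ne_top), fun X hX hXc hXr => ?_⟩
  have hsum : ‖gradient V X‖ₑ ^ 2 = ∑ i, ‖gradient V X i‖ₑ ^ 2 := by
    rw [enorm_sq_eq_ofReal, EuclideanSpace.norm_sq_eq, ENNReal.ofReal_sum_of_nonneg
      fun i _ => sq_nonneg _]
    exact Finset.sum_congr rfl fun i _ => (enorm_sq_eq_ofReal _).symm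
  have hind : ∀ Y, ‖f Y‖ₑ ^ 2 =
      (halfBall N ρ).indicator (fun Y => ‖weightedLaplacian a V Y‖ₑ ^ 2) Y := by
    intro Y
    by_cases hY : Y ∈ halfBall N ρ
    · simp [hf, hY]
    · simp [hf, hY]
  simp only [← hind]
  rw [hsum]
  have h2 : ∀ i, ‖gradient V X i‖ₑ ^ 2 ≤ (J ^ 2)⁻¹ * _ := fun i => by
    have := mul_le_mul_right (hcomp X hX hXc hXr i) (J ^ 2)⁻¹
    rwa [← mul_assoc, ENNReal.inv_mul_cancel hJ2 hJ2t, one_mul] at this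
  refine (Finset.sum_le_sum fun i _ => h2 i).trans (le_of_eq ?_)
  rw [Finset.sum_const, Finset.card_univ, Fintype.card_fin, nsmul_eq_mul, hk]
  ring

/-- The roles of the exponents: `2(a + κ₁) < 1 + a` makes the square of the boundary term integrable
for `dσ`; `p < a` gives decay near the equator; `κ₂ < 1 + p` makes the time integral of `s^(p-κ₂)`
converge; `a ≤ 1 + p - κ₂` lets the weight `y₀^a` dominate what remains. -/
lemma exists_exponents {a : ℝ} (ha : a ∈ Ioo (-1 : ℝ) 1) : ∃ κ₁ κ₂ p : ℝ,
    0 < κ₁ ∧ κ₁ ≤ 1 ∧ 0 ≤ a + κ₁ ∧ 2 * (a + κ₁) < 1 + a ∧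
    0 < κ₂ ∧ -1 < p ∧ p ≤ 0 ∧ p < a ∧ κ₂ < 1 + p ∧ a ≤ 1 + p - κ₂ := by
  obtain ⟨h1, h2⟩ := ha
  rcases le_total 0 a with h | h
  · exact ⟨(1 - a) / 4, (1 - a) / 2, -((1 - a) / 4), by constructorm* _ ∧ _ <;> linarith⟩
  · exact ⟨(1 - 3 * a) / 4, (1 + a) / 2, a - (1 + a) / 4, by constructorm* _ ∧ _ <;> linarith⟩

lemma tendsto_ofReal_rpow_zero {e : ℝ} (he : 0 < e) :
    Tendsto (fun δ : ℝ => ENNReal.ofReal (δ ^ e)) (𝓝[>] 0) (𝓝 0) := by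
  have h : Tendsto (fun δ : ℝ => δ ^ e) (𝓝[>] 0) (𝓝 (0 ^ e)) :=
    ((Real.continuous_rpow_const he.le).tendsto 0).mono_left nhdsWithin_le_nhds
  rw [Real.zero_rpow he.ne'] at h
  simpa using ENNReal.tendsto_ofReal h

/-- The gradient does not concentrate at the equators of the half-spheres, uniformly with respect
to the radius. -/
lemma exists_gradient_tail_le {a R : ℝ} (ha : a ∈ Ioo (-1 : ℝ) 1) {V : Space N → ℝ}
    (hV : ContDiffOn ℝ 2 V (halfBall N R))
    (hf : ∀ ρ ∈ Ioo 0 R, MemLp (weightedLaplacian a V) 2 (weightedVolume a (halfBall N ρ)))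
    (hbd : ∃ ε₀ > 0, ∃ M : ℝ, ∀ Y ∈ halfBall N R, Y 0 < ε₀ → |(Y 0) ^ a * gradient V Y 0| ≤ M)
    {r₁ r₂ : ℝ} (h₁ : 0 < r₁) (h₁₂ : r₁ ≤ r₂) (h₂ : r₂ < R) {η : ℝ≥0∞} (hη : η ≠ 0) :
    ∃ δ > 0, ∀ r ∈ Icc r₁ r₂,
      ∫⁻ θ in {θ | θ 0 < δ}, ‖gradient V (r • θ)‖ₑ ^ 2 ∂(weightedSphere N a 1) ≤ η := by
  obtain ⟨ε, hε, M, hM⟩ := hbd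
  obtain ⟨κ₁, κ₂, p, k1, k2, k3, k4, k5, k6, k7, k8, k9, k10⟩ := exists_exponents ha
  have hr₂ : 0 < r₂ := h₁.trans_le h₁₂
  set ρ := (r₂ + R) / 2 with hρ
  have hρ0 : ρ ∈ Ioo 0 R := ⟨by rw [hρ]; linarith, by rw [hρ]; linarith⟩
  -- The time `c` is short enough for the balls to stay in `D_ρ`, below the height `ε` where `∂₀V`
  -- is controlled, and for the cap estimate to apply.
  obtain ⟨c, hc, hc1, hcr, hcε, hcρ⟩ : ∃ c > 0, c ≤ 1 ∧ c ≤ r₁ / 2 ∧ 3 * c ≤ ε ∧ r₂ + 2 * c < ρ := by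
    have h0 : 0 < (ρ - r₂) / 3 := by rw [hρ]; linarith
    refine ⟨min (min 1 (r₁ / 2)) (min (ε / 3) ((ρ - r₂) / 3)), by positivity, ?_, ?_, ?_, ?_⟩
    · exact (min_le_left _ _).trans (min_le_left _ _)
    · exact (min_le_left _ _).trans (min_le_right _ _)
    · have := (min_le_right (min 1 (r₁ / 2)) _).trans (min_le_left (ε / 3) ((ρ - r₂) / 3))
      linarith
    · have := (min_le_right (min 1 (r₁ / 2)) _).trans (min_le_right (ε / 3) ((ρ - r₂) / 3))
      linarith
  have hVρ := hV.mono (halfBall_mono (N := N) hρ0.2.le)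
  have hbd' : ∀ Y ∈ halfBall N ρ, Y 0 < ε → |gradient V Y 0| ≤ max M 0 * (Y 0) ^ (-a) := by
    intro Y hY hYε
    have h := hM Y (halfBall_mono hρ0.2.le hY) hYε
    have hpos := Real.rpow_pos_of_pos hY.1 a
    rw [abs_mul, abs_of_pos hpos] at h
    rw [Real.rpow_neg hY.1.le, ← div_eq_mul_inv, le_div_iff₀ hpos, mul_comm]
    exact h.trans (le_max_left _ _)
  obtain ⟨D, E, hD, hE, hDE⟩ := exists_gradient_sq_bound ha hVρ (le_max_right M 0) hbd' hc hc1 hcρ hcε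
    k1 k2 rfl k3 k5
  obtain ⟨C, hC, hCle⟩ := lintegral_lift_le N k6 k7 h₁ h₁₂ k9 hcr
  set b := a + κ₁ with hb
  set e := (1 + a - 2 * b) / 2 with he
  have he0 : 0 < e := by rw [he]; linarith
  set F : Space N → ℝ≥0∞ := (halfBall N ρ).indicator (fun Y => ‖weightedLaplacian a V Y‖ₑ ^ 2) with hF
  have hFm : Measurable F := by
    classical
    have hcont : ContinuousOn (fun Y => ‖weightedLaplacian a V Y‖ₑ ^ 2) (halfBall N ρ) :=
      ((ENNReal.continuous_pow 2).comp continuous_enorm).comp_continuousOn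
        (continuousOn_weightedLaplacian a hVρ)
    have := hcont.measurable_piecewise (g := 0) continuousOn_const (measurableSet_halfBall ρ)
    rwa [piecewise_eq_indicator] at this
  set I := ∫⁻ Y in {Y : Space N | 0 < Y 0}, ENNReal.ofReal ((Y 0) ^ (1 + p - κ₂)) * F Y with hI
  have hIt : I ≠ ⊤ := by
    have h1 : I ≤ ENNReal.ofReal (ρ ^ (1 + p - κ₂ - a)) *
        ∫⁻ Y, ‖weightedLaplacian a V Y‖ₑ ^ 2 ∂(weightedVolume a (halfBall N ρ)) := by
      have h2 : ∫⁻ Y, ‖weightedLaplacian a V Y‖ₑ ^ 2 ∂(weightedVolume a (halfBall N ρ)) =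
          ∫⁻ Y in halfBall N ρ, ENNReal.ofReal ((Y 0) ^ a) * F Y := by
        have h3 : ∫⁻ Y, ‖weightedLaplacian a V Y‖ₑ ^ 2 ∂(weightedVolume a (halfBall N ρ)) =
            ∫⁻ Y, F Y ∂(weightedVolume a (halfBall N ρ)) := by
          refine lintegral_congr_ae ?_
          filter_upwards [ae_mem_halfBall a ρ] with Y hY
          rw [hF, indicator_of_mem hY]
        rw [h3, weightedVolume, lintegral_withDensity_eq_lintegral_mul _ (measurable_weight a) hFm]
        rfl
      rw [h2, ← lintegral_const_mul' _ _ ENNReal.ofReal_ne_top, hI,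
        ← lintegral_indicator measurableSet_upper, ← lintegral_indicator (measurableSet_halfBall ρ)]
      refine lintegral_mono fun Y => ?_
      by_cases hY : Y ∈ halfBall N ρ
      · rw [indicator_of_mem hY, indicator_of_mem (show Y ∈ {Y : Space N | 0 < Y 0} from hY.1),
          ← mul_assoc, ← ENNReal.ofReal_mul (Real.rpow_nonneg hρ0.1.le _)]
        refine mul_le_mul_left (ENNReal.ofReal_le_ofReal ?_) _
        have hYρ : Y 0 ≤ ρ := (le_abs_self _).trans ((abs_coord_le Y 0).trans hY.2.le)
        calc (Y 0) ^ (1 + p - κ₂) = (Y 0) ^ (1 + p - κ₂ - a) * (Y 0) ^ a := by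
              rw [← Real.rpow_add hY.1, sub_add_cancel]
          _ ≤ _ := mul_le_mul_of_nonneg_right (Real.rpow_le_rpow hY.1.le hYρ (by linarith))
              (Real.rpow_nonneg hY.1.le _)
      · have : F Y = 0 := by rw [hF, indicator_of_notMem hY]
        by_cases hY0 : Y ∈ {Y : Space N | 0 < Y 0}
        · rw [indicator_of_mem hY0, this, mul_zero]; exact zero_le
        · rw [indicator_of_notMem hY0]; exact zero_le
    exact ((h1.trans_lt (ENNReal.mul_lt_top ENNReal.ofReal_lt_top
      (MemLp.lintegral_sq_lt_top (hf ρ hρ0)))).ne)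
  -- Half of the slack `1 + a - 2b` is given away as `e`: the exponent `a - 2b - e` is still above
  -- `-1`, and the factor `δ^e` is gained.
  set A₁ := D * ENNReal.ofReal (r₁ ^ (-(2 * b))) * weightedSphere N (a - 2 * b - e) 1 univ with hA₁
  have hA₁t : A₁ ≠ ⊤ := ENNReal.mul_ne_top (ENNReal.mul_ne_top hD ENNReal.ofReal_ne_top)
    (weightedSphere_univ_lt_top N (by rw [he]; linarith)).ne
  have hA₂t : E * (C * I) ≠ ⊤ := ENNReal.mul_ne_top hE (ENNReal.mul_ne_top hC hIt)
  -- The condition `r₂ δ ≤ c` places all points `rθ` with `θ₀ < δ` below the height `c`, where the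
  -- pointwise bound holds.
  have hmain : ∀ δ > 0, r₂ * δ ≤ c → ∀ r ∈ Icc r₁ r₂,
      ∫⁻ θ in {θ | θ 0 < δ}, ‖gradient V (r • θ)‖ₑ ^ 2 ∂(weightedSphere N a 1) ≤
        A₁ * ENNReal.ofReal (δ ^ e) + E * (C * I) * ENNReal.ofReal (δ ^ (a - p)) := by
    intro δ hδ hδc r hr
    have hr0 : 0 < r := h₁.trans_le hr.1
    have hSm : MeasurableSet {θ : Space N | θ 0 < δ} :=
      measurableSet_lt (measurable_coord 0) measurable_const
    set Ψ : Space N → ℝ≥0∞ := fun X => ∫⁻ s in Ioc 0 c, ∫⁻ z in Metric.closedBall (0 : Space N) 1,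
      ENNReal.ofReal (s ^ (1 - κ₂)) * F (lift X s z) with hΨ
    calc _ ≤ ∫⁻ θ in {θ | θ 0 < δ}, (D * ENNReal.ofReal (r₁ ^ (-(2 * b))) *
          ENNReal.ofReal ((θ 0) ^ (-(2 * b))) + E * Ψ (r • θ)) ∂(weightedSphere N a 1) := by
          refine lintegral_mono_ae ?_
          filter_upwards [ae_restrict_of_ae (ae_weightedSphere_one N a), ae_restrict_mem hSm]
            with θ hθ hθδ
          have hX : (r • θ) 0 = r * θ 0 := by simp
          have hθδ' : θ 0 < δ := hθδ
          refine (hDE (r • θ) (by rw [hX]; exact mul_pos hr0 hθ.2) ?_ ?_).trans ?_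
          · rw [hX]
            calc r * θ 0 ≤ r₂ * θ 0 := mul_le_mul_of_nonneg_right hr.2 hθ.2.le
              _ < r₂ * δ := mul_lt_mul_of_pos_left hθδ' hr₂
              _ ≤ c := hδc
          · rw [norm_smul, hθ.1, mul_one, Real.norm_of_nonneg hr0.le]
            exact hr.2
          · refine add_le_add_left ?_ _
            rw [mul_assoc, ← ENNReal.ofReal_mul (by positivity), hX, Real.mul_rpow hr0.le hθ.2.le]
            refine mul_le_mul_right (ENNReal.ofReal_le_ofReal (mul_le_mul_of_nonneg_right
              (Real.rpow_le_rpow_of_nonpos h₁ hr.1 (by linarith)) (Real.rpow_nonneg hθ.2.le _))) _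
      _ = D * ENNReal.ofReal (r₁ ^ (-(2 * b))) * weightedSphere N (a - 2 * b) 1 {θ | θ 0 < δ} +
          E * ∫⁻ θ in {θ | θ 0 < δ}, Ψ (r • θ) ∂(weightedSphere N a 1) := by
          rw [lintegral_add_left ((measurable_weight _).const_mul _),
            lintegral_const_mul _ (measurable_weight _), lintegral_weight_mul _ _ hSm,
            lintegral_const_mul' _ _ hE, ← sub_eq_add_neg]
      _ ≤ _ := by
          refine add_le_add ?_ ?_
          · rw [hA₁, mul_assoc (D * _)]
            refine mul_le_mul_right ?_ _
            have h1 := restrict_weightedSphere_le (N := N) (a := a - 2 * b) (q := a - 2 * b - e)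
              (δ := δ) (by linarith) univ
            rw [Measure.restrict_apply_univ, Measure.smul_apply, Measure.restrict_apply_univ,
              sub_sub_cancel, smul_eq_mul, mul_comm (ENNReal.ofReal (δ ^ e))] at h1
            exact h1.trans (mul_le_mul_left (measure_mono (subset_univ _)) _)
          · rw [mul_assoc E]
            refine mul_le_mul_right ?_ _
            calc ∫⁻ θ in {θ | θ 0 < δ}, Ψ (r • θ) ∂(weightedSphere N a 1)
                ≤ ENNReal.ofReal (δ ^ (a - p)) *
                  ∫⁻ θ in {θ | θ 0 < δ}, Ψ (r • θ) ∂(weightedSphere N p 1) := by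
                  rw [← smul_eq_mul, ← lintegral_smul_measure]
                  exact lintegral_mono' (restrict_weightedSphere_le k8.le) le_rfl
              _ ≤ ENNReal.ofReal (δ ^ (a - p)) * (C * I) :=
                  mul_le_mul_right ((setLIntegral_le_lintegral _ _).trans (hCle F hFm r hr)) _
              _ = _ := mul_comm _ _
  have hlim : Tendsto (fun δ : ℝ => A₁ * ENNReal.ofReal (δ ^ e) +
      E * (C * I) * ENNReal.ofReal (δ ^ (a - p))) (𝓝[>] 0) (𝓝 0) := by
    have t1 := ENNReal.Tendsto.const_mul (tendsto_ofReal_rpow_zero he0) (Or.inr hA₁t)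
    have t2 := ENNReal.Tendsto.const_mul (tendsto_ofReal_rpow_zero (sub_pos.2 k8)) (Or.inr hA₂t)
    simpa using t1.add t2
  obtain ⟨δ, ⟨hδ, hδc⟩, hδ0⟩ := ((hlim.eventually (ge_mem_nhds (pos_iff_ne_zero.2 hη))).and
    ((eventually_le_nhds (div_pos hc hr₂)).filter_mono nhdsWithin_le_nhds)
    |>.and self_mem_nhdsWithin).exists
  refine ⟨δ, hδ0, fun r hr => (hmain δ hδ0 ?_ r hr).trans hδ⟩
  rwa [le_div_iff₀ hr₂, mul_comm] at hδc

/-! ### Sobolev gradients and traces of `C¹` functions -/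

/-- On compact subsets of a half-ball, the Lebesgue measure is controlled by the weighted one. -/
lemma exists_restrict_le_weightedVolume (a : ℝ) {ρ : ℝ} {K : Set (Space N)} (hK : IsCompact K)
    (hKρ : K ⊆ halfBall N ρ) :
    ∃ C : ℝ≥0∞, C ≠ ⊤ ∧ volume.restrict K ≤ C • weightedVolume a (halfBall N ρ) := by
  have hc : ContinuousOn (fun Y : Space N => (Y 0) ^ (-a)) K := by
    have h0 : Continuous fun Y : Space N => Y 0 := by fun_prop
    exact h0.continuousOn.rpow_const fun Y hY => Or.inl (hKρ hY).1.ne'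
  obtain ⟨B, hB⟩ := hK.exists_bound_of_continuousOn hc
  refine ⟨ENNReal.ofReal B, ENNReal.ofReal_ne_top, Measure.le_iff.2 fun T hT => ?_⟩
  rw [Measure.restrict_apply hT, Measure.smul_apply, weightedVolume, withDensity_apply _ hT,
    Measure.restrict_restrict hT, smul_eq_mul, ← lintegral_const_mul _ (measurable_weight a)]
  calc volume (T ∩ K) = ∫⁻ _ in T ∩ K, 1 := by simp
    _ ≤ ∫⁻ Y in T ∩ K, ENNReal.ofReal B * ENNReal.ofReal ((Y 0) ^ a) := by
      refine setLIntegral_mono' (hT.inter hK.measurableSet) fun Y hY => ?_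
      have hY0 := (hKρ hY.2).1
      have h1 := hB Y hY.2
      rw [Real.norm_of_nonneg (Real.rpow_nonneg hY0.le _), Real.rpow_neg hY0.le] at h1
      have h2 := Real.rpow_pos_of_pos hY0 a
      rw [← ENNReal.ofReal_mul ((inv_nonneg.2 h2.le).trans h1), ENNReal.one_le_ofReal]
      calc (1 : ℝ) = (Y 0 ^ a)⁻¹ * Y 0 ^ a := (inv_mul_cancel₀ h2.ne').symm
        _ ≤ _ := mul_le_mul_of_nonneg_right h1 h2.le
    _ ≤ _ := lintegral_mono_set (inter_subset_inter_right T hKρ)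

/-- Integration by parts against a compactly supported function. -/
lemma integral_mul_fderiv_eq_neg {Ω : Set (Space N)} (hΩ : IsOpen Ω) {k g : Space N → ℝ}
    (hk : ContDiff ℝ 1 k) (hkc : HasCompactSupport k) (hks : tsupport k ⊆ Ω)
    (hg : ContDiffOn ℝ 1 g Ω) (v : Space N) :
    ∫ Y, k Y * fderiv ℝ g Y v = -∫ Y, fderiv ℝ k Y v * g Y := by
  have hk0 : ∀ z, z ∉ tsupport k → k z = 0 := fun z hz => image_eq_zero_of_notMem_tsupport hz
  have hk'0 : ∀ z, z ∉ tsupport k → fderiv ℝ k z v = 0 := fun z hz => by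
    rw [image_eq_zero_of_notMem_tsupport fun h => hz (tsupport_fderiv_subset ℝ h)]
    rfl
  have hk'c : Continuous fun z => fderiv ℝ k z v :=
    (hk.continuous_fderiv one_ne_zero).clm_apply continuous_const
  have hint {u w : Space N → ℝ} (hu : Continuous u) (hw : ContinuousOn w Ω)
      (h0 : ∀ z, z ∉ tsupport k → u z = 0) : Integrable (fun z => u z * w z) := by
    refine IntegrableOn.integrable_of_forall_notMem_eq_zero
      ((hu.continuousOn.mul (hw.mono hks)).integrableOn_compact hkc) fun z hz => ?_
    rw [h0 z hz, zero_mul]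
  exact integral_bilinear_hasFDerivAt_right_eq_neg_left_of_integrable (μ := volume) (v := v)
    (B := ContinuousLinearMap.mul ℝ ℝ) (f := k) (f' := fun z => fderiv ℝ k z)
    (g := g) (g' := fun z => fderiv ℝ g z)
    (hint hk'c hg.continuousOn hk'0)
    (hint hk.continuous ((hg.continuousOn_fderiv_of_isOpen hΩ le_rfl).clm_apply continuousOn_const) hk0)
    (hint hk.continuous hg.continuousOn hk0)
    (fun z _ => (hk.differentiable one_ne_zero z).hasFDerivAt)
    (fun z hz => ((hg.differentiableOn one_ne_zero).differentiableAt
      (hΩ.mem_nhds (hks hz))).hasFDerivAt)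

/-- The weak gradient of a `C¹` function is its gradient. -/
lemma HasH1Gradient.ae_eq_gradient {a ρ : ℝ} {V : Space N → ℝ} {G : Space N → Space N}
    (h : HasH1Gradient a (halfBall N ρ) V G) (hV : ContDiffOn ℝ 1 V (halfBall N ρ)) :
    G =ᵐ[weightedVolume a (halfBall N ρ)] gradient V := by
  obtain ⟨hV2, hG2, φ, hφ⟩ := h
  set Ω := halfBall N ρ with hΩ
  have hΩo : IsOpen Ω := isOpen_halfBall ρ
  have hgc := continuousOn_gradient hΩo hV
  have key : ∀ i : Fin (N + 1), ∀ᵐ Y : Space N, Y ∈ Ω →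
      inner ℝ (basisVec i) (G Y) - inner ℝ (basisVec i) (gradient V Y) = 0 := by
    intro i
    -- Fundamental lemma of the calculus of variations: both fields have the same integrals against
    -- smooth test functions. The weight is harmless on the compact support of a test function.
    refine hΩo.ae_eq_zero_of_integral_contDiff_smul_eq_zero ?_ ?_
    · rw [locallyIntegrableOn_iff hΩo.isLocallyClosed]
      intro K hKΩ hK
      obtain ⟨C, hC, hle⟩ := exists_restrict_le_weightedVolume a hK hKΩ
      have : IsFiniteMeasure (volume.restrict K) := ⟨by
        rw [Measure.restrict_apply_univ]; exact hK.measure_lt_top⟩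
      have h1 : MemLp G 2 (volume.restrict K) := hG2.of_measure_le_smul hC hle
      have h2 : IntegrableOn (fun Y => inner ℝ (basisVec i) (gradient V Y)) K :=
        (continuousOn_const.inner (𝕜 := ℝ) (hgc.mono hKΩ)).integrableOn_compact hK
      exact ((h1.integrable (by norm_num)).const_inner (𝕜 := ℝ) (basisVec i)).sub h2
    · intro k hk hkc hks
      obtain ⟨C, hC, hle⟩ := exists_restrict_le_weightedVolume a hkc hks
      set K := tsupport k with hKdef
      set μ := volume.restrict K with hμ
      have hkc1 : ContDiff ℝ 1 k := hk.of_le (by exact_mod_cast le_top)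
      have hm {E : Type} [NormedAddCommGroup E] {u : Space N → E}
          (hu : MemLp u 2 (weightedVolume a Ω)) : MemLp u 2 μ := hu.of_measure_le_smul hC hle
      have hlim {E : Type} [NormedAddCommGroup E] {u : ℕ → Space N → E}
          (hu : Tendsto (fun n => ∫⁻ Y, ‖u n Y‖ₑ ^ 2 ∂(weightedVolume a Ω)) atTop (𝓝 0)) :
          Tendsto (fun n => ∫⁻ Y, ‖u n Y‖ₑ ^ 2 ∂μ) atTop (𝓝 0) := by
        have h1 := ENNReal.Tendsto.const_mul hu (Or.inr hC)
        rw [mul_zero] at h1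
        refine tendsto_of_tendsto_of_tendsto_of_le_of_le tendsto_const_nhds h1 (fun _ => zero_le)
          fun n => ?_
        rw [← smul_eq_mul, ← lintegral_smul_measure]
        exact lintegral_mono' hle le_rfl
      have hcm {E : Type} [NormedAddCommGroup E] {u : Space N → E} (hu : Continuous u)
          (hu0 : HasCompactSupport u) : MemLp u 2 μ :=
        (hu.memLp_of_hasCompactSupport hu0).restrict _
      have hke : MemLp (fun Y => k Y • (basisVec i : Space N)) 2 μ :=
        hcm (hk.continuous.smul continuous_const) hkc.smul_right
      have hk' : Continuous fun Y => fderiv ℝ k Y (basisVec i) :=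
        (hkc1.continuous_fderiv one_ne_zero).clm_apply continuous_const
      have hk's : HasCompactSupport fun Y => fderiv ℝ k Y (basisVec i) :=
        hkc.fderiv_apply ℝ (basisVec i)
      have t1 := tendsto_integral_inner (μ := μ) (l := atTop) (f := fun _ : ℕ => fun Y =>
          k Y • (basisVec i : Space N)) (g := fun n => gradient (φ n))
        (Eventually.of_forall fun n => hke) (Eventually.of_forall fun n => hm (hφ.1 n).2.2) hke (hm hG2)
        (by simp) (hlim (tendsto_eLpNorm_two_iff.1 hφ.2.2))
      have t2 := tendsto_integral_inner (μ := μ) (l := atTop) (f := fun _ : ℕ => fun Y =>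
          fderiv ℝ k Y (basisVec i)) (g := fun n => φ n)
        (Eventually.of_forall fun n => hcm hk' hk's) (Eventually.of_forall fun n => hm (hφ.1 n).2.1)
        (hcm hk' hk's) (hm hV2) (by simp) (hlim (tendsto_eLpNorm_two_iff.1 hφ.2.1))
      have hset {F : Space N → ℝ} (hF : ∀ z, z ∉ K → F z = 0) : ∫ z in K, F z = ∫ z, F z :=
        setIntegral_eq_integral_of_forall_compl_eq_zero hF
      have hk0 : ∀ z, z ∉ K → k z = 0 := fun z hz => image_eq_zero_of_notMem_tsupport hz
      have hk'0 : ∀ z, z ∉ K → fderiv ℝ k z (basisVec i) = 0 := fun z hz => by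
        rw [image_eq_zero_of_notMem_tsupport fun h => hz (tsupport_fderiv_subset ℝ h)]
        rfl
      have hparts {g : Space N → ℝ} (hg : ContDiffOn ℝ 1 g Ω) :
          ∫ Y in K, inner ℝ (k Y • basisVec i) (gradient g Y) =
            -∫ Y in K, inner ℝ (fderiv ℝ k Y (basisVec i)) (g Y) := by
        rw [hset fun z hz => by rw [hk0 z hz, zero_smul, inner_zero_left],
          hset fun z hz => by rw [hk'0 z hz, inner_zero_left]]
        have e1 : ∀ Y, inner ℝ (k Y • basisVec i) (gradient g Y) =
            k Y * fderiv ℝ g Y (basisVec i) := fun Y => by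
          rw [real_inner_smul_left, real_inner_comm, basisVec_inner, gradient_coord]
        have e2 : ∀ Y, inner ℝ (fderiv ℝ k Y (basisVec i)) (g Y) =
            fderiv ℝ k Y (basisVec i) * g Y := fun Y => by
          rw [real_inner_comm]
          rfl
        simp only [e1, e2]
        exact integral_mul_fderiv_eq_neg hΩo hkc1 hkc hks hg (basisVec i)
      -- Integration by parts for the smooth approximants passes to the limit, and `V` satisfies the
      -- same formula classically.
      have h3 : ∫ Y in K, inner ℝ (k Y • basisVec i) (G Y) =
          ∫ Y in K, inner ℝ (k Y • basisVec i) (gradient V Y) := by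
        rw [hparts hV]
        refine tendsto_nhds_unique t1 ?_
        refine t2.neg.congr fun n => ?_
        exact (hparts (hφ.contDiffOn n)).symm
      have i1 : IntegrableOn (fun Y => inner ℝ (k Y • basisVec i) (G Y)) K := by
        have h4 := (hcm hk.continuous hkc).integrable_mul ((hm hG2).const_inner (𝕜 := ℝ) (basisVec i))
        refine h4.congr (ae_of_all _ fun Y => ?_)
        simp only [Pi.mul_apply, real_inner_smul_left]
      have i2 : IntegrableOn (fun Y => inner ℝ (k Y • basisVec i) (gradient V Y)) K :=
        (((hk.continuous.smul continuous_const).continuousOn).inner (𝕜 := ℝ)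
          (hgc.mono hks)).integrableOn_compact hkc
      rw [← hset fun z hz => by rw [hk0 z hz, zero_smul]]
      have : ∀ Y, k Y • (inner ℝ (basisVec i) (G Y) - inner ℝ (basisVec i) (gradient V Y)) =
          inner ℝ (k Y • basisVec i) (G Y) - inner ℝ (k Y • basisVec i) (gradient V Y) := fun Y => by
        rw [real_inner_smul_left, real_inner_smul_left, smul_eq_mul, mul_sub]
      simp only [this]
      rw [integral_sub i1 i2, h3, sub_self]
  have h2 := (weightedVolume_absolutelyContinuous a Ω).ae_le
    (ae_restrict_of_ae (s := Ω) (ae_all_iff.2 key))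
  filter_upwards [h2, ae_mem_halfBall a ρ] with Y hY hYΩ
  ext i
  have := sub_eq_zero.1 (hY i hYΩ)
  rwa [real_inner_comm, basisVec_inner, real_inner_comm, basisVec_inner] at this

lemma SmoothApprox.congr_gradient {a : ℝ} {Ω : Set (Space N)} {φ : ℕ → Space N → ℝ}
    {V : Space N → ℝ} {G G' : Space N → Space N} (h : SmoothApprox a Ω φ V G)
    (hG : G =ᵐ[weightedVolume a Ω] G') : SmoothApprox a Ω φ V G' := by
  refine ⟨h.1, h.2.1, h.2.2.congr fun n => eLpNorm_congr_ae ?_⟩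
  filter_upwards [hG] with Y hY
  rw [hY]

/-- A field known almost everywhere says nothing on an individual half-sphere, so at every radius
the pointwise gradient must replace `G`. -/
lemma HasH1LocGradient.of_contDiffOn {a R : ℝ} {V : Space N → ℝ} {G : Space N → Space N}
    (h : HasH1LocGradient a R V G) (hV : ContDiffOn ℝ 1 V (halfBall N R)) :
    HasH1LocGradient a R V (gradient V) := by
  intro ρ hρ
  have hG := (h ρ hρ).ae_eq_gradient (hV.mono (halfBall_mono hρ.2.le))
  obtain ⟨h1, h2, φ, hφ⟩ := h ρ hρ
  exact ⟨h1, h2.ae_eq hG, φ, hφ.congr_gradient hG⟩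

lemma IsTrace.of_contDiffOn {a R r : ℝ} (hr : 0 < r) {V : Space N → ℝ} {G : Space N → Space N}
    {u : Space N → ℝ} (hu : IsTrace a R V G r u)
    (h : HasH1LocGradient a R V G) (hV : ContDiffOn ℝ 1 V (halfBall N R)) :
    IsTrace a R V (gradient V) r u := by
  obtain ⟨hu1, ρ, hρ, φ, hφ, hlim⟩ := hu
  exact ⟨hu1, ρ, hρ, φ, hφ.congr_gradient ((h ρ ⟨hr.trans hρ.1, hρ.2⟩).ae_eq_gradient
    (hV.mono (halfBall_mono hρ.2.le))), hlim⟩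

lemma lintegral_enorm_sub_sq_comm {α E : Type*} [MeasurableSpace α] (μ : Measure α)
    [NormedAddCommGroup E] (f g : α → E) :
    ∫⁻ x, ‖f x - g x‖ₑ ^ 2 ∂μ = ∫⁻ x, ‖g x - f x‖ₑ ^ 2 ∂μ := by
  simp_rw [← edist_eq_enorm_sub, edist_comm]

/-- Limits in `L²` are unique. -/
lemma ae_eq_of_tendsto_lintegral_sub {α ι E : Type*} [MeasurableSpace α] {μ : Measure α}
    [NormedAddCommGroup E] {l : Filter ι} [l.NeBot] {f : ι → α → E} {u v : α → E}
    (hf : ∀ᶠ i in l, AEStronglyMeasurable (f i) μ) (hu : AEStronglyMeasurable u μ)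
    (hv : AEStronglyMeasurable v μ)
    (h1 : Tendsto (fun i => ∫⁻ x, ‖f i x - u x‖ₑ ^ 2 ∂μ) l (𝓝 0))
    (h2 : Tendsto (fun i => ∫⁻ x, ‖f i x - v x‖ₑ ^ 2 ∂μ) l (𝓝 0)) : u =ᵐ[μ] v := by
  have hz : ∫⁻ x, ‖u x - v x‖ₑ ^ 2 ∂μ = 0 := by
    refine le_antisymm ?_ zero_le
    have h3 := ENNReal.Tendsto.const_mul (a := 2) (h1.add h2) (Or.inr (by simp))
    rw [add_zero, mul_zero] at h3
    refine ge_of_tendsto h3 ?_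
    filter_upwards [hf] with i hi
    have e := lintegral_enorm_add_sq_le (μ := μ) (f := fun x => u x - f i x)
      (g := fun x => f i x - v x) (hu.sub hi)
    simp only [sub_add_sub_cancel] at e
    rwa [lintegral_enorm_sub_sq_comm μ u (f i)] at e
  have hm : AEMeasurable (fun x => ‖u x - v x‖ₑ ^ 2) μ := (hu.sub hv).enorm.pow_const 2
  rw [lintegral_eq_zero_iff' hm] at hz
  filter_upwards [hz] with x hx
  simpa [sub_eq_zero] using hx

/-- The trace of a `C¹` function on every half-sphere is its restriction. -/
lemma IsTrace.ae_eq_of_contDiffOn {a R r : ℝ} (hr : r ∈ Ioo 0 R) {V : Space N → ℝ}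
    {u : Space N → ℝ} (hu : IsTrace a R V (gradient V) r u)
    (hVg : HasH1LocGradient a R V (gradient V)) (hV : ContDiffOn ℝ 1 V (halfBall N R)) :
    (fun θ => V (r • θ)) =ᵐ[weightedSphere N a 1] fun θ => u (r • θ) := by
  obtain ⟨ρ, hrρ, hρR⟩ := exists_between hr.2
  obtain ⟨hV1, hG1, φ, hφ⟩ := hVg ρ ⟨hr.1.trans hrρ, hρR⟩
  have hVρ := hV.mono (halfBall_mono (N := N) hρR.le)
  obtain ⟨C, hC, hle⟩ := lintegral_sphere_sub_le N a (r₁ := r / 2) (r₂ := r) (half_pos hr.1)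
    (half_lt_self hr.1) hrρ
  have h1 := hu.tendsto hr.1 hrρ hρR hVg hφ.contDiffOn hφ.tendsto_sq
  have h2 : Tendsto (fun n => ∫⁻ θ, ‖φ n (r • θ) - V (r • θ)‖ₑ ^ 2 ∂(weightedSphere N a 1))
      atTop (𝓝 0) := by
    have h3 := ENNReal.Tendsto.const_mul hφ.tendsto_sq (Or.inr hC)
    rw [mul_zero] at h3
    refine tendsto_of_tendsto_of_tendsto_of_le_of_le tendsto_const_nhds h3 (fun _ => zero_le)
      fun n => ?_
    have := hle V (gradient V) hV1.1 hG1.1 (φ n) V (hφ.contDiffOn n) hVρ r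
      ⟨(half_lt_self hr.1).le, le_rfl⟩
    simpa using this
  exact ae_eq_of_tendsto_lintegral_sub (Eventually.of_forall fun n =>
    aestronglyMeasurable_sphere_of_continuousOn a (hφ.contDiffOn n).continuousOn ⟨hr.1, hrρ⟩)
    (aestronglyMeasurable_sphere_of_continuousOn a hVρ.continuousOn ⟨hr.1, hrρ⟩)
    (hu.memLp hr.1).1 h2 h1

/-! ### Uniform tails and continuity in the radius -/

lemma exists_bound_sphere {E : Type*} [NormedAddCommGroup E] {F : Space N → E} {R r₁ r₂ δ : ℝ}
    (hF : ContinuousOn F (halfBall N R)) (h₁ : 0 < r₁) (h₂ : r₂ < R) (hδ : 0 < δ) :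
    ∃ L : ℝ, ∀ r ∈ Icc r₁ r₂, ∀ θ : Space N, ‖θ‖ = 1 → δ ≤ θ 0 → ‖F (r • θ)‖ ≤ L := by
  obtain ⟨L, hL⟩ : ∃ L, ∀ Y ∈ {Y : Space N | r₁ * δ ≤ Y 0 ∧ ‖Y‖ ≤ r₂}, ‖F Y‖ ≤ L := by
    refine IsCompact.exists_bound_of_continuousOn (Metric.isCompact_of_isClosed_isBounded ?_ ?_)
      (hF.mono ?_)
    · have h1 : Continuous fun Y : Space N => Y 0 := by fun_prop
      exact (isClosed_le continuous_const h1).inter (isClosed_le continuous_norm continuous_const)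
    · exact Metric.isBounded_closedBall (x := (0 : Space N)) (r := r₂) |>.subset
        fun Y hY => by simpa using hY.2
    · exact fun Y hY => ⟨(mul_pos h₁ hδ).trans_le hY.1, hY.2.trans_lt h₂⟩
  refine ⟨L, fun r hr θ hθ hθδ => hL _ ⟨?_, ?_⟩⟩
  · have : (r • θ) 0 = r * θ 0 := by simp
    rw [this]
    exact mul_le_mul hr.1 hθδ hδ.le (h₁.le.trans hr.1)
  · rw [norm_smul, hθ, mul_one, Real.norm_of_nonneg (h₁.le.trans hr.1)]
    exact hr.2

/-- The functions `θ ↦ F (r θ)` do not concentrate at the equator, locally uniformly in `r`. -/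
def UniformTail {E : Type*} [NormedAddCommGroup E] (a R : ℝ) (F : Space N → E) : Prop :=
  ∀ r₁ r₂ : ℝ, 0 < r₁ → r₁ ≤ r₂ → r₂ < R → ∀ η : ℝ≥0∞, η ≠ 0 → ∃ δ > 0, ∀ r ∈ Icc r₁ r₂,
    ∫⁻ θ in {θ | θ 0 < δ}, ‖F (r • θ)‖ₑ ^ 2 ∂(weightedSphere N a 1) ≤ η

section UniformTail

variable {E : Type*} [NormedAddCommGroup E] {F : Space N → E} {a R : ℝ}

lemma measurableSet_coord_lt (δ : ℝ) : MeasurableSet {θ : Space N | θ 0 < δ} :=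
  measurableSet_lt (measurable_coord 0) measurable_const

/-- The tail is bounded by hypothesis; away from the equator, continuity on a compact set and the
finite mass of the sphere suffice. -/
lemma UniformTail.exists_lintegral_le (ha : -1 < a) (hT : UniformTail a R F)
    (hF : ContinuousOn F (halfBall N R)) {r₁ r₂ : ℝ} (h₁ : 0 < r₁) (h₁₂ : r₁ ≤ r₂) (h₂ : r₂ < R) :
    ∃ K : ℝ≥0∞, K ≠ ⊤ ∧ ∀ r ∈ Icc r₁ r₂, ∫⁻ θ, ‖F (r • θ)‖ₑ ^ 2 ∂(weightedSphere N a 1) ≤ K := by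
  obtain ⟨δ, hδ, hle⟩ := hT r₁ r₂ h₁ h₁₂ h₂ 1 one_ne_zero
  obtain ⟨L, hL⟩ := exists_bound_sphere hF h₁ h₂ hδ
  refine ⟨1 + ENNReal.ofReal (L ^ 2) * weightedSphere N a 1 univ, ENNReal.add_ne_top.2
    ⟨ENNReal.one_ne_top, ENNReal.mul_ne_top ENNReal.ofReal_ne_top
      (weightedSphere_univ_lt_top N ha).ne⟩, fun r hr => ?_⟩
  rw [← lintegral_add_compl _ (measurableSet_coord_lt δ)]
  refine add_le_add (hle r hr) ?_
  calc _ ≤ ∫⁻ θ in {θ : Space N | θ 0 < δ}ᶜ, ENNReal.ofReal (L ^ 2) ∂(weightedSphere N a 1) := by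
        refine lintegral_mono_ae ?_
        filter_upwards [ae_restrict_of_ae (ae_weightedSphere_one N a),
          ae_restrict_mem (measurableSet_coord_lt δ).compl] with θ hθ hθδ
        rw [enorm_sq_eq_ofReal]
        exact ENNReal.ofReal_le_ofReal (pow_le_pow_left₀ (norm_nonneg _)
          (hL r hr θ hθ.1 (not_lt.1 hθδ)) 2)
    _ ≤ _ := by
        rw [setLIntegral_const]
        exact mul_le_mul_right (measure_mono (subset_univ _)) _

lemma UniformTail.memLp [SecondCountableTopology E] (ha : -1 < a) (hT : UniformTail a R F)
    (hF : ContinuousOn F (halfBall N R)) {r : ℝ} (hr : r ∈ Ioo 0 R) :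
    MemLp (fun θ => F (r • θ)) 2 (weightedSphere N a 1) := by
  obtain ⟨K, hK, hle⟩ := hT.exists_lintegral_le ha hF hr.1 le_rfl hr.2
  rw [memLp_two_iff (aestronglyMeasurable_sphere_of_continuousOn a hF hr)]
  exact (hle r ⟨le_rfl, le_rfl⟩).trans_lt hK.lt_top

/-- Continuity in `L²` of the restrictions to the half-spheres. -/
lemma UniformTail.tendsto [SecondCountableTopology E] (ha : -1 < a) (hT : UniformTail a R F)
    (hF : ContinuousOn F (halfBall N R)) {r : ℝ} (hr : r ∈ Ioo 0 R) :
    Tendsto (fun s => ∫⁻ θ, ‖F (s • θ) - F (r • θ)‖ₑ ^ 2 ∂(weightedSphere N a 1)) (𝓝 r) (𝓝 0) := by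
  obtain ⟨r₂, hr₂, hr₂R⟩ := exists_between hr.2
  have hr₁ : 0 < r / 2 := half_pos hr.1
  have hr₁r : r / 2 < r := half_lt_self hr.1
  have hnear : ∀ᶠ s in 𝓝 r, s ∈ Icc (r / 2) r₂ := Icc_mem_nhds hr₁r hr₂
  have hrI : r ∈ Icc (r / 2) r₂ := ⟨hr₁r.le, hr₂.le⟩
  have hI : ∀ s ∈ Icc (r / 2) r₂, s ∈ Ioo 0 R := fun s hs => ⟨hr₁.trans_le hs.1, hs.2.trans_lt hr₂R⟩
  have hm : ∀ s ∈ Icc (r / 2) r₂, AEStronglyMeasurable (fun θ => F (s • θ)) (weightedSphere N a 1) :=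
    fun s hs => aestronglyMeasurable_sphere_of_continuousOn a hF (hI s hs)
  have hfin := isFiniteMeasure_weightedSphere N ha
  rw [ENNReal.tendsto_nhds_zero]
  intro ε hε
  -- The two tails contribute `2(ε/8 + ε/8)`, and the part away from the equator at most `4 · ε/8`.
  have hη : ε / 8 ≠ 0 := (ENNReal.div_pos hε.ne' (by simp)).ne'
  obtain ⟨δ, hδ, hle⟩ := hT (r / 2) r₂ hr₁ (hr₁r.trans hr₂).le hr₂R (ε / 8) hη
  obtain ⟨L, hL⟩ := exists_bound_sphere hF hr₁ hr₂R hδ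
  set S := {θ : Space N | θ 0 < δ} with hS
  have hSm : MeasurableSet S := measurableSet_coord_lt δ
  -- Away from the equator `F` is bounded, so dominated convergence applies.
  have hlim : Tendsto (fun s => ∫⁻ θ in Sᶜ, ‖F (s • θ) - F (r • θ)‖ₑ ^ 2 ∂(weightedSphere N a 1))
      (𝓝 r) (𝓝 (∫⁻ _ in Sᶜ, 0 ∂(weightedSphere N a 1))) := by
    refine tendsto_lintegral_filter_of_dominated_convergence'
      (fun _ => ENNReal.ofReal ((L + L) ^ 2)) ?_ ?_ ?_ ?_
    · filter_upwards [hnear] with s hs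
      exact (((hm s hs).sub (hm r hrI)).enorm.pow_const 2).restrict
    · filter_upwards [hnear] with s hs
      filter_upwards [ae_restrict_of_ae (ae_weightedSphere_one N a), ae_restrict_mem hSm.compl]
        with θ hθ hθδ
      rw [enorm_sq_eq_ofReal]
      refine ENNReal.ofReal_le_ofReal (pow_le_pow_left₀ (norm_nonneg _) ((norm_sub_le _ _).trans ?_) 2)
      exact add_le_add (hL s hs θ hθ.1 (not_lt.1 hθδ)) (hL r hrI θ hθ.1 (not_lt.1 hθδ))
    · rw [lintegral_const]
      exact ENNReal.mul_ne_top ENNReal.ofReal_ne_top (measure_ne_top _ _)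
    · filter_upwards [ae_restrict_of_ae (ae_weightedSphere_one N a)] with θ hθ
      have h1 : ContinuousAt (fun s : ℝ => F (s • θ)) r :=
        (continuousOn_ray hF hθ).continuousAt (isOpen_Ioo.mem_nhds hr)
      have h2 := ENNReal.Tendsto.pow (n := 2) (h1.tendsto.sub_const (F (r • θ))).enorm
      simpa using h2
  rw [lintegral_zero] at hlim
  filter_upwards [hnear, hlim.eventually (ge_mem_nhds (pos_iff_ne_zero.2
    (mul_ne_zero (four_ne_zero' ℝ≥0∞) hη)))] with s hs hsS
  rw [← lintegral_add_compl _ hSm]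
  have h1 := lintegral_enorm_add_sq_le (μ := (weightedSphere N a 1).restrict S)
    (f := fun θ => F (s • θ)) (g := fun θ => -F (r • θ)) (hm s hs).restrict
  simp only [← sub_eq_add_neg, enorm_neg] at h1
  calc _ ≤ 2 * (ε / 8 + ε / 8) + 4 * (ε / 8) :=
        add_le_add (h1.trans (mul_le_mul_right (add_le_add (hle s hs) (hle r hrI)) _)) hsS
    _ = 8 * (ε / 8) := by ring
    _ = ε := ENNReal.mul_div_cancel (by simp) (by simp)

end UniformTail

section Ray

variable {V : Space N → ℝ} {a R : ℝ}

/-- Fundamental theorem of calculus along the ray, then Cauchy–Schwarz against the constant 1. -/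
lemma enorm_ray_sub_sq_le (hV : ContDiffOn ℝ 1 V (halfBall N R)) {θ : Space N}
    (hθ : ‖θ‖ = 1 ∧ 0 < θ 0) {r s : ℝ} (hr : 0 < r) (hrs : r ≤ s) (hs : s < R) :
    ‖V (s • θ) - V (r • θ)‖ₑ ^ 2 ≤
      ENNReal.ofReal (s - r) * ∫⁻ t in Ioc r s, ‖gradient V (t • θ)‖ₑ ^ 2 := by
  have hI : ∀ t ∈ Icc r s, t ∈ Ioo 0 R := fun t ht => ⟨hr.trans_le ht.1, ht.2.trans_lt hs⟩
  have hgc : ContinuousOn (fun t : ℝ => gradient V (t • θ)) (Icc r s) :=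
    (continuousOn_ray (continuousOn_gradient (isOpen_halfBall R) hV) hθ).mono hI
  have hftc : ∫ t in r..s, inner ℝ θ (gradient V (t • θ)) = V (s • θ) - V (r • θ) := by
    refine intervalIntegral.integral_eq_sub_of_hasDerivAt (f := fun t => V (t • θ)) (fun t ht => ?_) ?_
    · rw [uIcc_of_le hrs] at ht
      exact hasDerivAt_ray hV hθ (hI t ht)
    · refine ContinuousOn.intervalIntegrable ?_
      rw [uIcc_of_le hrs]
      exact continuousOn_const.inner (𝕜 := ℝ) hgc
  rw [← hftc, intervalIntegral.integral_of_le hrs]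
  have hm : AEMeasurable (fun t : ℝ => ‖gradient V (t • θ)‖ₑ) (volume.restrict (Ioc r s)) :=
    ((hgc.mono Ioc_subset_Icc_self).aestronglyMeasurable measurableSet_Ioc).enorm
  calc _ ≤ (∫⁻ t in Ioc r s, 1 * ‖gradient V (t • θ)‖ₑ) ^ 2 := by
        refine pow_le_pow_left₀ zero_le ((enorm_integral_le_lintegral_enorm _).trans
          (lintegral_mono fun t => ?_)) 2
        rw [one_mul, ← ofReal_norm, ← ofReal_norm]
        refine ENNReal.ofReal_le_ofReal ((norm_inner_le_norm _ _).trans ?_)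
        rw [hθ.1, one_mul]
    _ ≤ _ := (sq_lintegral_mul_le _ aemeasurable_const hm).trans (by simp)

lemma lintegral_sphere_sub_sq_le (hV : ContDiffOn ℝ 1 V (halfBall N R)) {r s : ℝ} (hr : 0 < r)
    (hrs : r ≤ s) (hs : s < R) :
    ∫⁻ θ, ‖V (s • θ) - V (r • θ)‖ₑ ^ 2 ∂(weightedSphere N a 1) ≤
      ENNReal.ofReal (s - r) * ∫⁻ t in Ioc r s,
        ∫⁻ θ, ‖gradient V (t • θ)‖ₑ ^ 2 ∂(weightedSphere N a 1) := by
  have hg := continuousOn_gradient (isOpen_halfBall R) hV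
  have hm : AEMeasurable (Function.uncurry fun (t : ℝ) (θ : Space N) => ‖gradient V (t • θ)‖ₑ ^ 2)
      ((volume.restrict (Ioc r s)).prod (weightedSphere N a 1)) := by
    obtain ⟨ρ, hsρ, hρR⟩ := exists_between hs
    have h1 : AEStronglyMeasurable (gradient V) (weightedVolume a (halfBall N ρ)) :=
      aestronglyMeasurable_of_continuousOn a (hg.mono (halfBall_mono hρR.le))
    exact (h1.comp_quasiMeasurePreserving
      (quasiMeasurePreserving_shell a hr hrs hsρ)).enorm.pow_const 2
  rw [lintegral_lintegral_swap hm, ← lintegral_const_mul' _ _ ENNReal.ofReal_ne_top]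
  refine lintegral_mono_ae ?_
  filter_upwards [ae_weightedSphere_one N a] with θ hθ using enorm_ray_sub_sq_le hV hθ hr hrs hs

/-- No tail bound for `V` itself is needed: slices of the gradient are bounded in `L²` locally
uniformly, so slices of `V` are Lipschitz in the radius. -/
lemma UniformTail.tendsto_value (ha : -1 < a) (hT : UniformTail a R (gradient V))
    (hV : ContDiffOn ℝ 1 V (halfBall N R)) {r : ℝ} (hr : r ∈ Ioo 0 R) :
    Tendsto (fun s => ∫⁻ θ, ‖V (s • θ) - V (r • θ)‖ₑ ^ 2 ∂(weightedSphere N a 1)) (𝓝 r) (𝓝 0) := by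
  obtain ⟨r₂, hr₂, hr₂R⟩ := exists_between hr.2
  have hr₁ : 0 < r / 2 := half_pos hr.1
  have hr₁r : r / 2 < r := half_lt_self hr.1
  obtain ⟨K, hK, hle⟩ := hT.exists_lintegral_le ha (continuousOn_gradient (isOpen_halfBall R) hV)
    hr₁ (hr₁r.trans hr₂).le hr₂R
  have key : ∀ s t : ℝ, r / 2 ≤ s → s ≤ t → t ≤ r₂ →
      ∫⁻ θ, ‖V (t • θ) - V (s • θ)‖ₑ ^ 2 ∂(weightedSphere N a 1) ≤
        ENNReal.ofReal |t - s| * (K * ENNReal.ofReal |t - s|) := by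
    intro s t hs hst ht
    rw [abs_of_nonneg (sub_nonneg.2 hst)]
    refine (lintegral_sphere_sub_sq_le hV (hr₁.trans_le hs) hst (ht.trans_lt hr₂R)).trans
      (mul_le_mul_right ?_ _)
    calc _ ≤ ∫⁻ _ in Ioc s t, K := setLIntegral_mono' measurableSet_Ioc fun x hx =>
          hle x ⟨hs.trans hx.1.le, hx.2.trans ht⟩
      _ = _ := by rw [setLIntegral_const, Real.volume_Ioc]
  have hlim : Tendsto (fun s => ENNReal.ofReal |s - r| * (K * ENNReal.ofReal |s - r|)) (𝓝 r) (𝓝 0) := by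
    have h1 : Tendsto (fun s : ℝ => ENNReal.ofReal |s - r|) (𝓝 r) (𝓝 0) := by
      have : Continuous fun s : ℝ => ENNReal.ofReal |s - r| :=
        ENNReal.continuous_ofReal.comp (by fun_prop)
      simpa using this.tendsto r
    have h2 := ENNReal.Tendsto.const_mul h1 (Or.inr hK)
    rw [mul_zero] at h2
    simpa using ENNReal.Tendsto.mul h1 (Or.inr (by simp)) h2 (Or.inr (by simp))
  refine tendsto_of_tendsto_of_tendsto_of_le_of_le' tendsto_const_nhds hlim
    (Eventually.of_forall fun _ => zero_le) ?_
  filter_upwards [Icc_mem_nhds hr₁r hr₂] with s hs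
  rcases le_total s r with h | h
  · rw [lintegral_enorm_sub_sq_comm, abs_sub_comm]
    exact key s r hs.1 h hr₂.le
  · exact key r s hr₁r.le h hs.2

end Ray

/-! ### The Weiss identity at every radius -/

section Conclusion

variable {V : Space N → ℝ} {a R : ℝ} {r : ℝ}

/-- The density of the energy is now continuous in the radius, so its primitive is differentiable
everywhere. -/
lemma UniformTail.hasDerivAt_energyD (ha : -1 < a) (hT : UniformTail a R (gradient V))
    (hV : ContDiffOn ℝ 1 V (halfBall N R)) (hVg : HasH1LocGradient a R V (gradient V))
    (hr : r ∈ Ioo 0 R) : HasDerivAt (fun s => energyD a s (gradient V))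
      (r ^ (N + a) * ∫ θ, ‖gradient V (r • θ)‖ ^ 2 ∂(weightedSphere N a 1)) r := by
  have hg := continuousOn_gradient (isOpen_halfBall R) hV
  have hcont : ContinuousOn (fun s => s ^ (N + a) *
      ∫ θ, ‖gradient V (s • θ)‖ ^ 2 ∂(weightedSphere N a 1)) (Ioo 0 R) := by
    intro s hs
    refine (ContinuousAt.mul (Real.continuousAt_rpow_const _ _ (Or.inl hs.1.ne')) ?_).continuousWithinAt
    have hm : ∀ᶠ t in 𝓝 s, MemLp (fun θ => gradient V (t • θ)) 2 (weightedSphere N a 1) := by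
      filter_upwards [isOpen_Ioo.mem_nhds hs] with t ht using hT.memLp ha hg ht
    have := tendsto_integral_inner hm hm (hT.memLp ha hg hs) (hT.memLp ha hg hs)
      (hT.tendsto ha hg hs) (hT.tendsto ha hg hs)
    simp only [real_inner_self_eq_norm_sq] at this
    exact this
  obtain ⟨ρ, hrρ, hρR⟩ := exists_between hr.2
  have hG := (hVg ρ ⟨hr.1.trans hrρ, hρR⟩).2.1
  have hi := (intervalIntegrable_energy (hr.1.trans hrρ) hG).mono_set (c := 0) (d := r) (by
    rw [uIcc_of_le hr.1.le, uIcc_of_le (hr.1.trans hrρ).le]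
    exact Icc_subset_Icc_right hrρ.le)
  have := intervalIntegral.integral_hasDerivAt_right hi
    (hcont.stronglyMeasurableAtFilter isOpen_Ioo r hr) (hcont.continuousAt (isOpen_Ioo.mem_nhds hr))
  refine this.congr_of_eventuallyEq ?_
  filter_upwards [isOpen_Ioo.mem_nhds (⟨hr.1, hrρ⟩ : r ∈ Ioo 0 ρ)] with s hs using energyD_eq hs hG

lemma UniformTail.hasDerivAt_height (ha : -1 < a) (hT : UniformTail a R (gradient V))
    (hV : ContDiffOn ℝ 1 V (halfBall N R)) (hVg : HasH1LocGradient a R V (gradient V))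
    {T : ℝ → Space N → ℝ} (hTr : ∀ r ∈ Ioo 0 R, IsTrace a R V (gradient V) r (T r))
    (hr : r ∈ Ioo 0 R) : HasDerivAt (fun s => ∫ θ, T s (s • θ) ^ 2 ∂(weightedSphere N a 1))
      (∫ θ, 2 * (V (r • θ) * inner ℝ θ (gradient V (r • θ))) ∂(weightedSphere N a 1)) r := by
  have hg := continuousOn_gradient (isOpen_halfBall R) hV
  have hVm : ∀ s ∈ Ioo 0 R, MemLp (fun θ => V (s • θ)) 2 (weightedSphere N a 1) := fun s hs =>
    ((hTr s hs).memLp hs.1).ae_eq ((hTr s hs).ae_eq_of_contDiffOn hs hVg hV).symm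
  have hGm : ∀ s ∈ Ioo 0 R, MemLp (fun θ => inner ℝ θ (gradient V (s • θ))) 2
      (weightedSphere N a 1) := by
    intro s hs
    have hG := hT.memLp ha hg hs
    refine hG.mono (measurable_id.aestronglyMeasurable.inner hG.1) ?_
    filter_upwards [ae_weightedSphere_one N a] with θ hθ
    refine (norm_inner_le_norm _ _).trans ?_
    rw [hθ.1, one_mul]
  have hGt : ∀ s ∈ Ioo 0 R, Tendsto (fun t => ∫⁻ θ, ‖inner ℝ θ (gradient V (t • θ)) -
      inner ℝ θ (gradient V (s • θ))‖ₑ ^ 2 ∂(weightedSphere N a 1)) (𝓝 s) (𝓝 0) := by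
    intro s hs
    refine tendsto_of_tendsto_of_tendsto_of_le_of_le tendsto_const_nhds (hT.tendsto ha hg hs)
      (fun _ => zero_le) fun t => lintegral_mono_ae ?_
    filter_upwards [ae_weightedSphere_one N a] with θ hθ
    rw [← inner_sub_right, ← ofReal_norm, ← ofReal_norm]
    refine pow_le_pow_left₀ zero_le (ENNReal.ofReal_le_ofReal ((norm_inner_le_norm _ _).trans ?_)) 2
    rw [hθ.1, one_mul]
  have hcont : ContinuousOn (fun s => ∫ θ, 2 * (V (s • θ) * inner ℝ θ (gradient V (s • θ)))
      ∂(weightedSphere N a 1)) (Ioo 0 R) := by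
    intro s hs
    refine ContinuousAt.continuousWithinAt ?_
    have := tendsto_integral_inner
      (by filter_upwards [isOpen_Ioo.mem_nhds hs] with t ht using hGm t ht)
      (by filter_upwards [isOpen_Ioo.mem_nhds hs] with t ht using hVm t ht)
      (hGm s hs) (hVm s hs) (hGt s hs) (hT.tendsto_value ha hV hs)
    have h2 := this.const_mul 2
    simp only [← integral_const_mul] at h2
    exact h2
  obtain ⟨ρ, hrρ, hρR⟩ := exists_between hr.2
  have hr₁ : 0 < r / 2 := half_pos hr.1
  have hr₁r : r / 2 < r := half_lt_self hr.1
  have := (intervalIntegral.integral_hasDerivAt_right (height_sub hVg hTr hr₁ hr₁r.le hr.2).1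
    (hcont.stronglyMeasurableAtFilter isOpen_Ioo r hr)
    (hcont.continuousAt (isOpen_Ioo.mem_nhds hr))).const_add
      (∫ θ, T (r / 2) ((r / 2) • θ) ^ 2 ∂(weightedSphere N a 1))
  refine this.congr_of_eventuallyEq ?_
  filter_upwards [isOpen_Ioo.mem_nhds (⟨hr₁r, hr.2⟩ : r ∈ Ioo (r / 2) R)] with s hs
  rw [← (height_sub hVg hTr hr₁ hs.1.le hs.2).2]
  ring

lemma gradient_comp_smul {φ : Space N → ℝ} {ρ c : ℝ} (hφ : ContDiffOn ℝ 1 φ (halfBall N ρ))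
    {Y : Space N} (hY : c • Y ∈ halfBall N ρ) :
    gradient (fun Y => φ (c • Y)) Y = c • gradient φ (c • Y) := by
  have h1 := (hasGradientAt_of_contDiffOn (isOpen_halfBall ρ) hφ hY).hasFDerivAt
  have h2 : HasFDerivAt (fun Y : Space N => c • Y) (c • ContinuousLinearMap.id ℝ (Space N)) Y :=
    (hasFDerivAt_id Y).const_smul c
  have h3 := HasFDerivAt.comp (f := fun Y : Space N => c • Y) Y h1 h2
  refine HasGradientAt.gradient (hasGradientAt_iff_hasFDerivAt.2 (h3.congr_fderiv ?_))
  ext v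
  simp

/-- Approximation on every half-sphere, by dilation of approximations on nearby ones. -/
lemma UniformTail.sphereApprox (ha : -1 < a) (hT : UniformTail a R (gradient V))
    (hV : ContDiffOn ℝ 1 V (halfBall N R)) (hVg : HasH1LocGradient a R V (gradient V))
    (hr : r ∈ Ioo 0 R) : SphereApprox a r V (gradient V) := by
  intro ε hε
  have hg := continuousOn_gradient (isOpen_halfBall R) hV
  set K := ∫⁻ θ, ‖gradient V (r • θ)‖ₑ ^ 2 ∂(weightedSphere N a 1) with hK
  have hKt : K ≠ ⊤ := (MemLp.lintegral_sq_lt_top (hT.memLp ha hg hr)).ne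
  -- The gradient error splits into three terms, and squaring costs a factor 3, so `9 · ε/10 < ε` is
  -- needed; the values need only `4 · ε/10`.
  have hη : 0 < ε / 10 := ENNReal.div_pos hε.ne' (by simp)
  have hlim : Tendsto (fun s => ENNReal.ofReal (|s / r - 1| ^ 2) * K) (𝓝 r) (𝓝 0) := by
    have h1 : Continuous fun s : ℝ => ENNReal.ofReal (|s / r - 1| ^ 2) :=
      ENNReal.continuous_ofReal.comp (by fun_prop)
    have h2 := h1.tendsto r
    rw [div_self hr.1.ne', sub_self, abs_zero, zero_pow two_ne_zero, ENNReal.ofReal_zero] at h2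
    simpa using ENNReal.Tendsto.mul_const h2 (Or.inr hKt)
  have hev : ∀ᶠ s in 𝓝 r, s ∈ Ioo 0 R ∧
      ∫⁻ θ, ‖V (s • θ) - V (r • θ)‖ₑ ^ 2 ∂(weightedSphere N a 1) < ε / 10 ∧
      ∫⁻ θ, ‖gradient V (s • θ) - gradient V (r • θ)‖ₑ ^ 2 ∂(weightedSphere N a 1) < ε / 10 ∧
      ENNReal.ofReal (|s / r - 1| ^ 2) * K < ε / 10 := by
    filter_upwards [isOpen_Ioo.mem_nhds hr, (hT.tendsto_value ha hV hr).eventually (gt_mem_nhds hη),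
      (hT.tendsto ha hg hr).eventually (gt_mem_nhds hη), hlim.eventually (gt_mem_nhds hη)]
      with s h1 h2 h3 h4 using ⟨h1, h2, h3, h4⟩
  obtain ⟨l, u, ⟨hl, hu⟩, hlu⟩ := mem_nhds_iff_exists_Ioo_subset.1 hev
  -- Good radii have full measure, hence are dense. One is taken below `r`, so that `c = s/r ≤ 1`
  -- and the dilation does not increase the gradient error.
  obtain ⟨s, hsd, hs⟩ := (Measure.dense_of_ae (ae_sphereApprox hVg)).exists_mem_open
    (isOpen_Ioo (a := l) (b := r)) (nonempty_Ioo.2 hl)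
  obtain ⟨hsR, h1, h2, h3⟩ := hlu ⟨hs.1, hs.2.trans hu⟩
  obtain ⟨ρ, hρ, φ, hφ, h4, h5⟩ := hsd hsR (ε / 10) hη
  have hs0 := hsR.1
  have hr0 := hr.1
  set c := s / r with hc
  have hc0 : 0 < c := div_pos hs0 hr0
  have hc1 : c ≤ 1 := (div_le_one hr0).2 hs.2.le
  have hcr : ∀ θ : Space N, c • r • θ = s • θ := fun θ => by
    rw [smul_smul, hc, div_mul_cancel₀ _ hr0.ne']
  have hmaps : MapsTo (fun Y : Space N => c • Y) (halfBall N (ρ / c)) (halfBall N ρ) := by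
    intro Y hY
    refine ⟨?_, ?_⟩
    · have : (c • Y) 0 = c * Y 0 := by simp
      rw [this]
      exact mul_pos hc0 hY.1
    · rw [norm_smul, Real.norm_of_nonneg hc0.le, mul_comm]
      exact (lt_div_iff₀ hc0).1 hY.2
  have hφ1 : ContDiffOn ℝ 1 φ (halfBall N ρ) := hφ.of_le (by exact_mod_cast le_top)
  have hten : 10 * (ε / 10) = ε := ENNReal.mul_div_cancel (by simp) (by simp)
  have hmV : ∀ t ∈ Ioo 0 R, AEStronglyMeasurable (fun θ => V (t • θ)) (weightedSphere N a 1) :=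
    fun t ht => aestronglyMeasurable_sphere_of_continuousOn a hV.continuousOn ht
  have hmG : ∀ t ∈ Ioo 0 R, AEStronglyMeasurable (fun θ => gradient V (t • θ)) (weightedSphere N a 1) :=
    fun t ht => aestronglyMeasurable_sphere_of_continuousOn a hg ht
  have hmφ : AEStronglyMeasurable (fun θ => φ (s • θ)) (weightedSphere N a 1) :=
    aestronglyMeasurable_sphere_of_continuousOn a hφ.continuousOn ⟨hs0, hρ⟩
  have hmφ' : AEStronglyMeasurable (fun θ => gradient φ (s • θ)) (weightedSphere N a 1) :=
    aestronglyMeasurable_sphere_of_continuousOn a (continuousOn_gradient (isOpen_halfBall ρ) hφ1)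
      ⟨hs0, hρ⟩
  -- The dilate `Y ↦ φ (cY)` takes on `H_r` the values of `φ` on `H_s`, and it is smooth on a
  -- half-ball larger than `D_r` because `ρ > s`.
  refine ⟨ρ / c, ?_, fun Y => φ (c • Y), hφ.comp (contDiff_const_smul c).contDiffOn hmaps, ?_, ?_⟩
  · rw [gt_iff_lt, lt_div_iff₀ hc0, hc, mul_div_cancel₀ _ hr0.ne']
    exact hρ
  · simp only [hcr]
    have e := lintegral_enorm_add_sq_le (μ := weightedSphere N a 1)
      (f := fun θ => φ (s • θ) - V (s • θ)) (g := fun θ => V (s • θ) - V (r • θ))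
      (hmφ.sub (hmV s hsR))
    simp only [sub_add_sub_cancel] at e
    refine e.trans_lt (lt_of_lt_of_le (ENNReal.mul_lt_mul_right (by simp) (by simp)
      (ENNReal.add_lt_add h4 h1)) ?_)
    calc 2 * (ε / 10 + ε / 10) = 4 * (ε / 10) := by ring
      _ ≤ 10 * (ε / 10) := by gcongr; norm_num
      _ = ε := hten
  · have e : ∀ᵐ θ ∂(weightedSphere N a 1),
        ‖gradient (fun Y => φ (c • Y)) (r • θ) - gradient V (r • θ)‖ₑ ^ 2 ≤
        3 * (‖gradient φ (s • θ) - gradient V (s • θ)‖ₑ ^ 2 +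
          ‖gradient V (s • θ) - gradient V (r • θ)‖ₑ ^ 2 +
          ENNReal.ofReal (|c - 1| ^ 2) * ‖gradient V (r • θ)‖ₑ ^ 2) := by
      filter_upwards [ae_weightedSphere_one N a] with θ hθ
      have hsθ : s • θ ∈ halfBall N ρ := smul_mem_halfBall hθ ⟨hs0, hρ⟩
      rw [gradient_comp_smul hφ1 (by rw [hcr]; exact hsθ), hcr]
      have e1 : c • gradient φ (s • θ) - gradient V (r • θ) =
          c • (gradient φ (s • θ) - gradient V (s • θ)) +
          c • (gradient V (s • θ) - gradient V (r • θ)) + (c - 1) • gradient V (r • θ) := by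
        module
      have hcle : ∀ x : Space N, ‖c • x‖ₑ ≤ ‖x‖ₑ := fun x => by
        rw [← ofReal_norm, ← ofReal_norm, norm_smul, Real.norm_of_nonneg hc0.le]
        exact ENNReal.ofReal_le_ofReal (mul_le_of_le_one_left (norm_nonneg _) hc1)
      have h6 : ‖(c - 1) • gradient V (r • θ)‖ₑ ^ 2 =
          ENNReal.ofReal (|c - 1| ^ 2) * ‖gradient V (r • θ)‖ₑ ^ 2 := by
        rw [enorm_smul, mul_pow, enorm_sq_eq_ofReal, Real.norm_eq_abs]
      rw [e1, ← h6]
      calc _ ≤ (‖c • (gradient φ (s • θ) - gradient V (s • θ))‖ₑ +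
            ‖c • (gradient V (s • θ) - gradient V (r • θ))‖ₑ + ‖(c - 1) • gradient V (r • θ)‖ₑ) ^ 2 :=
            pow_le_pow_left₀ zero_le ((enorm_add_le _ _).trans
              (add_le_add_left (enorm_add_le _ _) _)) 2
        _ ≤ _ := (sq_add_three_le _ _ _).trans (by gcongr <;> exact hcle _)
    refine (lintegral_mono_ae e).trans_lt ?_
    have hmA : AEMeasurable (fun θ => ‖gradient φ (s • θ) - gradient V (s • θ)‖ₑ ^ 2)
        (weightedSphere N a 1) := (hmφ'.sub (hmG s hsR)).enorm.pow_const 2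
    have hmB : AEMeasurable (fun θ => ‖gradient V (s • θ) - gradient V (r • θ)‖ₑ ^ 2)
        (weightedSphere N a 1) := ((hmG s hsR).sub (hmG r hr)).enorm.pow_const 2
    have hmAB : AEMeasurable (fun θ => ‖gradient φ (s • θ) - gradient V (s • θ)‖ₑ ^ 2 +
        ‖gradient V (s • θ) - gradient V (r • θ)‖ₑ ^ 2) (weightedSphere N a 1) := hmA.add hmB
    rw [lintegral_const_mul' _ _ (by simp), lintegral_add_left' hmAB,
      lintegral_add_left' hmA, lintegral_const_mul' _ _ ENNReal.ofReal_ne_top]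
    refine (ENNReal.mul_lt_mul_right (by simp) (by simp)
      (ENNReal.add_lt_add (ENNReal.add_lt_add h5 h2) h3)).trans_le ?_
    calc 3 * (ε / 10 + ε / 10 + ε / 10) = 9 * (ε / 10) := by ring
      _ ≤ 10 * (ε / 10) := by gcongr; norm_num
      _ = ε := hten

lemma weissIdentityAt_gradient {h : ℝ} (ha : a ∈ Ioo (-1 : ℝ) 1) (hA : 0 < expA N a h)
    {G : Space N → Space N} (hVG : HasH1LocGradient a R V G) {T : ℝ → Space N → ℝ}
    (hTG : ∀ r ∈ Ioo 0 R, IsTrace a R V G r (T r)) (hV : ContDiffOn ℝ 2 V (halfBall N R))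
    (hf : ∀ ρ ∈ Ioo 0 R, MemLp (weightedLaplacian a V) 2 (weightedVolume a (halfBall N ρ)))
    (hbd : ∃ ε₀ > 0, ∃ M : ℝ, ∀ Y ∈ halfBall N R, Y 0 < ε₀ → |(Y 0) ^ a * gradient V Y 0| ≤ M)
    (hr : r ∈ Ioo 0 R) : WeissIdentityAt a h T (gradient V) r := by
  have hV1 : ContDiffOn ℝ 1 V (halfBall N R) := hV.of_le (by norm_num)
  have hVg := hVG.of_contDiffOn hV1
  have hTr : ∀ r ∈ Ioo 0 R, IsTrace a R V (gradient V) r (T r) := fun r hr =>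
    (hTG r hr).of_contDiffOn hr.1 hVG hV1
  have hT : UniformTail a R (gradient V) := fun r₁ r₂ h₁ h₁₂ h₂ η hη =>
    exists_gradient_tail_le ha hV hf hbd h₁ h₁₂ h₂ hη
  have heq := (hTr r hr).ae_eq_of_contDiffOn hr hVg hV1
  refine weissIdentityAt_of_hasDerivAt hr.1 hA ((hT.sphereApprox ha.1 hV1 hVg hr).congr heq)
    ((hTr r hr).memLp hr.1) (hT.memLp ha.1 (continuousOn_gradient (isOpen_halfBall R) hV1) hr)
    (hT.hasDerivAt_energyD ha.1 hV1 hVg hr) ?_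
  convert hT.hasDerivAt_height ha.1 hV1 hVg hTr hr using 1
  refine integral_congr_ae ?_
  filter_upwards [heq] with θ hθ
  rw [hθ]

end Conclusion

end EllipticWeiss

end

theorem mainTheorem7 (N : ℕ) (hN : 1 ≤ N) (a : ℝ) (ha : a ∈ Set.Ioo (-1 : ℝ) 1)
    (R : ℝ) (hR : 0 < R) (h : ℝ) (hh : 0 < h) (hA : 0 < EllipticWeiss.expA N a h)
    (V : EllipticWeiss.Space N → ℝ) (G : EllipticWeiss.Space N → EllipticWeiss.Space N)
    (hV : EllipticWeiss.HasH1LocGradient a R V G) :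
    (∀ r ∈ Set.Ioo 0 R, ∃ u, EllipticWeiss.IsTrace a R V G r u) ∧
    ∀ T : ℝ → EllipticWeiss.Space N → ℝ,
      (∀ r ∈ Set.Ioo 0 R, EllipticWeiss.IsTrace a R V G r (T r)) →
      (∀ᵐ r ∂(MeasureTheory.volume : MeasureTheory.Measure ℝ), r ∈ Set.Ioo 0 R →
        EllipticWeiss.WeissIdentityAt a h T G r) ∧
      (ContDiffOn ℝ 2 V (EllipticWeiss.halfBall N R) →
        (∀ ρ ∈ Set.Ioo 0 R, MeasureTheory.MemLp (EllipticWeiss.weightedLaplacian a V) 2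
          (EllipticWeiss.weightedVolume a (EllipticWeiss.halfBall N ρ))) →
        EllipticWeiss.EllipticBC a R V →
        ∀ r ∈ Set.Ioo 0 R, EllipticWeiss.WeissIdentityAt a h T (gradient V) r) := by
  refine ⟨fun r hr => EllipticWeiss.exists_isTrace hV hr, fun T hT =>
    ⟨EllipticWeiss.ae_weissIdentityAt hA hV hT, ?_⟩⟩
  exact fun hV2 hf hbc r hr =>
    EllipticWeiss.weissIdentityAt_gradient ha hA hV hT hV2 hf hbc.1 hr
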